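/- Let $\Omega=(a,b)$ with $a<b$, let $\beta\in\mathbb R$ and $\sigma\ge 1$, and let $V\in H^2_{\rm per}(\Omega)$ be real-valued. Here $H^m_{\rm per}(\Omega)=\{\phi\in H^m(\Omega):\phi^{(k)}(a)=\phi^{(k)}(b),\ k=0,\dots,m-1\}$. Put $B(v)=Vv+\beta|v|^{2\sigma}v$. Let $T>0$ and let $$\psi\in C([0,T];H^4_{\rm per}(\Omega))\cap C^1([0,T];H^2(\Omega))\cap C^2([0,T];L^2(\Omega))$$ be a solution on $[0,T]$ of the nonlinear Schrödinger equation $i\,\partial_t\psi=-\Delta\psi+B(\psi)$ with $\psi(\cdot,0)=\psi_0$. For an even integer $N>0$ let $h=(b-a)/N$, $\mathcal T_N=\{-N/2,\dots,N/2-1\}$, $\mu_l=2\pi l/(b-a)$ and $\widehat u_l=\frac1{b-a}\int_a^b u(x)e^{-i\mu_l(x-a)}\,dx$. For a time step $\tau>0$ let $t_n=n\tau$. With $\varphi_1(z)=(e^z-1)/z$ and $\varphi_s(\theta)=\sin(\theta)/\theta$ (both equal to $1$ at $0$), define $\psi_h^n\in X_N=\mathrm{span}\{e^{i\mu_l(x-a)}:l\in\mathcal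 T_N\}$, $n\ge0$, by its Fourier coefficients: for $l\in\mathcal T_N$, $$\widehat{(\psi_h^0)}_l=\widehat{(\psi_0)}_l,\qquad \widehat{(\psi_h^1)}_l=e^{-i\tau\mu_l^2}\widehat{(\psi_h^0)}_l-i\tau\varphi_1(-i\tau\mu_l^2)\widehat{(B(\psi_h^0))}_l,$$ $$\widehat{(\psi_h^{n+1})}_l=e^{-2i\tau\mu_l^2}\widehat{(\psi_h^{n-1})}_l-2i\tau e^{-i\tau\mu_l^2}\varphi_s(\tau\mu_l^2)\widehat{(B(\psi_h^n))}_l,\quad n\ge1 .$$ Then there exist $\tau_0>0$, $h_0>0$ and $C>0$ such that for all $\tau$ with $0<\tau<\tau_0$, all even $N>0$ with $h=(b-a)/N<h_0$, and all integers $n$ with $0\le n\le T/\tau$, $$\|\psi(\cdot,t_n)-\psi_h^n\|_{L^2(\Omega)}\le C(\tau^2+h^4),\qquad \|\psi(\cdot,t_n)-\psi_h^n\|_{H^1(\Omega)}\le C(\tau^{3/2}+h^3).$$ The constants $\tau_0,h_0,C$ do not depend on $\tau$, $h$ or $n$, and no relation between $\tau$ and $h$ is assumed. -/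

import Mathlib

open MeasureTheory Set Filter Topology
open scoped ENNReal ContDiff

noncomputable section

namespace SEWI

/-- Lebesgue measure on the interval `Ω = (a, b)`. -/
abbrev vol (a b : ℝ) : Measure ℝ := volume.restrict (Ioo a b)

/-- The complex space `L²(Ω)`, `Ω = (a, b)`. -/
abbrev L2 (a b : ℝ) : Type := Lp ℂ 2 (vol a b)

/-- `φ` is a test function on `Ω = (a, b)`: smooth, with compact support contained in `Ω`. -/
def IsTest (a b : ℝ) (φ : ℝ → ℂ) : Prop :=
  ContDiff ℝ ∞ φ ∧ HasCompactSupport φ ∧ tsupport φ ⊆ Ioo a b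

/-- `v` is the weak derivative of `u` on `Ω = (a, b)`. -/
def IsWeakDeriv (a b : ℝ) (u v : ℝ → ℂ) : Prop :=
  ∀ φ : ℝ → ℂ, IsTest a b φ →
    ∫ x in Ioo a b, u x * deriv φ x = - ∫ x in Ioo a b, v x * φ x

theorem IsTest.memLp {a b : ℝ} {φ : ℝ → ℂ} (h : IsTest a b φ) : MemLp φ 2 (vol a b) :=
  (h.1.continuous.memLp_of_hasCompactSupport (μ := volume) h.2.1).restrict _

theorem IsTest.memLp_deriv {a b : ℝ} {φ : ℝ → ℂ} (h : IsTest a b φ) :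
    MemLp (deriv φ) 2 (vol a b) :=
  (((h.1.continuous_deriv (by simp)).memLp_of_hasCompactSupport (μ := volume)
    h.2.1.deriv)).restrict _

theorem integral_add_mul {a b : ℝ} (u v : L2 a b) {φ : ℝ → ℂ} (h : MemLp φ 2 (vol a b)) :
    ∫ x in Ioo a b, (u + v : L2 a b) x * φ x
      = (∫ x in Ioo a b, u x * φ x) + ∫ x in Ioo a b, v x * φ x := by
  have hu : Integrable (fun x => u x * φ x) (vol a b) := (Lp.memLp u).integrable_mul h
  have hv : Integrable (fun x => v x * φ x) (vol a b) := (Lp.memLp v).integrable_mul h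
  rw [← integral_add hu hv]
  refine integral_congr_ae ?_
  filter_upwards [Lp.coeFn_add u v] with x hx
  rw [hx, Pi.add_apply, add_mul]

theorem integral_smul_mul {a b : ℝ} (c : ℂ) (u : L2 a b) (φ : ℝ → ℂ) :
    ∫ x in Ioo a b, (c • u : L2 a b) x * φ x = c * ∫ x in Ioo a b, u x * φ x := by
  rw [← integral_const_mul]
  refine integral_congr_ae ?_
  filter_upwards [Lp.coeFn_smul c u] with x hx
  simp [hx, mul_assoc]

theorem integral_zero_mul {a b : ℝ} (φ : ℝ → ℂ) :
    ∫ x in Ioo a b, (0 : L2 a b) x * φ x = 0 := by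
  refine integral_eq_zero_of_ae ?_
  filter_upwards [Lp.coeFn_zero ℂ 2 (vol a b)] with x hx
  rw [hx, Pi.zero_apply, zero_mul]

/-- The Sobolev space `H^m(Ω)`, `Ω = (a, b)`. An element is stored as the tuple
`(u, u', …, u^{(m)})` of an `L²` function and its weak derivatives, all of them in `L²(Ω)`; the
norm it inherits is the usual one, `‖u‖² = ∑_{k ≤ m} ‖u^{(k)}‖²_{L²}`. -/
def Hm (a b : ℝ) (m : ℕ) : Submodule ℂ (PiLp 2 (fun _ : Fin (m + 1) => L2 a b)) where
  carrier := {g | ∀ k : Fin m, IsWeakDeriv a b (g k.castSucc) (g k.succ)}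
  add_mem' := by
    intro u v hu hv k φ hφ
    rw [PiLp.add_apply, PiLp.add_apply, integral_add_mul _ _ hφ.memLp,
      integral_add_mul _ _ hφ.memLp_deriv, hu k φ hφ, hv k φ hφ]
    ring
  zero_mem' := by
    intro k φ _
    rw [PiLp.zero_apply, PiLp.zero_apply, integral_zero_mul, integral_zero_mul, neg_zero]
  smul_mem' := by
    intro c u hu k φ hφ
    rw [PiLp.smul_apply, PiLp.smul_apply, integral_smul_mul, integral_smul_mul, hu k φ hφ]
    ring

/-- The weak derivative `w^{(k)} ∈ L²(Ω)` (`k ≤ m`) of `w ∈ H^m(Ω)`. -/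
def wderiv {a b : ℝ} {m : ℕ} (w : Hm a b m) (k : Fin (m + 1)) : L2 a b := w.1 k

/-- The element of `L²(Ω)` underlying `w ∈ H^m(Ω)`. -/
def toL2 {a b : ℝ} {m : ℕ} (w : Hm a b m) : L2 a b := wderiv w 0

/-- `w ∈ H^m(Ω)` lies in `H^m_per(Ω)`: `w^{(k)}(a) = w^{(k)}(b)` for `k = 0, …, m - 1`. The
boundary values are those of the representative of `w^{(k)}` that is continuous on `[a, b]`. -/
def IsPer {a b : ℝ} {m : ℕ} (w : Hm a b m) : Prop :=
  ∀ k : Fin m, ∃ v : ℝ → ℂ, ContinuousOn v (Icc a b) ∧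
    wderiv w k.castSucc =ᵐ[vol a b] v ∧ v a = v b

/-- The function `u` belongs to `H^m_per(Ω)`. -/
def MemHper (a b : ℝ) (m : ℕ) (u : ℝ → ℂ) : Prop :=
  ∃ w : Hm a b m, toL2 w =ᵐ[vol a b] u ∧ IsPer w

/-- The `H^m(Ω)` norm of a function on `Ω = (a, b)`; it is `∞` outside `H^m(Ω)`. -/
def HmNorm (a b : ℝ) (m : ℕ) (u : ℝ → ℂ) : ℝ≥0∞ :=
  ⨅ (w : Hm a b m) (_ : toL2 w =ᵐ[vol a b] u), ‖w‖ₑ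

/-- `ψ ∈ C^j([0, T]; H^m(Ω))`. -/
def IsCjHm (a b T : ℝ) (j m : ℕ) (ψ : ℝ → L2 a b) : Prop :=
  ∃ Ψ : ℝ → Hm a b m, ContDiffOn ℝ j Ψ (Icc 0 T) ∧ ∀ t ∈ Icc 0 T, toL2 (Ψ t) = ψ t

/-- The power nonlinearity `f(ρ) = β ρ^σ`. -/
def f (β σ ρ : ℝ) : ℝ := β * ρ ^ σ

/-- The operator `B(v)(x) = V(x) v(x) + f(|v(x)|²) v(x)`. -/
def B (V : ℝ → ℝ) (β σ : ℝ) (v : ℝ → ℂ) (x : ℝ) : ℂ :=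
  (V x : ℂ) * v x + (f β σ (‖v x‖ ^ 2) : ℂ) * v x

/-- `ψ` solves `i ∂_t ψ = -Δψ + V ψ + f(|ψ|²) ψ` on `Ω × (0, T]` with `ψ(0) = ψ₀`; here `∂_t` is
the derivative of `ψ` as a map from `[0, T]` to `L²(Ω)`, and `Δψ(t)` the second weak derivative. -/
def IsNLSESolution (a b T : ℝ) (V : ℝ → ℝ) (β σ : ℝ) (ψ₀ : L2 a b) (ψ : ℝ → L2 a b) : Prop :=
  ψ 0 = ψ₀ ∧ DifferentiableOn ℝ ψ (Icc 0 T) ∧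
    ∀ t ∈ Ioc 0 T, ∃ w : Hm a b 2, toL2 w = ψ t ∧
      ∀ᵐ x ∂(vol a b), Complex.I * (derivWithin ψ (Icc 0 T) t : L2 a b) x
        = - wderiv w 2 x + B V β σ (ψ t) x

/-- The frequency `μ_l = 2πl / (b - a)`. -/
def freq (a b : ℝ) (l : ℤ) : ℝ := 2 * Real.pi * l / (b - a)

/-- The Fourier coefficient `û_l = (b - a)⁻¹ ∫_a^b u(x) e^{-i μ_l (x - a)} dx`. -/
def fourierCoef (a b : ℝ) (u : ℝ → ℂ) (l : ℤ) : ℂ :=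
  (1 / (b - a) : ℂ) *
    ∫ x in Ioo a b, u x * Complex.exp (-Complex.I * (freq a b l : ℂ) * ((x : ℂ) - a))

/-- The index set `T_N = {-N/2, …, N/2 - 1}` (`N` even). -/
def indexSet (N : ℕ) : Finset ℤ := Finset.Ico (-((N : ℤ) / 2)) ((N : ℤ) / 2)

/-- The element `∑_{l ∈ T_N} c_l e^{i μ_l (x - a)}` of `X_N` with Fourier coefficients `c`. -/
def trigPoly (a b : ℝ) (N : ℕ) (c : ℤ → ℂ) (x : ℝ) : ℂ :=
  ∑ l ∈ indexSet N, c l * Complex.exp (Complex.I * (freq a b l : ℂ) * ((x : ℂ) - a))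

/-- The entire function `φ₁(z) = (e^z - 1) / z`, `φ₁(0) = 1`. -/
def phi1 (z : ℂ) : ℂ := if z = 0 then 1 else (Complex.exp z - 1) / z

/-- The numerical solution `ψ_h^n ∈ X_N` of the sEWI Fourier spectral method with `N` modes, time
step `τ` and initial datum `ψ₀`, given by its Fourier coefficients of index `l ∈ T_N`. The function
`φ_s` is `Real.sinc`. -/
def psih (a b : ℝ) (V : ℝ → ℝ) (β σ : ℝ) (ψ₀ : ℝ → ℂ) (N : ℕ) (τ : ℝ) : ℕ → ℝ → ℂ
  | 0 => trigPoly a b N fun l => fourierCoef a b ψ₀ l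
  | 1 => trigPoly a b N fun l =>
      Complex.exp (-Complex.I * τ * (freq a b l : ℂ) ^ 2) *
          fourierCoef a b (psih a b V β σ ψ₀ N τ 0) l
        - Complex.I * τ * phi1 (-Complex.I * τ * (freq a b l : ℂ) ^ 2) *
          fourierCoef a b (B V β σ (psih a b V β σ ψ₀ N τ 0)) l
  | n + 2 => trigPoly a b N fun l =>
      Complex.exp (-2 * Complex.I * τ * (freq a b l : ℂ) ^ 2) *
          fourierCoef a b (psih a b V β σ ψ₀ N τ n) l
        - 2 * Complex.I * τ * Complex.exp (-Complex.I * τ * (freq a b l : ℂ) ^ 2) *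
          (Real.sinc (τ * freq a b l ^ 2) : ℂ) *
          fourierCoef a b (B V β σ (psih a b V β σ ψ₀ N τ (n + 1))) l

end SEWI

end

/-! The Fourier coefficients of ψ satisfy y_l' = -i(μ_l² y_l + G_l), where G_l(t) is the l-th
coefficient of B(ψ(t)). Duhamel's formula on [t - τ, t + τ] with G_l frozen at the midpoint is
exactly the two-step scheme. The local error is therefore, up to a unimodular factor, the integral
over |s| ≤ τ of e^{iμ_l² s} (G_l(t + s) - G_l(t)) (`center_error`).

Local error. The map t ↦ B(ψ(t)) is Lipschitz into H², because ψ is C¹ into H², stays bounded in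
H⁴_per, and |z|^{2σ} z has locally Lipschitz second derivatives when σ ≥ 1. Hence the local error is
O(τ²) in H². In L² it is O(τ³): write e^{iθ} = 1 + (e^{iθ} - 1). The term 1 leaves a symmetric
second difference of B(ψ), which is O(s²) because ψ is C² into L². The other term costs |s| μ_l²,
which the H² Lipschitz bound pays for. Interpolating between L² and H² gives O(τ^{5/2}) in H¹, which
is the source of the rate 3/2.

Stability. The propagators are unimodular and |sinc| ≤ 1, so the error in the retained modes grows
over one step only by 2τ times the error of B plus the local error, in L² and in H¹ alike and
whatever the size of μ_l. The Lipschitz constant of B requires a sup bound on the numerical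
solution. The H¹ error itself provides it through the one-dimensional Sobolev inequality, so the H¹
recursion closes by the bootstrap in `two_step_gronwall` as soon as τ and h are separately small. No
inverse inequality is used, hence no relation between τ and h. The L² recursion is run afterwards,
with the sup bound in hand.

Space. The coefficients of B are exact integrals, so the only spatial error comes from discarded
modes. There h|μ_l| ≥ 1, and the H⁴ bound on ψ yields h⁴ in L² and h³ for the derivative.

The lemmas that carry the proof are `Sol.center_error`, the three `Model.op_lipschitz` bounds,
`Model.op_second_difference`, `two_step_gronwall` and `Sol.error`; `exists_sol` translates the
Sobolev hypotheses into the pointwise and Fourier bounds that these use. -/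

namespace SEWI

/-! ### Primitives of integrable functions and their product rule -/

/-- `g` is a primitive of the integrable function `g₁` on `[a, b]`. -/
def IsPrim (a b : ℝ) (g g₁ : ℝ → ℂ) : Prop :=
  IntervalIntegrable g₁ volume a b ∧ ∀ x ∈ Icc a b, g x = g a + ∫ s in a..x, g₁ s

variable {a b : ℝ} {g g₁ k k₁ w w₁ : ℝ → ℂ}

theorem intervalIntegrable_left {E : Type*} [NormedAddCommGroup E] {u : ℝ → E}
    (hu : IntervalIntegrable u volume a b) {x : ℝ}
    (hx : x ∈ Icc a b) : IntervalIntegrable u volume a x :=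
  hu.mono_set (by rw [uIcc_of_le hx.1, uIcc_of_le (hx.1.trans hx.2)]; exact Icc_subset_Icc_right hx.2)

theorem norm_integral_left_le {u : ℝ → ℂ} (hu : IntervalIntegrable u volume a b) {x : ℝ}
    (hx : x ∈ Icc a b) : ‖∫ s in a..x, u s‖ ≤ ∫ s in a..b, ‖u s‖ :=
  (intervalIntegral.norm_integral_le_integral_norm hx.1).trans
    (intervalIntegral.integral_mono_interval le_rfl hx.1 hx.2
      (Eventually.of_forall fun _ => norm_nonneg _) hu.norm)

theorem IsPrim.of_hasDerivAt (hg : ∀ x, HasDerivAt g (g₁ x) x) (hc : Continuous g₁) :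
    IsPrim a b g g₁ := by
  refine ⟨hc.intervalIntegrable _ _, fun x _ => ?_⟩
  rw [intervalIntegral.integral_eq_sub_of_hasDerivAt (fun y _ => hg y) (hc.intervalIntegrable _ _)]
  ring

theorem IsPrim.sub (hg : IsPrim a b g g₁) (hk : IsPrim a b k k₁) :
    IsPrim a b (fun x => g x - k x) (fun x => g₁ x - k₁ x) := by
  refine ⟨hg.1.sub hk.1, fun x hx => ?_⟩
  beta_reduce
  rw [intervalIntegral.integral_sub (intervalIntegrable_left hg.1 hx)
    (intervalIntegrable_left hk.1 hx), hg.2 x hx, hk.2 x hx]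
  ring

theorem IsPrim.add (hg : IsPrim a b g g₁) (hk : IsPrim a b k k₁) :
    IsPrim a b (fun x => g x + k x) (fun x => g₁ x + k₁ x) := by
  refine ⟨hg.1.add hk.1, fun x hx => ?_⟩
  beta_reduce
  rw [intervalIntegral.integral_add (intervalIntegrable_left hg.1 hx)
    (intervalIntegrable_left hk.1 hx), hg.2 x hx, hk.2 x hx]
  ring

theorem IsPrim.continuousOn (hab : a ≤ b) (hg : IsPrim a b g g₁) : ContinuousOn g (Icc a b) := by
  have h := (intervalIntegral.continuousOn_primitive_interval' hg.1 left_mem_uIcc)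
  rw [uIcc_of_le hab] at h
  exact (continuousOn_const.add h).congr fun x hx => hg.2 x hx

/-- The rule is classical when the derivative is continuous. The general case follows by density:
approximate `g₁` in L¹ by a continuous `p`; the primitive of `p` is then uniformly close to `g`, and
every term of the identity is stable under this. -/
theorem IsPrim.mul (hab : a ≤ b) (hg : IsPrim a b g g₁) (hw : ∀ x, HasDerivAt w (w₁ x) x)
    (hw₁ : Continuous w₁) :
    IsPrim a b (fun x => g x * w x) (fun x => g₁ x * w x + g x * w₁ x) := by
  have hwc : Continuous w := continuous_iff_continuousAt.2 fun x => (hw x).continuousAt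
  have hgc := hg.continuousOn hab
  have i1 : IntervalIntegrable (fun x => g₁ x * w x) volume a b := hg.1.mul_continuousOn hwc.continuousOn
  have i2 : IntervalIntegrable (fun x => g x * w₁ x) volume a b :=
    (hgc.mul hw₁.continuousOn).intervalIntegrable_of_Icc hab
  refine ⟨i1.add i2, fun x hx => ?_⟩
  obtain ⟨W, hW⟩ := (isCompact_Icc (a := a) (b := b)).exists_bound_of_continuousOn hwc.continuousOn
  obtain ⟨W₁, hW₁⟩ := (isCompact_Icc (a := a) (b := b)).exists_bound_of_continuousOn hw₁.continuousOn
  have hWn : 0 ≤ W := (norm_nonneg _).trans (hW x hx)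
  have hW₁n : 0 ≤ W₁ := (norm_nonneg _).trans (hW₁ x hx)
  -- The defect of the identity; it is shown to be at most a fixed multiple of every ε > 0.
  set X := g x * w x - (g a * w a + ∫ s in a..x, (g₁ s * w s + g s * w₁ s)) with hX
  have key : ∀ ε > 0, ‖X‖ ≤ ε * (2 * W + W₁ * (b - a)) := by
    intro ε hε
    have hi : Integrable ((Ioc a b).indicator g₁) volume :=
      (integrable_indicator_iff measurableSet_Ioc).2
        ((intervalIntegrable_iff_integrableOn_Ioc_of_le hab).1 hg.1)
    obtain ⟨p, -, hp, hpc, hpi⟩ := hi.exists_hasCompactSupport_integral_sub_le hε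
    have hdi : IntervalIntegrable (fun s => g₁ s - p s) volume a b :=
      hg.1.sub (hpc.intervalIntegrable _ _)
    have hd : ∫ s in a..b, ‖g₁ s - p s‖ ≤ ε := by
      refine le_trans ?_ hp
      rw [intervalIntegral.integral_of_le hab]
      refine le_trans (le_of_eq ?_) (setIntegral_le_integral (s := Ioc a b) (hi.sub hpi).norm
        (Eventually.of_forall fun _ => norm_nonneg _))
      refine setIntegral_congr_fun measurableSet_Ioc fun s hs => ?_
      simp [indicator_of_mem hs]
    -- Starting the primitive at `g a` makes `g - P` the integral of `g₁ - p`, hence at most ε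
    -- everywhere.
    set P : ℝ → ℂ := fun y => g a + ∫ s in a..y, p s with hP
    have hPd : ∀ y, HasDerivAt P (p y) y := fun y =>
      (hpc.integral_hasStrictDerivAt a y).hasDerivAt.const_add _
    have hPc : Continuous P := continuous_iff_continuousAt.2 fun x => (hPd x).continuousAt
    have hPw : ∫ s in a..x, (p s * w s + P s * w₁ s) = P x * w x - P a * w a :=
      intervalIntegral.integral_eq_sub_of_hasDerivAt (fun y _ => (hPd y).mul (hw y))
        (((hpc.mul hwc).add (hPc.mul hw₁)).intervalIntegrable _ _)
    have hPa : P a = g a := by simp [hP]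
    have hD : ∀ y ∈ Icc a b, ‖g y - P y‖ ≤ ε := by
      intro y hy
      have : g y - P y = ∫ s in a..y, (g₁ s - p s) := by
        rw [intervalIntegral.integral_sub (intervalIntegrable_left hg.1 hy)
          (hpc.intervalIntegrable _ _), hg.2 y hy]
        simp [hP]
      rw [this]
      exact (norm_integral_left_le hdi hy).trans hd
    have j1 : IntervalIntegrable (fun s => (g₁ s - p s) * w s) volume a b :=
      hdi.mul_continuousOn hwc.continuousOn
    have j2 : IntervalIntegrable (fun s => (g s - P s) * w₁ s) volume a b :=
      ((hgc.sub hPc.continuousOn).mul hw₁.continuousOn).intervalIntegrable_of_Icc hab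
    have e1 : X = (g x - P x) * w x - ((∫ s in a..x, (g₁ s - p s) * w s)
        + ∫ s in a..x, (g s - P s) * w₁ s) := by
      rw [← intervalIntegral.integral_add (intervalIntegrable_left j1 hx)
        (intervalIntegrable_left j2 hx)]
      have : (fun s => (g₁ s - p s) * w s + (g s - P s) * w₁ s)
          = fun s => (g₁ s * w s + g s * w₁ s) - (p s * w s + P s * w₁ s) := by
        ext s; ring
      have hs := intervalIntegral.integral_sub (intervalIntegrable_left (i1.add i2) hx)
        (((hpc.mul hwc).add (hPc.mul hw₁)).intervalIntegrable a x)
      simp only [Pi.add_apply, Pi.mul_apply] at hs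
      rw [this, hs, hPw, hX, hPa]
      ring
    have b1 : ‖∫ s in a..x, (g₁ s - p s) * w s‖ ≤ ε * W := by
      refine (norm_integral_left_le j1 hx).trans ?_
      calc ∫ s in a..b, ‖(g₁ s - p s) * w s‖ ≤ ∫ s in a..b, ‖g₁ s - p s‖ * W := by
            refine intervalIntegral.integral_mono_on hab j1.norm (hdi.norm.mul_const _) fun s hs => ?_
            rw [norm_mul]
            exact mul_le_mul_of_nonneg_left (hW s hs) (norm_nonneg _)
        _ ≤ ε * W := by
            rw [intervalIntegral.integral_mul_const]
            exact mul_le_mul_of_nonneg_right hd hWn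
    have b2 : ‖∫ s in a..x, (g s - P s) * w₁ s‖ ≤ ε * W₁ * (b - a) := by
      refine (norm_integral_left_le j2 hx).trans ?_
      calc ∫ s in a..b, ‖(g s - P s) * w₁ s‖ ≤ ∫ _s in a..b, ε * W₁ := by
            refine intervalIntegral.integral_mono_on hab j2.norm (by simp) fun s hs => ?_
            rw [norm_mul]
            exact mul_le_mul (hD s hs) (hW₁ s hs) (norm_nonneg _) hε.le
        _ = ε * W₁ * (b - a) := by simp; ring
    have b3 : ‖(g x - P x) * w x‖ ≤ ε * W := by
      rw [norm_mul]; exact mul_le_mul (hD x hx) (hW x hx) (norm_nonneg _) hε.le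
    rw [e1]
    refine (norm_sub_le _ _).trans ?_
    have := norm_add_le (∫ s in a..x, (g₁ s - p s) * w s) (∫ s in a..x, (g s - P s) * w₁ s)
    linarith
  have h0 : ‖X‖ ≤ 0 := by
    have hpos : 0 < 2 * W + W₁ * (b - a) + 1 := by
      have := mul_nonneg hW₁n (sub_nonneg.2 hab); linarith
    refine le_of_forall_pos_le_add fun ε hε => ?_
    have := key (ε / (2 * W + W₁ * (b - a) + 1)) (by positivity)
    refine this.trans ?_
    rw [zero_add, div_mul_eq_mul_div, div_le_iff₀ hpos]
    nlinarith
  exact sub_eq_zero.1 (norm_le_zero_iff.1 h0)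

/-! ### The `L²` norm on `Ω` -/

/-- The `L²(Ω)` norm of a function, as a real number. -/
noncomputable def nrm (a b : ℝ) (u : ℝ → ℂ) : ℝ := (eLpNorm u 2 (vol a b)).toReal

theorem nrm_nonneg (u : ℝ → ℂ) : 0 ≤ nrm a b u := ENNReal.toReal_nonneg

theorem nrm_congr {u v : ℝ → ℂ} (h : u =ᵐ[vol a b] v) : nrm a b u = nrm a b v := by
  rw [nrm, nrm, eLpNorm_congr_ae h]

theorem nrm_coeFn (u : L2 a b) : nrm a b u = ‖u‖ := rfl

theorem nrm_add_le {u v : ℝ → ℂ} (hu : MemLp u 2 (vol a b)) (hv : MemLp v 2 (vol a b)) :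
    nrm a b (fun x => u x + v x) ≤ nrm a b u + nrm a b v := by
  rw [nrm, nrm, nrm, ← ENNReal.toReal_add hu.2.ne hv.2.ne]
  exact ENNReal.toReal_mono (ENNReal.add_ne_top.2 ⟨hu.2.ne, hv.2.ne⟩)
    (eLpNorm_add_le hu.1 hv.1 (by norm_num))

theorem nrm_mono {u v : ℝ → ℂ} {c : ℝ} (hc : 0 ≤ c) (hv : MemLp v 2 (vol a b))
    (h : ∀ᵐ x ∂(vol a b), ‖u x‖ ≤ c * ‖v x‖) : nrm a b u ≤ c * nrm a b v := by
  have := eLpNorm_le_mul_eLpNorm_of_ae_le_mul h 2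
  rw [nrm, nrm]
  refine (ENNReal.toReal_mono (ENNReal.mul_ne_top ENNReal.ofReal_ne_top hv.2.ne) this).trans ?_
  rw [ENNReal.toReal_mul, ENNReal.toReal_ofReal hc]

theorem ae_vol_of_forall_Icc {p : ℝ → Prop} (h : ∀ x ∈ Icc a b, p x) : ∀ᵐ x ∂(vol a b), p x :=
  (ae_restrict_mem measurableSet_Ioo).mono fun x hx => h x (Ioo_subset_Icc_self hx)

theorem memLp_of_continuousOn {u : ℝ → ℂ} (h : ContinuousOn u (Icc a b)) :
    MemLp u 2 (vol a b) := by
  obtain ⟨C, hC⟩ := (isCompact_Icc (a := a) (b := b)).exists_bound_of_continuousOn h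
  exact MemLp.of_bound ((h.mono Ioo_subset_Icc_self).aestronglyMeasurable measurableSet_Ioo) C
    (ae_vol_of_forall_Icc hC)

theorem nrm_le_of_bound (hab : a ≤ b) {u : ℝ → ℂ} {c : ℝ} (hc : 0 ≤ c)
    (h : ∀ x ∈ Icc a b, ‖u x‖ ≤ c) : nrm a b u ≤ c * Real.sqrt (b - a) := by
  have h1 := nrm_mono (a := a) (b := b) (u := u) (v := fun _ => 1) hc
    (memLp_of_continuousOn continuousOn_const) (by simpa using ae_vol_of_forall_Icc h)
  refine h1.trans (mul_le_mul_of_nonneg_left (le_of_eq ?_) hc)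
  rw [nrm, eLpNorm_const' _ (by norm_num) (by norm_num)]
  simp [Real.sqrt_eq_rpow, hab, ENNReal.toReal_ofReal, ← ENNReal.toReal_rpow]

theorem nrm_sq {u : ℝ → ℂ} (hu : MemLp u 2 (vol a b)) :
    nrm a b u ^ 2 = ∫ x in Ioo a b, ‖u x‖ ^ 2 := by
  have h := hu.eLpNorm_eq_integral_rpow_norm (by norm_num) (by norm_num)
  rw [nrm, h, ENNReal.toReal_ofReal (by positivity)]
  have h0 : (0:ℝ) ≤ ∫ x in Ioo a b, ‖u x‖ ^ 2 := integral_nonneg fun _ => by positivity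
  simp only [ENNReal.toReal_ofNat, Real.rpow_ofNat]
  rw [show (2:ℝ)⁻¹ = 1 / 2 by norm_num, ← Real.sqrt_eq_rpow]
  exact Real.sq_sqrt h0

theorem integral_norm_le_nrm (hab : a ≤ b) {u : ℝ → ℂ} (hu : MemLp u 2 (vol a b)) :
    ∫ x in Ioo a b, ‖u x‖ ≤ Real.sqrt (b - a) * nrm a b u := by
  have h1 := eLpNorm_le_eLpNorm_mul_rpow_measure_univ (p := 1) (q := 2) (by norm_num) hu.1
  have h2 : (∫ x in Ioo a b, ‖u x‖) = (eLpNorm u 1 (vol a b)).toReal := by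
    rw [eLpNorm_one_eq_lintegral_enorm, integral_norm_eq_lintegral_enorm hu.1]
  rw [h2, nrm, mul_comm]
  refine (ENNReal.toReal_mono ?_ h1).trans (le_of_eq ?_)
  · refine ENNReal.mul_ne_top hu.2.ne (ENNReal.rpow_ne_top_of_nonneg (by norm_num) (by simp))
  · rw [ENNReal.toReal_mul]
    congr 1
    rw [← ENNReal.toReal_rpow]
    simp [hab, Real.sqrt_eq_rpow]
    norm_num

/-- The one-dimensional Sobolev inequality. -/
theorem IsPrim.norm_le (hab : a < b) (hg : IsPrim a b g g₁) (hg₁ : MemLp g₁ 2 (vol a b)) {x : ℝ}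
    (hx : x ∈ Icc a b) :
    ‖g x‖ ≤ (Real.sqrt (b - a) / (b - a) + Real.sqrt (b - a)) * (nrm a b g + nrm a b g₁) := by
  have hpos : 0 < b - a := sub_pos.2 hab
  have hgc := hg.continuousOn hab.le
  have hgm := memLp_of_continuousOn hgc
  have e : ∀ u : ℝ → ℂ, ∫ s in a..b, ‖u s‖ = ∫ s in Ioo a b, ‖u s‖ := fun u => by
    rw [intervalIntegral.integral_of_le hab.le, integral_Ioc_eq_integral_Ioo]
  -- The value at `x` is compared with the value at an arbitrary `y`. Averaging over `y` and
  -- bounding both L¹ norms by Cauchy–Schwarz gives the claim.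
  have h1 : ∀ y ∈ Icc a b, ‖g x‖ ≤ ‖g y‖ + ∫ s in a..b, ‖g₁ s‖ := by
    intro y hy
    have hxy : g x = g y + ∫ s in y..x, g₁ s := by
      rw [hg.2 x hx, hg.2 y hy, ← intervalIntegral.integral_interval_sub_left
        (intervalIntegrable_left hg.1 hx) (intervalIntegrable_left hg.1 hy)]
      ring
    rw [hxy]
    refine (norm_add_le _ _).trans (add_le_add_right ?_ _)
    refine intervalIntegral.norm_integral_le_abs_integral_norm.trans ?_
    rw [intervalIntegral.integral_of_le hab.le, intervalIntegral.abs_integral_eq_abs_integral_uIoc,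
      abs_of_nonneg (integral_nonneg fun _ => norm_nonneg _)]
    refine setIntegral_mono_set ((intervalIntegrable_iff_integrableOn_Ioc_of_le hab.le).1 hg.1.norm)
      (Eventually.of_forall fun _ => norm_nonneg _) (LE.le.eventuallyLE ?_)
    rw [uIoc]
    exact Ioc_subset_Ioc (le_min hy.1 hx.1) (max_le hy.2 hx.2)
  have h2 : (b - a) * ‖g x‖ ≤ (∫ s in a..b, ‖g s‖) + (b - a) * ∫ s in a..b, ‖g₁ s‖ := by
    have := intervalIntegral.integral_mono_on (μ := volume) (f := fun _ => ‖g x‖)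
      (g := fun y => ‖g y‖ + ∫ s in a..b, ‖g₁ s‖) hab.le intervalIntegrable_const
      ((hgc.norm.add continuousOn_const).intervalIntegrable_of_Icc hab.le) h1
    rw [intervalIntegral.integral_add (hgc.norm.intervalIntegrable_of_Icc hab.le)
      intervalIntegrable_const] at this
    simpa using this
  rw [e, e] at h2
  have h3 := integral_norm_le_nrm hab.le hgm
  have h4 := integral_norm_le_nrm hab.le hg₁
  have n1 := nrm_nonneg (a := a) (b := b) g
  have n2 := nrm_nonneg (a := a) (b := b) g₁
  set q := Real.sqrt (b - a)
  have hq : 0 ≤ q := Real.sqrt_nonneg _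
  have h5 : (b - a) * ‖g x‖ ≤ q * nrm a b g + (b - a) * (q * nrm a b g₁) :=
    h2.trans (add_le_add h3 (mul_le_mul_of_nonneg_left h4 hpos.le))
  have h6 : ‖g x‖ ≤ (q * nrm a b g + (b - a) * (q * nrm a b g₁)) / (b - a) := by
    rw [le_div_iff₀ hpos]; linarith
  refine h6.trans ?_
  have : (q * nrm a b g + (b - a) * (q * nrm a b g₁)) / (b - a)
      = q / (b - a) * nrm a b g + q * nrm a b g₁ := by field_simp
  rw [this]
  have : 0 ≤ q / (b - a) := by positivity
  nlinarith [mul_nonneg this n2, mul_nonneg hq n1]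

end SEWI

namespace SEWI

variable {a b : ℝ} {g g₁ k k₁ w w₁ : ℝ → ℂ}

/-! ### Weak derivatives -/

theorem integrable_of_memLp {u : ℝ → ℂ} (hu : MemLp u 2 (vol a b)) : Integrable u (vol a b) :=
  hu.integrable (by norm_num)

theorem intervalIntegrable_of_memLp (hab : a ≤ b) {u : ℝ → ℂ} (hu : MemLp u 2 (vol a b)) :
    IntervalIntegrable u volume a b :=
  (intervalIntegrable_iff_integrableOn_Ioo_of_le hab).2 (integrable_of_memLp hu)

theorem intervalIntegral_eq_Ioo (hab : a ≤ b) (u : ℝ → ℂ) :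
    ∫ x in a..b, u x = ∫ x in Ioo a b, u x := by
  rw [intervalIntegral.integral_of_le hab, integral_Ioc_eq_integral_Ioo]

theorem IsPrim.isWeakDeriv (hab : a ≤ b) (hg : IsPrim a b g g₁) : IsWeakDeriv a b g g₁ := by
  intro φ hφ
  have hz : ∀ x, x ∉ Ioo a b → φ x = 0 := fun x hx =>
    image_eq_zero_of_notMem_tsupport fun h => hx (hφ.2.2 h)
  have hd : Continuous (deriv φ) := hφ.1.continuous_deriv (by simp)
  have h := (hg.mul hab (fun x => (hφ.1.differentiable (by simp) x).hasDerivAt) hd)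
  have h2 := h.2 b (right_mem_Icc.2 hab)
  have i1 : IntervalIntegrable (fun x => g₁ x * φ x) volume a b :=
    hg.1.mul_continuousOn hφ.1.continuous.continuousOn
  have i2 : IntervalIntegrable (fun x => g x * deriv φ x) volume a b :=
    ((hg.continuousOn hab).mul hd.continuousOn).intervalIntegrable_of_Icc hab
  beta_reduce at h2
  rw [hz a (by simp), hz b (by simp), intervalIntegral.integral_add i1 i2,
    intervalIntegral_eq_Ioo hab, intervalIntegral_eq_Ioo hab] at h2
  linear_combination -h2

theorem IsTest.ofReal {φ : ℝ → ℝ} (h1 : ContDiff ℝ ∞ φ) (h2 : HasCompactSupport φ)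
    (h3 : tsupport φ ⊆ Ioo a b) : IsTest a b (fun x => (φ x : ℂ)) := by
  refine ⟨Complex.ofRealCLM.contDiff.comp h1, h2.comp_left (g := fun x : ℝ => (x : ℂ)) (by simp), ?_⟩
  refine (closure_mono ?_).trans h3
  exact Function.support_comp_subset (g := fun x : ℝ => (x : ℂ)) (by simp) φ

theorem ae_eq_zero_of_forall_test {u : ℝ → ℂ} (hu : Integrable u (vol a b))
    (h : ∀ φ : ℝ → ℝ, ContDiff ℝ ∞ φ → HasCompactSupport φ → tsupport φ ⊆ Ioo a b →
      ∫ x in Ioo a b, u x * (φ x : ℂ) = 0) : u =ᵐ[vol a b] 0 := by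
  have := isOpen_Ioo.ae_eq_zero_of_integral_contDiff_smul_eq_zero (U := Ioo a b) (μ := vol a b)
    (hu.locallyIntegrable.locallyIntegrableOn _) (fun φ h1 h2 h3 => by
      rw [← h φ h1 h2 h3]
      refine integral_congr_ae (Eventually.of_forall fun x => ?_)
      simp [mul_comm])
  filter_upwards [this, ae_restrict_mem measurableSet_Ioo] with x h1 h2 using h1 h2

theorem IsTest.integrable_mul {u φ : ℝ → ℂ} (hφ : IsTest a b φ) (hu : MemLp u 2 (vol a b)) :
    Integrable (fun x => u x * φ x) (vol a b) :=
  hu.integrable_mul hφ.memLp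

theorem IsTest.integrable_mul_deriv {u φ : ℝ → ℂ} (hφ : IsTest a b φ) (hu : MemLp u 2 (vol a b)) :
    Integrable (fun x => u x * deriv φ x) (vol a b) :=
  hu.integrable_mul hφ.memLp_deriv

theorem IsWeakDeriv.unique {u v v' : ℝ → ℂ} (hv : MemLp v 2 (vol a b)) (hv' : MemLp v' 2 (vol a b))
    (h : IsWeakDeriv a b u v) (h' : IsWeakDeriv a b u v') : v =ᵐ[vol a b] v' := by
  have := ae_eq_zero_of_forall_test (integrable_of_memLp (hv.sub hv')) (fun φ h1 h2 h3 => by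
    have ht := IsTest.ofReal h1 h2 h3
    have e := h _ ht
    rw [h' _ ht, neg_inj] at e
    simp only [Pi.sub_apply, sub_mul]
    rw [integral_sub (ht.integrable_mul hv) (ht.integrable_mul hv'), e, sub_self])
  filter_upwards [this] with x hx
  exact sub_eq_zero.1 hx

theorem IsWeakDeriv.congr {u v u' v' : ℝ → ℂ} (h : IsWeakDeriv a b u v) (hu : u =ᵐ[vol a b] u')
    (hv : v =ᵐ[vol a b] v') : IsWeakDeriv a b u' v' := by
  intro φ hφ
  have e : ∫ x in Ioo a b, u x * deriv φ x = ∫ x in Ioo a b, u' x * deriv φ x :=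
    integral_congr_ae (hu.mono fun x hx => by simp only [hx])
  rw [← e, h φ hφ]
  congr 1
  exact integral_congr_ae (hv.mono fun x hx => by simp only [hx])

/-- Subtracting (∫φ)θ makes the mean zero, so the primitive vanishes on both sides of the hull `[c,
d]` of the two supports and is again a test function. -/
theorem exists_primitive_test {φ θ : ℝ → ℝ} (h1 : ContDiff ℝ ∞ φ)
    (h2 : HasCompactSupport φ) (h3 : tsupport φ ⊆ Ioo a b) (t1 : ContDiff ℝ ∞ θ)
    (t2 : HasCompactSupport θ) (t3 : tsupport θ ⊆ Ioo a b) (ht : ∫ x, θ x = 1) :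
    ∃ Φ : ℝ → ℝ, ContDiff ℝ ∞ Φ ∧ HasCompactSupport Φ ∧ tsupport Φ ⊆ Ioo a b ∧
      ∀ x, HasDerivAt Φ (φ x - (∫ y, φ y) * θ x) x := by
  set χ : ℝ → ℝ := fun x => φ x - (∫ y, φ y) * θ x with hχ
  have hχs : ContDiff ℝ ∞ χ := h1.sub (contDiff_const.mul t1)
  have hχc := hχs.continuous
  have hne : (tsupport θ).Nonempty := by
    by_contra hh
    rw [not_nonempty_iff_eq_empty, tsupport_eq_empty_iff] at hh
    simp [hh] at ht
  have hK : IsCompact (tsupport φ ∪ tsupport θ) := h2.isCompact.union t2.isCompact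
  have hKne : (tsupport φ ∪ tsupport θ).Nonempty := hne.mono subset_union_right
  obtain ⟨c, hc, hcl⟩ := hK.exists_isLeast hKne
  obtain ⟨d, hd, hdg⟩ := hK.exists_isGreatest hKne
  have hc' : c ∈ Ioo a b := union_subset h3 t3 hc
  have hd' : d ∈ Ioo a b := union_subset h3 t3 hd
  have hz : ∀ x, x ∉ Icc c d → χ x = 0 := by
    intro x hx
    have : x ∉ tsupport φ ∪ tsupport θ := fun h => hx ⟨hcl h, hdg h⟩
    rw [mem_union, not_or] at this
    simp [hχ, image_eq_zero_of_notMem_tsupport this.1, image_eq_zero_of_notMem_tsupport this.2]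
  have hint : ∫ x, χ x = 0 := by
    rw [hχ, integral_sub (h1.continuous.integrable_of_hasCompactSupport h2)
      ((t1.continuous.integrable_of_hasCompactSupport t2).const_mul _), integral_const_mul, ht]
    ring
  have hd1 : ∀ x, HasDerivAt (fun x => ∫ s in a..x, χ s) (χ x) x := fun x =>
    (hχc.integral_hasStrictDerivAt a x).hasDerivAt
  have hzero : ∀ x, x ∉ Icc c d → ∫ s in a..x, χ s = 0 := by
    intro x hx
    rw [mem_Icc, not_and_or, not_le, not_le] at hx
    rcases hx with hx | hx
    · refine intervalIntegral.integral_zero_ae (Eventually.of_forall fun y hy => hz y fun h => ?_)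
      have := (uIoc_subset_uIcc hy).2
      exact absurd (h.1.trans this) (not_le.2 (max_lt hc'.1 hx))
    · rw [← hint, intervalIntegral.integral_of_le (by linarith [hd'.1]), ← integral_indicator measurableSet_Ioc]
      congr 1
      ext y
      by_cases hy : y ∈ Ioc a x
      · rw [indicator_of_mem hy]
      · rw [indicator_of_notMem hy, hz y fun h => hy ⟨hc'.1.trans_le h.1, h.2.trans hx.le⟩]
  refine ⟨fun x => ∫ s in a..x, χ s, ?_, ?_, ?_, hd1⟩
  · rw [contDiff_infty_iff_deriv]
    refine ⟨fun x => (hd1 x).differentiableAt, ?_⟩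
    rwa [show deriv (fun x => ∫ s in a..x, χ s) = χ from funext fun x => (hd1 x).deriv]
  · exact HasCompactSupport.intro isCompact_Icc hzero
  · refine (closure_minimal (fun x hx => ?_) isClosed_Icc).trans (Icc_subset_Ioo hc'.1 hd'.2)
    by_contra h
    exact hx (hzero x h)

/-- The lemma of du Bois-Reymond. -/
theorem IsWeakDeriv.exists_primitive (hab : a < b) {u v : ℝ → ℂ} (hu : MemLp u 2 (vol a b))
    (hv : MemLp v 2 (vol a b)) (h : IsWeakDeriv a b u v) :
    ∃ c : ℂ, u =ᵐ[vol a b] fun x => c + ∫ s in a..x, v s := by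
  have hvi := intervalIntegrable_of_memLp hab.le hv
  have hP : IsPrim a b (fun x => ∫ s in a..x, v s) v := ⟨hvi, fun x _ => by simp⟩
  have hPm := memLp_of_continuousOn (hP.continuousOn hab.le)
  -- The remainder `r` has weak derivative zero; it remains to see that it is constant.
  set r : ℝ → ℂ := fun x => u x - ∫ s in a..x, v s with hr
  have hrm : MemLp r 2 (vol a b) := hu.sub hPm
  have hr0 : ∀ φ : ℝ → ℂ, IsTest a b φ → ∫ x in Ioo a b, r x * deriv φ x = 0 := by
    intro φ hφ
    simp only [hr, sub_mul]
    rw [integral_sub (hφ.integrable_mul_deriv hu) (hφ.integrable_mul_deriv hPm), h φ hφ,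
      hP.isWeakDeriv hab.le φ hφ, sub_self]
  let bump : ContDiffBump ((a + b) / 2) :=
    ⟨(b - a) / 8, (b - a) / 4, by linarith, by linarith⟩
  set θ : ℝ → ℝ := bump.normed volume
  have t1 : ContDiff ℝ ∞ θ := bump.contDiff_normed
  have t2 : HasCompactSupport θ := bump.hasCompactSupport_normed
  have t3 : tsupport θ ⊆ Ioo a b := by
    rw [bump.tsupport_normed_eq, Real.closedBall_eq_Icc]
    change Icc ((a + b) / 2 - (b - a) / 4) ((a + b) / 2 + (b - a) / 4) ⊆ _
    exact Icc_subset_Ioo (by linarith) (by linarith)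
  have ht : ∫ x, θ x = 1 := bump.integral_normed
  have hθ := IsTest.ofReal t1 t2 t3
  refine ⟨∫ x in Ioo a b, r x * θ x, ?_⟩
  -- Testing `r` against the derivative φ - (∫φ)θ of a test function gives ∫ rφ = (∫ rθ)(∫φ), which
  -- identifies the constant as ∫ rθ.
  set c : ℂ := ∫ x in Ioo a b, r x * θ x with hc
  have hz := ae_eq_zero_of_forall_test (u := fun x => r x - c)
    ((integrable_of_memLp hrm).sub (integrable_const c)) (fun φ h1 h2 h3 => by
    have hφ := IsTest.ofReal h1 h2 h3
    obtain ⟨Φ, p1, p2, p3, p4⟩ := exists_primitive_test h1 h2 h3 t1 t2 t3 ht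
    have e := hr0 _ (IsTest.ofReal p1 p2 p3)
    have hder : deriv (fun x => (Φ x : ℂ)) = fun x => (φ x : ℂ) - ((∫ y, φ y : ℝ) : ℂ) * θ x := by
      ext x
      rw [(p4 x).ofReal_comp.deriv]
      push_cast; rfl
    rw [hder] at e
    simp only [mul_sub, mul_left_comm (r _)] at e
    rw [integral_sub (hφ.integrable_mul hrm) ((hθ.integrable_mul hrm).const_mul _),
      integral_const_mul] at e
    simp only [sub_mul]
    rw [integral_sub (hφ.integrable_mul hrm)
      ((integrable_of_memLp hφ.memLp).const_mul c), integral_const_mul]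
    have hof : ∫ x in Ioo a b, (φ x : ℂ) = ((∫ x in Ioo a b, φ x : ℝ) : ℂ) := integral_ofReal
    rw [hof]
    have : ∫ x in Ioo a b, φ x = ∫ x, φ x :=
      setIntegral_eq_integral_of_forall_compl_eq_zero fun x hx =>
        image_eq_zero_of_notMem_tsupport fun h => hx (h3 h)
    rw [this]
    linear_combination e)
  filter_upwards [hz] with x hx
  simp only [hr, Pi.zero_apply] at hx
  linear_combination hx

/-! ### Classical representatives of Sobolev functions -/

theorem wderiv_memLp {m : ℕ} (w : Hm a b m) (k : Fin (m + 1)) :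
    MemLp (wderiv w k) 2 (vol a b) := Lp.memLp _

/-- The regularity assumptions come with separate Sobolev witnesses of different orders. This
identifies their derivatives, so that one family of representatives serves all of them. -/
theorem Hm.wderiv_unique {m m' : ℕ} (w : Hm a b m) (w' : Hm a b m') (h : toL2 w = toL2 w') :
    ∀ k (hk : k < m + 1) (hk' : k < m' + 1), wderiv w ⟨k, hk⟩ = wderiv w' ⟨k, hk'⟩ := by
  intro k
  induction k with
  | zero => intro _ _; exact h
  | succ k ih =>
    intro hk hk'
    have e := ih (by omega) (by omega)
    have h1 := w.2 ⟨k, by omega⟩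
    have h2 := w'.2 ⟨k, by omega⟩
    refine Lp.ext ?_
    refine IsWeakDeriv.unique (wderiv_memLp w _) (wderiv_memLp w' _) h1 ?_
    change IsWeakDeriv a b (wderiv w ⟨k, by omega⟩) _
    rw [e]
    exact h2

/-- Integrate downwards from the top derivative, with the constants supplied by du Bois-Reymond. The
top derivative is merely integrable, so the last link is only an `IsPrim`; the lower ones are
classical derivatives. -/
theorem Hm.exists_rep (hab : a < b) {m : ℕ} (w : Hm a b m) : ∃ U : ℕ → ℝ → ℂ,
    (∀ k (hk : k < m + 1), wderiv w ⟨k, hk⟩ =ᵐ[vol a b] U k) ∧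
    (∀ k < m, Continuous (U k)) ∧ (∀ k < m, IsPrim a b (U k) (U (k + 1))) ∧
    ∀ k, k + 1 < m → ∀ x, HasDerivAt (U k) (U (k + 1) x) x := by
  have hc : ∀ k : Fin m, ∃ c : ℂ, wderiv w k.castSucc =ᵐ[vol a b]
      fun x => c + ∫ s in a..x, wderiv w k.succ s := fun k =>
    (w.2 k).exists_primitive hab (wderiv_memLp w _) (wderiv_memLp w _)
  choose c hc using hc
  -- `W j` represents the derivative of order `m - j`. The indicator makes `W 0` integrable on the
  -- whole line, so that all later primitives are continuous everywhere and not just on the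
  -- interval.
  let W : ℕ → ℝ → ℂ := fun j => Nat.rec ((Ioo a b).indicator (wderiv w (Fin.last m)))
    (fun j Wj x => (if h : m - (j + 1) < m then c ⟨m - (j + 1), h⟩ else 0) + ∫ s in a..x, Wj s) j
  have hW0 : W 0 = (Ioo a b).indicator (wderiv w (Fin.last m)) := rfl
  have hW : ∀ j x, W (j + 1) x
      = (if h : m - (j + 1) < m then c ⟨m - (j + 1), h⟩ else 0) + ∫ s in a..x, W j s :=
    fun j x => rfl
  have hint : ∀ j, ∀ p q, IntervalIntegrable (W j) volume p q := by
    intro j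
    induction j with
    | zero =>
      intro p q
      rw [hW0]
      exact ((integrable_indicator_iff measurableSet_Ioo).2
        (integrable_of_memLp (wderiv_memLp w _))).intervalIntegrable
    | succ j ih =>
      intro p q
      have : Continuous (W (j + 1)) := continuous_const.add (intervalIntegral.continuous_primitive ih a)
      exact this.intervalIntegrable _ _
  have hcont : ∀ j, Continuous (W (j + 1)) := fun j =>
    continuous_const.add (intervalIntegral.continuous_primitive (hint j) a)
  have hae : ∀ j (hj : j ≤ m), wderiv w ⟨m - j, by omega⟩ =ᵐ[vol a b] W j := by
    intro j
    induction j with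
    | zero =>
      intro _
      rw [hW0]
      filter_upwards [ae_restrict_mem measurableSet_Ioo] with x hx
      rw [indicator_of_mem hx]; rfl
    | succ j ih =>
      intro hj
      have h1 := hc ⟨m - (j + 1), by omega⟩
      have h2 := ih (by omega)
      have e1 : (Fin.castSucc ⟨m - (j + 1), by omega⟩ : Fin (m + 1)) = ⟨m - (j + 1), by omega⟩ := rfl
      have e2 : (Fin.succ ⟨m - (j + 1), by omega⟩ : Fin (m + 1)) = ⟨m - j, by omega⟩ := by
        ext; simp; omega
      rw [e1, e2] at h1
      filter_upwards [h1, ae_restrict_mem measurableSet_Ioo] with x hx hxm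
      rw [hx, hW, dif_pos (by omega)]
      congr 1
      rw [intervalIntegral.integral_of_le hxm.1.le, intervalIntegral.integral_of_le hxm.1.le]
      refine setIntegral_congr_ae measurableSet_Ioc ?_
      have h3 := (ae_restrict_iff' measurableSet_Ioo).1 h2
      filter_upwards [h3] with y hy hym
      exact hy ⟨hym.1, hym.2.trans_lt hxm.2⟩
  refine ⟨fun k => W (m - k), fun k hk => ?_, fun k hk => ?_, fun k hk => ?_, fun k hk x => ?_⟩
  · have := hae (m - k) (by omega)
    have e : (⟨m - (m - k), by omega⟩ : Fin (m + 1)) = ⟨k, hk⟩ := by ext; simp; omega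
    rwa [e] at this
  · obtain ⟨j, hj⟩ : ∃ j, m - k = j + 1 := ⟨m - k - 1, by omega⟩
    simp only [hj]; exact hcont j
  · obtain ⟨j, hj⟩ : ∃ j, m - k = j + 1 := ⟨m - k - 1, by omega⟩
    have hj' : m - (k + 1) = j := by omega
    simp only [hj, hj']
    refine ⟨hint j _ _, fun x _ => ?_⟩
    rw [hW, hW]; simp
  · obtain ⟨j, hj⟩ : ∃ j, m - k = j + 1 + 1 := ⟨m - k - 2, by omega⟩
    have hj' : m - (k + 1) = j + 1 := by omega
    simp only [hj, hj']
    exact ((hcont j).integral_hasStrictDerivAt a x).hasDerivAt.const_add _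

theorem eqOn_Icc_of_ae_eq_vol (hab : a < b) {u v : ℝ → ℂ} (hu : ContinuousOn u (Icc a b))
    (hv : ContinuousOn v (Icc a b)) (h : u =ᵐ[vol a b] v) : EqOn u v (Icc a b) := by
  refine Measure.eqOn_Icc_of_ae_eq volume hab.ne ?_ hu hv
  rwa [vol, Measure.restrict_congr_set Ioo_ae_eq_Icc] at h

theorem IsPer.rep_eq (hab : a < b) {m : ℕ} {w : Hm a b m} (hw : IsPer w) {u : ℝ → ℂ} (k : Fin m)
    (hu : ContinuousOn u (Icc a b)) (h : wderiv w k.castSucc =ᵐ[vol a b] u) : u a = u b := by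
  obtain ⟨v, hv, hve, hvab⟩ := hw k
  have e := eqOn_Icc_of_ae_eq_vol hab hu hv (h.symm.trans hve)
  rw [e (left_mem_Icc.2 hab.le), e (right_mem_Icc.2 hab.le), hvab]

end SEWI

namespace SEWI

variable {a b : ℝ} {g g₁ k k₁ w w₁ : ℝ → ℂ}

/-! ### Fourier coefficients -/

/-- The conjugate Fourier mode `e^{-i μ_l (x - a)}`. -/
noncomputable def mode (a b : ℝ) (l : ℤ) (x : ℝ) : ℂ :=
  Complex.exp (-Complex.I * (freq a b l : ℂ) * ((x : ℂ) - a))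

theorem fourierCoef_eq (u : ℝ → ℂ) (l : ℤ) :
    fourierCoef a b u l = (1 / (b - a) : ℂ) * ∫ x in Ioo a b, u x * mode a b l x := rfl

theorem mode_hasDerivAt (l : ℤ) (x : ℝ) :
    HasDerivAt (mode a b l) (-Complex.I * (freq a b l : ℂ) * mode a b l x) x := by
  have h : HasDerivAt (fun x : ℝ => -Complex.I * (freq a b l : ℂ) * ((x : ℂ) - a))
      (-Complex.I * (freq a b l : ℂ) * 1) x :=
    (((hasDerivAt_id x).ofReal_comp.sub_const (a : ℂ)).const_mul _)
  have := h.cexp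
  rw [mul_one, mul_comm (Complex.exp _)] at this
  exact this

theorem mode_continuous (l : ℤ) : Continuous (mode a b l) :=
  continuous_iff_continuousAt.2 fun x => (mode_hasDerivAt l x).continuousAt

theorem mode_left (l : ℤ) : mode a b l a = 1 := by simp [mode]

theorem mode_right (hab : a < b) (l : ℤ) : mode a b l b = 1 := by
  have hne : (b : ℂ) - a ≠ 0 := by
    rw [← Complex.ofReal_sub]; exact_mod_cast (sub_pos.2 hab).ne'
  rw [mode, freq, Complex.exp_eq_one_iff]
  refine ⟨-l, ?_⟩
  push_cast
  field_simp

theorem norm_mode (l : ℤ) (x : ℝ) : ‖mode a b l x‖ = 1 := by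
  rw [mode, show -Complex.I * (freq a b l : ℂ) * ((x : ℂ) - a)
    = ((-(freq a b l) * (x - a) : ℝ) : ℂ) * Complex.I by push_cast; ring,
    Complex.norm_exp_ofReal_mul_I]

theorem fourierCoef_congr {u v : ℝ → ℂ} (h : u =ᵐ[vol a b] v) (l : ℤ) :
    fourierCoef a b u l = fourierCoef a b v l := by
  rw [fourierCoef_eq, fourierCoef_eq]
  congr 1
  exact integral_congr_ae (h.mono fun x hx => by simp only [hx])

theorem integrable_mul_mode {u : ℝ → ℂ} (hu : Integrable u (vol a b)) (l : ℤ) :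
    Integrable (fun x => u x * mode a b l x) (vol a b) :=
  hu.mul_bdd (c := 1) (mode_continuous l).aestronglyMeasurable
    (Eventually.of_forall fun x => (norm_mode l x).le)

theorem fourierCoef_add {u v : ℝ → ℂ} (hu : Integrable u (vol a b)) (hv : Integrable v (vol a b))
    (l : ℤ) : fourierCoef a b (fun x => u x + v x) l
      = fourierCoef a b u l + fourierCoef a b v l := by
  simp only [fourierCoef_eq, add_mul]
  rw [integral_add (integrable_mul_mode hu l) (integrable_mul_mode hv l), mul_add]

theorem fourierCoef_sub {u v : ℝ → ℂ} (hu : Integrable u (vol a b)) (hv : Integrable v (vol a b))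
    (l : ℤ) : fourierCoef a b (fun x => u x - v x) l
      = fourierCoef a b u l - fourierCoef a b v l := by
  simp only [fourierCoef_eq, sub_mul]
  rw [integral_sub (integrable_mul_mode hu l) (integrable_mul_mode hv l), mul_sub]

theorem fourierCoef_const_mul (c : ℂ) (u : ℝ → ℂ) (l : ℤ) :
    fourierCoef a b (fun x => c * u x) l = c * fourierCoef a b u l := by
  simp only [fourierCoef_eq, mul_assoc]
  rw [integral_const_mul]
  ring

/-- The two conventions differ by a unimodular phase, caused by the base point `a`. Moduli are
enough for Parseval. -/
theorem norm_fourierCoef (hab : a < b) (u : ℝ → ℂ) (l : ℤ) :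
    ‖fourierCoef a b u l‖ = ‖fourierCoeffOn hab u l‖ := by
  have hpos : 0 < b - a := sub_pos.2 hab
  have hne : (b : ℂ) - a ≠ 0 := by
    rw [← Complex.ofReal_sub]; exact_mod_cast hpos.ne'
  rw [fourierCoeffOn_eq_integral, fourierCoef_eq, norm_mul, norm_smul,
    intervalIntegral.integral_of_le hab.le, integral_Ioc_eq_integral_Ioo]
  congr 1
  · rw [← Complex.ofReal_sub, norm_div, norm_one, Complex.norm_real, norm_div, norm_one]
  have e : ∀ x : ℝ, u x * mode a b l x
      = Complex.exp (Complex.I * (freq a b l : ℂ) * a)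
        * (fourier (-l) (x : AddCircle (b - a)) • u x) := by
    intro x
    rw [fourier_coe_apply, smul_eq_mul, mode, mul_comm (u x), ← mul_assoc, ← Complex.exp_add, freq]
    congr 2
    push_cast
    field_simp
    ring
  simp only [e]
  rw [integral_const_mul, norm_mul]
  rw [show Complex.I * (freq a b l : ℂ) * a
    = ((freq a b l * a : ℝ) : ℂ) * Complex.I by push_cast; ring,
    Complex.norm_exp_ofReal_mul_I, one_mul]

/-- Parseval's identity. -/
theorem hasSum_fourierCoef (hab : a < b) {u : ℝ → ℂ} (hu : MemLp u 2 (vol a b)) :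
    HasSum (fun l => ‖fourierCoef a b u l‖ ^ 2) ((b - a)⁻¹ * nrm a b u ^ 2) := by
  have hu' : MemLp u 2 (volume.restrict (Ioc a b)) := by
    rwa [← Measure.restrict_congr_set (Ioo_ae_eq_Ioc (μ := volume))]
  have h := hasSum_sq_fourierCoeffOn hab hu'
  rw [intervalIntegral.integral_of_le hab.le, integral_Ioc_eq_integral_Ioo, ← nrm_sq hu] at h
  simpa only [norm_fourierCoef hab, smul_eq_mul] using h

/-- Integration by parts against the mode; periodicity cancels the boundary terms. -/
theorem IsPrim.fourierCoef_eq (hab : a < b) (hg : IsPrim a b g g₁) (hper : g a = g b) (l : ℤ) :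
    fourierCoef a b g₁ l = Complex.I * freq a b l * fourierCoef a b g l := by
  have hc : Continuous fun x => -Complex.I * (freq a b l : ℂ) * mode a b l x :=
    continuous_const.mul (mode_continuous l)
  have h := (hg.mul hab.le (mode_hasDerivAt (a := a) (b := b) l) hc).2 b (right_mem_Icc.2 hab.le)
  have i1 : IntervalIntegrable (fun x => g₁ x * mode a b l x) volume a b :=
    hg.1.mul_continuousOn (mode_continuous l).continuousOn
  have i2 : IntervalIntegrable (fun x => g x * (-Complex.I * (freq a b l : ℂ) * mode a b l x))
      volume a b :=
    ((hg.continuousOn hab.le).mul hc.continuousOn).intervalIntegrable_of_Icc hab.le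
  beta_reduce at h
  rw [mode_left, mode_right hab, intervalIntegral.integral_add i1 i2, intervalIntegral_eq_Ioo hab.le,
    intervalIntegral_eq_Ioo hab.le, hper] at h
  simp only [mul_left_comm (g _)] at h
  rw [integral_const_mul] at h
  rw [SEWI.fourierCoef_eq, SEWI.fourierCoef_eq]
  linear_combination (-(1 / ((b : ℂ) - a))) * h

/-- The Fourier mode `e^{i μ_l (x - a)}`. -/
noncomputable def wave (a b : ℝ) (l : ℤ) (x : ℝ) : ℂ :=
  Complex.exp (Complex.I * (freq a b l : ℂ) * ((x : ℂ) - a))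

theorem wave_eq_mode_neg (l : ℤ) : wave a b l = mode a b (-l) := by
  ext x
  rw [wave, mode]
  congr 1
  simp only [freq]
  push_cast
  ring

theorem freq_neg (l : ℤ) : freq a b (-l) = - freq a b l := by
  simp only [freq]; push_cast; ring

theorem wave_hasDerivAt (l : ℤ) (x : ℝ) :
    HasDerivAt (wave a b l) (Complex.I * (freq a b l : ℂ) * wave a b l x) x := by
  have := mode_hasDerivAt (a := a) (b := b) (-l) x
  rw [← wave_eq_mode_neg, freq_neg] at this
  simpa using this

theorem wave_continuous (l : ℤ) : Continuous (wave a b l) := by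
  rw [wave_eq_mode_neg]; exact mode_continuous _

theorem fourierCoef_wave (hab : a < b) (m l : ℤ) :
    fourierCoef a b (wave a b m) l = if l = m then 1 else 0 := by
  have hpos : 0 < b - a := sub_pos.2 hab
  have hne : (b : ℂ) - a ≠ 0 := by
    rw [← Complex.ofReal_sub]; exact_mod_cast hpos.ne'
  split_ifs with h
  · subst h
    rw [fourierCoef_eq]
    have : ∀ x, wave a b l x * mode a b l x = 1 := fun x => by
      rw [wave, mode, ← Complex.exp_add, ← Complex.exp_zero]; congr 1; ring
    simp only [this]
    simp [hab.le]
    field_simp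
  -- Orthogonality without computing the integral: the wave is an eigenfunction of the derivative,
  -- so the derivative rule gives (μ_m - μ_l) times the coefficient equal to 0.
  · have h1 := (IsPrim.of_hasDerivAt (a := a) (b := b) (wave_hasDerivAt (a := a) (b := b) m)
      (continuous_const.mul (wave_continuous m))).fourierCoef_eq hab
      (by rw [wave_eq_mode_neg, mode_left, mode_right hab]) l
    rw [fourierCoef_const_mul] at h1
    have h2 : (freq a b m : ℂ) - freq a b l ≠ 0 := by
      intro e
      rw [sub_eq_zero, Complex.ofReal_inj, freq, freq] at e
      field_simp at e
      exact h (by exact_mod_cast e.symm)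
    have h3 : ((freq a b m : ℂ) - freq a b l) * fourierCoef a b (wave a b m) l = 0 := by
      have : Complex.I * (((freq a b m : ℂ) - freq a b l) * fourierCoef a b (wave a b m) l) = 0 := by
        linear_combination h1
      exact (mul_eq_zero.1 this).resolve_left Complex.I_ne_zero
    exact (mul_eq_zero.1 h3).resolve_left h2

theorem trigPoly_eq (N : ℕ) (c : ℤ → ℂ) (x : ℝ) :
    trigPoly a b N c x = ∑ l ∈ indexSet N, c l * wave a b l x := rfl

/-- The derivative of the trigonometric polynomial `trigPoly a b N c`. -/
noncomputable def trigPolyDeriv (a b : ℝ) (N : ℕ) (c : ℤ → ℂ) : ℝ → ℂ :=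
  trigPoly a b N fun l => Complex.I * freq a b l * c l

theorem trigPoly_hasDerivAt (N : ℕ) (c : ℤ → ℂ) (x : ℝ) :
    HasDerivAt (trigPoly a b N c) (trigPolyDeriv a b N c x) x := by
  have : HasDerivAt (fun x => ∑ l ∈ indexSet N, c l * wave a b l x)
      (∑ l ∈ indexSet N, c l * (Complex.I * freq a b l * wave a b l x)) x :=
    HasDerivAt.fun_sum fun l _ => (wave_hasDerivAt l x).const_mul _
  refine this.congr_deriv ?_
  symm
  change ∑ l ∈ indexSet N, (Complex.I * freq a b l * c l) * wave a b l x = _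
  exact Finset.sum_congr rfl fun l _ => by ring

theorem trigPoly_continuous (N : ℕ) (c : ℤ → ℂ) : Continuous (trigPoly a b N c) :=
  continuous_iff_continuousAt.2 fun x => (trigPoly_hasDerivAt N c x).continuousAt

theorem trigPoly_periodic (hab : a < b) (N : ℕ) (c : ℤ → ℂ) :
    trigPoly a b N c a = trigPoly a b N c b := by
  rw [trigPoly_eq, trigPoly_eq]
  exact Finset.sum_congr rfl fun l _ => by
    rw [wave_eq_mode_neg, mode_left, mode_right hab]

theorem integrable_of_continuous {u : ℝ → ℂ} (hu : Continuous u) : Integrable u (vol a b) :=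
  integrable_of_memLp (memLp_of_continuousOn hu.continuousOn)

theorem fourierCoef_trigPoly (hab : a < b) (N : ℕ) (c : ℤ → ℂ) (l : ℤ) :
    fourierCoef a b (trigPoly a b N c) l = if l ∈ indexSet N then c l else 0 := by
  have h : ∀ S : Finset ℤ, fourierCoef a b (fun x => ∑ m ∈ S, c m * wave a b m x) l
      = ∑ m ∈ S, c m * (if l = m then 1 else 0) := by
    intro S
    induction S using Finset.induction_on with
    | empty => simp [fourierCoef]
    | insert m S hm ih =>
      simp only [Finset.sum_insert hm]
      rw [fourierCoef_add, ih, fourierCoef_const_mul, fourierCoef_wave hab]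
      · exact integrable_of_continuous (continuous_const.mul (wave_continuous m))
      · exact integrable_of_continuous
          (continuous_finsetSum _ fun m _ => continuous_const.mul (wave_continuous m))
  have := h (indexSet N)
  simp only [mul_ite, mul_one, mul_zero, Finset.sum_ite_eq] at this
  exact this

/-! ### Weighted `ℓ²` norms -/

/-- The weighted `ℓ²` norm of the finite family `c l`, `l ∈ S`. -/
noncomputable def ell (S : Finset ℤ) (w : ℤ → ℝ) (c : ℤ → ℂ) : ℝ :=
  Real.sqrt (∑ l ∈ S, (w l * ‖c l‖) ^ 2)

variable {S : Finset ℤ} {ν : ℤ → ℝ} {c d : ℤ → ℂ}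

theorem ell_nonneg : 0 ≤ ell S ν c := Real.sqrt_nonneg _

theorem ell_sq : ell S ν c ^ 2 = ∑ l ∈ S, (ν l * ‖c l‖) ^ 2 :=
  Real.sq_sqrt (Finset.sum_nonneg fun _ _ => sq_nonneg _)

theorem ell_eq_norm : ell S ν c
    = ‖(WithLp.toLp 2 fun l : S => (ν l : ℂ) * c l : EuclideanSpace ℂ S)‖ := by
  rw [ell, EuclideanSpace.norm_eq]
  congr 1
  rw [← Finset.sum_coe_sort S]
  refine Finset.sum_congr rfl fun l _ => ?_
  simp [mul_pow]

theorem ell_add_le : ell S ν (fun l => c l + d l) ≤ ell S ν c + ell S ν d := by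
  rw [ell_eq_norm, ell_eq_norm, ell_eq_norm]
  refine le_trans (le_of_eq ?_) (norm_add_le _ _)
  congr 1
  ext l
  simp [mul_add]

theorem ell_mono {r : ℝ} (hr : 0 ≤ r) (h : ∀ l ∈ S, ‖c l‖ ≤ r * ‖d l‖) :
    ell S ν c ≤ r * ell S ν d := by
  refine Real.sqrt_le_iff.2 ⟨mul_nonneg hr ell_nonneg, ?_⟩
  rw [mul_pow, ell_sq, Finset.mul_sum]
  refine Finset.sum_le_sum fun l hl => ?_
  have := pow_le_pow_left₀ (norm_nonneg _) (h l hl) 2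
  calc (ν l * ‖c l‖) ^ 2 = ν l ^ 2 * ‖c l‖ ^ 2 := by ring
    _ ≤ ν l ^ 2 * (r * ‖d l‖) ^ 2 := mul_le_mul_of_nonneg_left this (sq_nonneg _)
    _ = _ := by ring

theorem ell_congr (h : ∀ l ∈ S, c l = d l) : ell S ν c = ell S ν d := by
  rw [ell, ell, Finset.sum_congr rfl fun l hl => by rw [h l hl]]

/-- Minkowski's integral inequality: the weighted family is a curve in a Euclidean space, and the
norm of its integral is at most the integral of its norm. -/
theorem ell_integral_le {φ : ℝ → ℤ → ℂ} {α β K : ℝ} (hαβ : α ≤ β)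
    (hc : ∀ l ∈ S, ContinuousOn (fun s => φ s l) (Icc α β))
    (hK : ∀ s ∈ Icc α β, ell S ν (φ s) ≤ K) :
    ell S ν (fun l => ∫ s in α..β, φ s l) ≤ K * (β - α) := by
  set Φ : ℝ → EuclideanSpace ℂ S := fun s => WithLp.toLp 2 fun l : S => (ν l : ℂ) * φ s l with hΦ
  have hΦc : ContinuousOn Φ (Icc α β) := by
    refine (PiLp.continuous_toLp 2 (fun _ : S => ℂ)).comp_continuousOn ?_
    exact continuousOn_pi.2 fun l => continuousOn_const.mul (hc l l.2)
  have hi : IntervalIntegrable Φ volume α β := hΦc.intervalIntegrable_of_Icc hαβ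
  have e : (WithLp.toLp 2 fun l : S => (ν l : ℂ) * ∫ s in α..β, φ s l : EuclideanSpace ℂ S)
      = ∫ s in α..β, Φ s := by
    ext l
    have := (EuclideanSpace.proj (𝕜 := ℂ) l).intervalIntegral_comp_comm hi
    change ∫ s in α..β, (ν l : ℂ) * φ s l = (∫ s in α..β, Φ s) l at this
    rw [← this, intervalIntegral.integral_const_mul]
  rw [ell_eq_norm, e]
  have := intervalIntegral.norm_integral_le_of_norm_le_const (a := α) (b := β) (C := K) (f := Φ)
    fun s hs => by
      rw [uIoc_of_le hαβ] at hs
      have := hK s (Ioc_subset_Icc_self hs)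
      rwa [ell_eq_norm] at this
  rwa [abs_of_nonneg (sub_nonneg.2 hαβ)] at this

/-- Cauchy–Schwarz. Applied to the local error, it makes the H¹ norm the geometric mean of the H²
and L² bounds. -/
theorem ell_interpolation {ν₁ : ℤ → ℝ} (h : ∀ l, ν₁ l ^ 2 = ν l) :
    ell S ν₁ c ^ 2 ≤ ell S ν c * ell S (fun _ => 1) c := by
  refine le_of_sq_le_sq ?_ (mul_nonneg ell_nonneg ell_nonneg)
  rw [mul_pow, ell_sq, ell_sq, ell_sq]
  refine le_trans (le_of_eq ?_) (Finset.sum_mul_sq_le_sq_mul_sq S _ _)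
  congr 1
  refine Finset.sum_congr rfl fun l _ => ?_
  rw [← h]; ring

theorem ell_fourierCoef_le (hab : a < b) {u : ℝ → ℂ} (hu : MemLp u 2 (vol a b)) :
    ell S (fun _ => 1) (fourierCoef a b u) ≤ (Real.sqrt (b - a))⁻¹ * nrm a b u := by
  have hpos : 0 < b - a := sub_pos.2 hab
  refine Real.sqrt_le_iff.2 ⟨mul_nonneg (by positivity) (nrm_nonneg _), ?_⟩
  rw [mul_pow, inv_pow, Real.sq_sqrt hpos.le]
  simp only [one_mul]
  exact sum_le_hasSum S (fun _ _ => by positivity) (hasSum_fourierCoef hab hu)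

/-- The weight `(1 + μ_l²)^{1/2}` of the `H¹` norm. -/
noncomputable def wt₁ (a b : ℝ) (l : ℤ) : ℝ := Real.sqrt (1 + freq a b l ^ 2)

/-- The weight `1 + μ_l²` of the `H²` norm. -/
noncomputable def wt₂ (a b : ℝ) (l : ℤ) : ℝ := 1 + freq a b l ^ 2

theorem wt₁_sq (l : ℤ) : wt₁ a b l ^ 2 = wt₂ a b l := Real.sq_sqrt (by positivity)

theorem ell_wt₁_le (hab : a < b) (hg : IsPrim a b g g₁) (hper : g a = g b)
    (hg₁ : MemLp g₁ 2 (vol a b)) :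
    ell S (wt₁ a b) (fourierCoef a b g) ≤ (Real.sqrt (b - a))⁻¹ * (nrm a b g + nrm a b g₁) := by
  have hgm := memLp_of_continuousOn (hg.continuousOn hab.le)
  have h1 := ell_fourierCoef_le (S := S) hab hgm
  have h2 := ell_fourierCoef_le (S := S) hab hg₁
  have h3 : ell S (wt₁ a b) (fourierCoef a b g) ^ 2
      = ell S (fun _ => 1) (fourierCoef a b g) ^ 2 + ell S (fun _ => 1) (fourierCoef a b g₁) ^ 2 := by
    rw [ell_sq, ell_sq, ell_sq, ← Finset.sum_add_distrib]
    refine Finset.sum_congr rfl fun l _ => ?_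
    rw [hg.fourierCoef_eq hab hper, mul_pow, wt₁_sq, wt₂]
    simp [mul_pow]
    ring
  rw [mul_add]
  refine le_trans ?_ (add_le_add h1 h2)
  refine le_of_sq_le_sq ?_ (add_nonneg ell_nonneg ell_nonneg)
  rw [h3]
  nlinarith [ell_nonneg (S := S) (ν := fun _ => 1) (c := fourierCoef a b g),
    ell_nonneg (S := S) (ν := fun _ => 1) (c := fourierCoef a b g₁)]

theorem ell_wt₂_le (hab : a < b) {g₂ : ℝ → ℂ} (hg : IsPrim a b g g₁) (hper : g a = g b)
    (hg₁ : IsPrim a b g₁ g₂) (hper₁ : g₁ a = g₁ b) (hg₂ : MemLp g₂ 2 (vol a b)) :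
    ell S (wt₂ a b) (fourierCoef a b g) ≤ (Real.sqrt (b - a))⁻¹ * (nrm a b g + nrm a b g₂) := by
  have hgm := memLp_of_continuousOn (hg.continuousOn hab.le)
  have h1 := ell_fourierCoef_le (S := S) hab hgm
  have h2 := ell_fourierCoef_le (S := S) hab hg₂
  rw [mul_add]
  refine le_trans ?_ (add_le_add h1 h2)
  have h3 : ell S (wt₂ a b) (fourierCoef a b g)
      = ell S (fun _ => 1) (fun l => wt₂ a b l * fourierCoef a b g l) := by
    rw [ell, ell]
    congr 1
    refine Finset.sum_congr rfl fun l _ => ?_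
    rw [norm_mul, Complex.norm_real, Real.norm_of_nonneg (by rw [wt₂]; positivity), one_mul]
  -- Two derivatives multiply a coefficient by (iμ)² = -μ², so (1 + μ²)ĝ is the coefficient of g -
  -- g₂; hence the sign.
  have h4 : ell S (fun _ => 1) (fun l => - fourierCoef a b g₂ l)
      ≤ 1 * ell S (fun _ => 1) (fourierCoef a b g₂) := ell_mono zero_le_one fun l _ => by rw [norm_neg, one_mul]
  rw [one_mul] at h4
  rw [h3]
  refine le_trans (le_of_eq (ell_congr fun l _ => ?_)) (ell_add_le.trans (add_le_add_right h4 _))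
  rw [hg₁.fourierCoef_eq hab hper₁, hg.fourierCoef_eq hab hper, wt₂]
  push_cast
  linear_combination ((freq a b l : ℂ) ^ 2 * fourierCoef a b g l) * Complex.I_sq

end SEWI

namespace SEWI

open ComplexConjugate

/-! ### Locally Lipschitz functions -/

/-- `H` is Lipschitz on bounded sets. -/
def LocLip {X : Type*} [SeminormedAddCommGroup X] (H : X → ℂ) : Prop :=
  ∀ M : ℝ, ∃ C : ℝ, 0 ≤ C ∧ ∀ x y, ‖x‖ ≤ M → ‖y‖ ≤ M → ‖H x - H y‖ ≤ C * ‖x - y‖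

/-- `H` is bounded on bounded sets. -/
def LocBdd {X : Type*} [SeminormedAddCommGroup X] (H : X → ℂ) : Prop :=
  ∀ M : ℝ, ∃ C : ℝ, 0 ≤ C ∧ ∀ x, ‖x‖ ≤ M → ‖H x‖ ≤ C

section

variable {X Y : Type*} [SeminormedAddCommGroup X] [SeminormedAddCommGroup Y] {H H' : X → ℂ}

theorem LocLip.locBdd (h : LocLip H) : LocBdd H := by
  intro M
  obtain ⟨C, hC, h⟩ := h (max M 0)
  refine ⟨C * max M 0 + ‖H 0‖, by positivity, fun x hx => ?_⟩
  have := h x 0 (hx.trans (le_max_left _ _)) (by simp)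
  have h2 := norm_le_norm_sub_add (H x) (H 0)
  rw [sub_zero] at this
  nlinarith [hx.trans (le_max_left M 0)]

theorem LocLip.add (h : LocLip H) (h' : LocLip H') : LocLip fun x => H x + H' x := by
  intro M
  obtain ⟨C, hC, h⟩ := h M
  obtain ⟨C', hC', h'⟩ := h' M
  refine ⟨C + C', by positivity, fun x y hx hy => ?_⟩
  rw [add_sub_add_comm, add_mul]
  exact (norm_add_le _ _).trans (add_le_add (h x y hx hy) (h' x y hx hy))

theorem LocLip.mul (h : LocLip H) (h' : LocLip H') : LocLip fun x => H x * H' x := by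
  intro M
  obtain ⟨D, hD, b⟩ := h.locBdd M
  obtain ⟨D', hD', b'⟩ := h'.locBdd M
  obtain ⟨C, hC, h⟩ := h M
  obtain ⟨C', hC', h'⟩ := h' M
  refine ⟨C * D' + D * C', by positivity, fun x y hx hy => ?_⟩
  rw [show H x * H' x - H y * H' y = (H x - H y) * H' x + H y * (H' x - H' y) by ring]
  refine (norm_add_le _ _).trans ?_
  rw [norm_mul, norm_mul]
  have e1 := mul_le_mul (h x y hx hy) (b' x hx) (norm_nonneg _) (by positivity)
  have e2 := mul_le_mul (b y hy) (h' x y hx hy) (norm_nonneg _) hD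
  linarith

theorem LocLip.conj (h : LocLip H) : LocLip fun x => conj (H x) := by
  intro M
  obtain ⟨C, hC, h⟩ := h M
  refine ⟨C, hC, fun x y hx hy => ?_⟩
  rw [← map_sub, RCLike.norm_conj]
  exact h x y hx hy

theorem LocLip.const (c : ℂ) : LocLip fun _ : X => c := fun _ => ⟨0, le_rfl, by simp⟩

theorem LocLip.const_mul (h : LocLip H) (c : ℂ) : LocLip fun x => c * H x := (LocLip.const c).mul h

theorem LocLip.id : LocLip fun z : ℂ => z := fun _ => ⟨1, zero_le_one, by simp⟩

theorem LocLip.comp_fst (h : LocLip H) : LocLip fun p : X × Y => H p.1 := by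
  intro M
  obtain ⟨C, hC, h⟩ := h M
  refine ⟨C, hC, fun x y hx hy => ?_⟩
  refine (h x.1 y.1 ((le_max_left _ _).trans hx) ((le_max_left _ _).trans hy)).trans ?_
  exact mul_le_mul_of_nonneg_left (le_max_left _ _) hC

theorem LocLip.comp_snd (h : LocLip H) : LocLip fun p : Y × X => H p.2 := by
  intro M
  obtain ⟨C, hC, h⟩ := h M
  refine ⟨C, hC, fun x y hx hy => ?_⟩
  refine (h x.2 y.2 ((le_max_right _ _).trans hx) ((le_max_right _ _).trans hy)).trans ?_
  exact mul_le_mul_of_nonneg_left (le_max_right _ _) hC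

theorem LocBdd.const_mul (h : LocBdd H) (c : ℂ) : LocBdd fun x => c * H x := by
  intro M
  obtain ⟨C, hC, h⟩ := h M
  refine ⟨‖c‖ * C, by positivity, fun x hx => ?_⟩
  rw [norm_mul]
  exact mul_le_mul_of_nonneg_left (h x hx) (norm_nonneg _)

theorem LocLip.continuous (h : LocLip H) : Continuous H := by
  rw [continuous_iff_continuousAt]
  intro x
  obtain ⟨C, hC, h⟩ := h (‖x‖ + 1)
  rw [ContinuousAt, tendsto_iff_norm_sub_tendsto_zero]
  have h0 : Tendsto (fun y => C * ‖y - x‖) (𝓝 x) (𝓝 0) := by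
    have : Continuous fun y => C * ‖y - x‖ := by fun_prop
    simpa using this.tendsto x
  refine squeeze_zero' (Eventually.of_forall fun _ => norm_nonneg _) ?_ h0
  filter_upwards [Metric.ball_mem_nhds x one_pos] with y hy
  rw [mem_ball_iff_norm] at hy
  refine h y x ?_ (by linarith)
  linarith [norm_le_norm_sub_add y x]

end

/-! ### Wirtinger derivatives along curves -/

/-- `P` and `Q` are the Wirtinger derivatives `∂F/∂z` and `∂F/∂z̄`, in the form of a chain rule along
curves. -/
def WDeriv (F P Q : ℂ → ℂ) : Prop :=
  ∀ (u : ℝ → ℂ) (u' : ℂ) (x : ℝ), HasDerivAt u u' x →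
    HasDerivAt (fun y => F (u y)) (P (u x) * u' + Q (u x) * conj u') x

variable {F P Q : ℂ → ℂ}

theorem WDeriv.const_mul (h : WDeriv F P Q) (c : ℂ) :
    WDeriv (fun z => c * F z) (fun z => c * P z) (fun z => c * Q z) := fun u u' x hu =>
  ((h u u' x hu).const_mul c).congr_deriv (by ring)

theorem segment_hasDerivAt (z w : ℂ) (x : ℝ) :
    HasDerivAt (fun t : ℝ => w + t * (z - w)) (z - w) x := by
  have := ((hasDerivAt_id x).ofReal_comp.mul_const (z - w)).const_add w
  simpa using this

theorem norm_segment_le {z w : ℂ} {M : ℝ} (hz : ‖z‖ ≤ M) (hw : ‖w‖ ≤ M) {t : ℝ}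
    (ht : t ∈ Icc (0 : ℝ) 1) : ‖w + t * (z - w)‖ ≤ M := by
  have := (convex_closedBall (0 : ℂ) M).add_smul_sub_mem (x := w) (y := z) (by simpa using hw)
    (by simpa using hz) ht
  simpa using this

theorem WDeriv.locLip (h : WDeriv F P Q) (hP : LocBdd P) (hQ : LocBdd Q) : LocLip F := by
  intro M
  obtain ⟨C, hC, hP⟩ := hP M
  obtain ⟨C', hC', hQ⟩ := hQ M
  refine ⟨C + C', by positivity, fun z w hz hw => ?_⟩
  have := norm_image_sub_le_of_norm_deriv_le_segment_01'
    (f := fun t : ℝ => F (w + t * (z - w))) (C := (C + C') * ‖z - w‖)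
    (fun t _ => (h _ _ t (segment_hasDerivAt z w t)).hasDerivWithinAt) (fun t ht => by
      have hs := norm_segment_le hz hw (Ico_subset_Icc_self ht)
      refine (norm_add_le _ _).trans ?_
      rw [norm_mul, norm_mul, RCLike.norm_conj, add_mul]
      exact add_le_add (mul_le_mul_of_nonneg_right (hP _ hs) (norm_nonneg _))
        (mul_le_mul_of_nonneg_right (hQ _ hs) (norm_nonneg _)))
  simpa using this

/-- The mean value inequality along the segment from `w` to `z`, applied to the remainder: its
derivative is ≤ C‖z - w‖² because the Wirtinger derivatives are Lipschitz. -/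
theorem WDeriv.taylor (h : WDeriv F P Q) (hP : LocLip P) (hQ : LocLip Q) (M : ℝ) :
    ∃ C : ℝ, 0 ≤ C ∧ ∀ z w, ‖z‖ ≤ M → ‖w‖ ≤ M →
      ‖F z - F w - (P w * (z - w) + Q w * conj (z - w))‖ ≤ C * ‖z - w‖ ^ 2 := by
  obtain ⟨C, hC, hP⟩ := hP M
  obtain ⟨C', hC', hQ⟩ := hQ M
  refine ⟨C + C', by positivity, fun z w hz hw => ?_⟩
  have := norm_image_sub_le_of_norm_deriv_le_segment_01'
    (f := fun t : ℝ => F (w + t * (z - w)) - t * (P w * (z - w) + Q w * conj (z - w)))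
    (C := (C + C') * ‖z - w‖ ^ 2)
    (fun t _ => ((h _ _ t (segment_hasDerivAt z w t)).sub
      ((hasDerivAt_id t).ofReal_comp.mul_const _)).hasDerivWithinAt) (fun t ht => by
      have hs := norm_segment_le hz hw (Ico_subset_Icc_self ht)
      have hd : ‖(w + t * (z - w)) - w‖ ≤ ‖z - w‖ := by
        rw [add_sub_cancel_left, norm_mul, Complex.norm_real, Real.norm_of_nonneg ht.1]
        exact mul_le_of_le_one_left (norm_nonneg _) ht.2.le
      have e1 := (hP _ _ hs hw).trans (mul_le_mul_of_nonneg_left hd hC)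
      have e2 := (hQ _ _ hs hw).trans (mul_le_mul_of_nonneg_left hd hC')
      set s := w + t * (z - w)
      rw [show P s * (z - w) + Q s * conj (z - w) - ((1 : ℝ) : ℂ) *
        (P w * (z - w) + Q w * conj (z - w)) = (P s - P w) * (z - w) + (Q s - Q w) * conj (z - w) by
          push_cast; ring]
      refine (norm_add_le _ _).trans ?_
      rw [norm_mul, norm_mul, RCLike.norm_conj]
      have f1 := mul_le_mul_of_nonneg_right e1 (norm_nonneg (z - w))
      have f2 := mul_le_mul_of_nonneg_right e2 (norm_nonneg (z - w))
      linarith)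
  simp only [Complex.ofReal_one, Complex.ofReal_zero, one_mul, zero_mul, add_sub_cancel, add_zero,
    sub_zero] at this
  rwa [sub_right_comm]

/-! ### The power nonlinearity -/

/-- The function `|z|^{2s} z^j`. -/
noncomputable def powFun (s : ℝ) (j : ℕ) (z : ℂ) : ℂ := (((‖z‖ ^ 2) ^ s : ℝ) : ℂ) * z ^ j

theorem norm_powFun (s : ℝ) (j : ℕ) {z : ℂ} (hz : z ≠ 0) : ‖powFun s j z‖ = ‖z‖ ^ (2 * s + j) := by
  have h : 0 < ‖z‖ := norm_pos_iff.2 hz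
  rw [powFun, norm_mul, Complex.norm_real, Real.norm_of_nonneg (by positivity), norm_pow,
    Real.rpow_add h, Real.rpow_mul h.le, Real.rpow_natCast, Real.rpow_ofNat]

theorem powFun_locBdd {s : ℝ} {j : ℕ} (h : 0 ≤ 2 * s + j) : LocBdd (powFun s j) := by
  intro M
  -- The value at 0 is added separately, since `norm_powFun` concerns only nonzero `z`.
  refine ⟨max M 0 ^ (2 * s + j) + ‖powFun s j 0‖, by positivity, fun z hz => ?_⟩
  by_cases h0 : z = 0
  · subst h0
    have : 0 ≤ max M 0 ^ (2 * s + j) := by positivity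
    linarith
  · rw [norm_powFun s j h0]
    have := Real.rpow_le_rpow (norm_nonneg z) (hz.trans (le_max_left M 0)) h
    linarith [norm_nonneg (powFun s j 0)]

theorem normSq_rpow_hasDerivAt {s : ℝ} {u : ℝ → ℂ} {u' : ℂ} {x : ℝ} (hu : HasDerivAt u u' x)
    (h : u x ≠ 0 ∨ 1 ≤ s) : HasDerivAt (fun y => (((‖u y‖ ^ 2) ^ s : ℝ) : ℂ))
      ((s * (‖u x‖ ^ 2) ^ (s - 1) : ℝ) * (conj (u x) * u' + u x * conj u')) x := by
  have h1 : HasDerivAt (fun y => ‖u y‖ ^ 2) (2 * inner ℝ (u x) u') x := hu.norm_sq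
  have h2 := h1.rpow_const (p := s) (h.imp_left fun h => by simpa using h)
  refine h2.ofReal_comp.congr_deriv ?_
  have : ((2 * inner ℝ (u x) u' : ℝ) : ℂ) = conj (u x) * u' + u x * conj u' := by
    rw [Complex.inner]
    apply Complex.ext <;> simp <;> ring
  rw [← this]
  push_cast
  ring

/-- Away from zeros of `u` this is the product rule. At a zero the real power need not be
differentiable, but the function is homogeneous of degree 2s + j + 1 > 1, hence o(|u|), and both
sides vanish. -/
theorem powFun_wDeriv {s : ℝ} {j : ℕ} (h : 0 < 2 * s + j) :
    WDeriv (powFun s (j + 1)) (fun z => (s + j + 1) * powFun s j z)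
      (fun z => s * powFun (s - 1) (j + 2) z) := by
  intro u u' x hu
  by_cases h0 : u x = 0
  · have hz : (s + j + 1 : ℂ) * powFun s j (u x) * u' + s * powFun (s - 1) (j + 2) (u x) * conj u'
        = 0 := by
      rw [h0]
      have e1 : powFun (s - 1) (j + 2) 0 = 0 := by simp [powFun]
      have e2 : powFun s j 0 = 0 := by
        rcases Nat.eq_zero_or_pos j with hj | hj
        · subst hj
          have : s ≠ 0 := by rintro rfl; simp at h
          simp [powFun, Real.zero_rpow this]
        · simp [powFun, hj.ne']
      rw [e1, e2]; simp
    rw [hz]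
    rw [hasDerivAt_iff_isLittleO]
    have hO : (fun y => u y) =O[𝓝 x] fun y => y - x := by
      have := hu.isBigO_sub
      simpa [h0] using this
    have hlit : (fun y => powFun s (j + 1) (u y)) =o[𝓝 x] fun y => u y := by
      rw [Asymptotics.isLittleO_iff]
      intro c hc
      have ht : Tendsto (fun y => ‖u y‖ ^ (2 * s + j)) (𝓝 x) (𝓝 0) := by
        have h1 := (hu.continuousAt.norm).rpow_const (p := 2 * s + j) (Or.inr h.le)
        rw [ContinuousAt, h0, norm_zero, Real.zero_rpow h.ne'] at h1
        exact h1
      filter_upwards [ht.eventually (gt_mem_nhds hc)] with y hy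
      by_cases hy0 : u y = 0
      · simp [hy0, powFun]
      · rw [norm_powFun _ _ hy0]
        have hp : 0 < ‖u y‖ := norm_pos_iff.2 hy0
        push_cast
        rw [← add_assoc, Real.rpow_add hp, Real.rpow_one]
        exact mul_le_mul_of_nonneg_right hy.le hp.le
    have e : powFun s (j + 1) (u x) = 0 := by simp [powFun, h0]
    simpa [e] using hlit.trans_isBigO hO
  · have h1 := (normSq_rpow_hasDerivAt (s := s) hu (Or.inl h0)).mul (hu.fun_pow (j + 1))
    refine h1.congr_deriv ?_
    have hp : (0:ℝ) < ‖u x‖ ^ 2 := by have := norm_pos_iff.2 h0; positivity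
    have e : (((‖u x‖ ^ 2) ^ s : ℝ) : ℂ) = (((‖u x‖ ^ 2) ^ (s - 1) : ℝ) : ℂ) * (u x * conj (u x)) := by
      rw [Complex.mul_conj, Complex.normSq_eq_norm_sq, ← Complex.ofReal_mul, Real.rpow_sub_one hp.ne']
      congr 1
      field_simp
    simp only [powFun, Nat.add_sub_cancel, e]
    push_cast
    ring

theorem powFun_zero_wDeriv {s : ℝ} (h : 1 ≤ s) :
    WDeriv (powFun s 0) (fun z => s * conj (powFun (s - 1) 1 z))
      (fun z => s * powFun (s - 1) 1 z) := by
  intro u u' x hu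
  have h1 := normSq_rpow_hasDerivAt (s := s) hu (Or.inr h)
  simp only [powFun, pow_zero, mul_one, pow_one, map_mul, Complex.conj_ofReal]
  refine h1.congr_deriv ?_
  push_cast
  ring

/-- The function `F` has Wirtinger derivatives up to order two, all of them locally Lipschitz. -/
structure WDeriv₂ (F P Q P₁ P₂ Q₁ Q₂ : ℂ → ℂ) : Prop where
  dF : WDeriv F P Q
  dP : WDeriv P P₁ P₂
  dQ : WDeriv Q Q₁ Q₂
  lP₁ : LocLip P₁
  lP₂ : LocLip P₂
  lQ₁ : LocLip Q₁
  lQ₂ : LocLip Q₂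

theorem powFun_locLip_one {σ : ℝ} (hσ : 1 ≤ σ) : LocLip (powFun (σ - 1) 1) := by
  rcases hσ.eq_or_lt with rfl | h
  · have : powFun (1 - 1) 1 = fun z => z := by ext z; simp [powFun]
    rw [this]
    exact LocLip.id
  · have h1 : (0:ℝ) < 2 * (σ - 1) + (0:ℕ) := by push_cast; linarith
    refine (powFun_wDeriv (s := σ - 1) (j := 0) h1).locLip
      ((powFun_locBdd h1.le).const_mul _) ((powFun_locBdd ?_).const_mul _)
    push_cast; linarith

/-- For σ > 1 the first Wirtinger derivatives are locally bounded. At σ = 1 the degree drops to one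
and `powFun_wDeriv` does not apply, but the factor σ - 1 produced by differentiation vanishes. -/
theorem powFun_locLip_three {σ : ℝ} (hσ : 1 ≤ σ) :
    LocLip fun z => ((σ - 1 : ℝ) : ℂ) * powFun (σ - 2) 3 z := by
  rcases hσ.eq_or_lt with rfl | h
  · simpa using LocLip.const (X := ℂ) 0
  · refine LocLip.const_mul ?_ _
    refine (powFun_wDeriv (s := σ - 2) (j := 2) ?_).locLip
      ((powFun_locBdd ?_).const_mul _) ((powFun_locBdd ?_).const_mul _) <;> push_cast <;> linarith

/-- The second Wirtinger derivatives are homogeneous of degree 2σ - 1. This is at least 1 precisely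
when σ ≥ 1, and then they are locally Lipschitz. -/
theorem powFun_wDeriv₂ {σ : ℝ} (hσ : 1 ≤ σ) :
    ∃ P Q P₁ P₂ Q₁ Q₂, WDeriv₂ (powFun σ 1) P Q P₁ P₂ Q₁ Q₂ := by
  refine ⟨_, _, _, _, _, _, powFun_wDeriv (s := σ) (j := 0) (by push_cast; linarith),
    (powFun_zero_wDeriv hσ).const_mul _,
    (powFun_wDeriv (s := σ - 1) (j := 1) (by push_cast; linarith)).const_mul _, ?_, ?_, ?_, ?_⟩
  · exact ((powFun_locLip_one hσ).conj.const_mul _).const_mul _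
  · exact ((powFun_locLip_one hσ).const_mul _).const_mul _
  · exact ((powFun_locLip_one hσ).const_mul _).const_mul _
  · have := powFun_locLip_three hσ
    rw [show σ - 2 = σ - 1 - 1 by ring] at this
    exact this.const_mul _

theorem WDeriv₂.const_mul {P₁ P₂ Q₁ Q₂ : ℂ → ℂ} (h : WDeriv₂ F P Q P₁ P₂ Q₁ Q₂) (c : ℂ) :
    WDeriv₂ (fun z => c * F z) (fun z => c * P z) (fun z => c * Q z) (fun z => c * P₁ z)
      (fun z => c * P₂ z) (fun z => c * Q₁ z) (fun z => c * Q₂ z) :=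
  ⟨h.dF.const_mul c, h.dP.const_mul c, h.dQ.const_mul c, h.lP₁.const_mul c, h.lP₂.const_mul c,
    h.lQ₁.const_mul c, h.lQ₂.const_mul c⟩

theorem WDeriv₂.lP {P₁ P₂ Q₁ Q₂ : ℂ → ℂ} (h : WDeriv₂ F P Q P₁ P₂ Q₁ Q₂) : LocLip P :=
  h.dP.locLip h.lP₁.locBdd h.lP₂.locBdd

theorem WDeriv₂.lQ {P₁ P₂ Q₁ Q₂ : ℂ → ℂ} (h : WDeriv₂ F P Q P₁ P₂ Q₁ Q₂) : LocLip Q :=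
  h.dQ.locLip h.lQ₁.locBdd h.lQ₂.locBdd

theorem WDeriv₂.lF {P₁ P₂ Q₁ Q₂ : ℂ → ℂ} (h : WDeriv₂ F P Q P₁ P₂ Q₁ Q₂) : LocLip F :=
  h.dF.locLip h.lP.locBdd h.lQ.locBdd

end SEWI

/-! ### The abstract equation and Lipschitz bounds for `B` in L², H¹ and H² -/

namespace SEWI

open ComplexConjugate

/-- The data of the equation `i ∂_t ψ = -Δψ + V ψ + F(ψ)` on `(a, b)` with periodic boundary
conditions: a potential in `H²_per` and a nonlinearity with two locally Lipschitz derivatives. -/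
structure Model (a b : ℝ) where
  (V V₁ V₂ : ℝ → ℂ)
  (F P Q P₁ P₂ Q₁ Q₂ : ℂ → ℂ)
  hab : a < b
  hV : ∀ x, HasDerivAt V (V₁ x) x
  hV₁ : Continuous V₁
  hV₂ : IsPrim a b V₁ V₂
  memLp_V₂ : MemLp V₂ 2 (vol a b)
  per_V : V a = V b
  per_V₁ : V₁ a = V₁ b
  hF : WDeriv₂ F P Q P₁ P₂ Q₁ Q₂

/-- `u` is a periodic `C¹` function with derivative `u₁`. -/
structure PerC1 (a b : ℝ) (u u₁ : ℝ → ℂ) : Prop where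
  d : ∀ x, HasDerivAt u (u₁ x) x
  c : Continuous u₁
  per : u a = u b

/-- `u` is a periodic `C²` function with derivatives `u₁`, `u₂`. -/
structure PerC2 (a b : ℝ) (u u₁ u₂ : ℝ → ℂ) : Prop where
  zero : PerC1 a b u u₁
  one : PerC1 a b u₁ u₂

variable {a b : ℝ} {u u₁ u₂ v v₁ v₂ p p₁ : ℝ → ℂ}

theorem PerC1.continuous (h : PerC1 a b u u₁) : Continuous u :=
  continuous_iff_continuousAt.2 fun x => (h.d x).continuousAt

theorem memLp_of_continuous (h : Continuous u) : MemLp u 2 (vol a b) :=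
  memLp_of_continuousOn h.continuousOn

namespace Model

variable (Θ : Model a b)

/-- The operator `B(u) = V u + F(u)`. -/
def op (u : ℝ → ℂ) (x : ℝ) : ℂ := Θ.V x * u x + Θ.F (u x)

/-- The derivative of `B(u)`. -/
def op₁ (u u₁ : ℝ → ℂ) (x : ℝ) : ℂ :=
  Θ.V₁ x * u x + (Θ.V x * u₁ x + (Θ.P (u x) * u₁ x + Θ.Q (u x) * conj (u₁ x)))

/-- The second derivative of `F(u)`, as a function of the values of `u`, `u'`, `u''`. -/
def nonlin₂ (z : ℂ × ℂ × ℂ) : ℂ :=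
  (Θ.P₁ z.1 * z.2.1 + Θ.P₂ z.1 * conj z.2.1) * z.2.1 + Θ.P z.1 * z.2.2
    + ((Θ.Q₁ z.1 * z.2.1 + Θ.Q₂ z.1 * conj z.2.1) * conj z.2.1 + Θ.Q z.1 * conj z.2.2)

/-- The second derivative of `B(u)`. -/
def op₂ (u u₁ u₂ : ℝ → ℂ) (x : ℝ) : ℂ :=
  (Θ.V₂ x * u x + Θ.V₁ x * u₁ x)
    + (Θ.V₁ x * u₁ x + Θ.V x * u₂ x + Θ.nonlin₂ (u x, u₁ x, u₂ x))

theorem V_continuous : Continuous Θ.V :=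
  continuous_iff_continuousAt.2 fun x => (Θ.hV x).continuousAt

/-- Viewed on triples (u, u', u''), the second derivative is polynomial in the last two entries and
their conjugates, with locally Lipschitz coefficients. -/
theorem nonlin₂_locLip : LocLip Θ.nonlin₂ := by
  have z1 : LocLip fun z : ℂ × ℂ × ℂ => z.2.1 := LocLip.id.comp_fst.comp_snd
  have z2 : LocLip fun z : ℂ × ℂ × ℂ => z.2.2 := LocLip.id.comp_snd.comp_snd
  exact ((((Θ.hF.lP₁.comp_fst.mul z1).add (Θ.hF.lP₂.comp_fst.mul z1.conj)).mul z1).add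
    (Θ.hF.lP.comp_fst.mul z2)).add
    ((((Θ.hF.lQ₁.comp_fst.mul z1).add (Θ.hF.lQ₂.comp_fst.mul z1.conj)).mul z1.conj).add
    (Θ.hF.lQ.comp_fst.mul z2.conj))

theorem op_continuous (hu : Continuous u) : Continuous (Θ.op u) :=
  (Θ.V_continuous.mul hu).add (Θ.hF.lF.continuous.comp hu)

theorem op_perC1 (h : PerC1 a b u u₁) : PerC1 a b (Θ.op u) (Θ.op₁ u u₁) := by
  have hu := h.continuous
  have hc := h.c
  refine ⟨fun x => ?_, ?_, ?_⟩
  · refine (((Θ.hV x).mul (h.d x)).add (Θ.hF.dF u _ x (h.d x))).congr_deriv ?_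
    rw [op₁]; ring
  · have c1 := Θ.hF.lP.continuous
    have c2 := Θ.hF.lQ.continuous
    have c3 := Θ.hV₁
    have c4 := Θ.V_continuous
    have c5 := hc.star
    exact (c3.mul hu).add ((c4.mul hc).add (((c1.comp hu).mul hc).add ((c2.comp hu).mul c5)))
  · simp only [op, Θ.per_V, h.per]

/-- `V₁` is only a primitive of an L² function, so the product `V₁ u` needs `IsPrim.mul`; all other
terms are continuously differentiable. -/
theorem op₁_isPrim (h : PerC2 a b u u₁ u₂) : IsPrim a b (Θ.op₁ u u₁) (Θ.op₂ u u₁ u₂) := by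
  have hu := h.zero.continuous
  have hu₁ := h.zero.c
  have hu₂ := h.one.c
  refine (Θ.hV₂.mul Θ.hab.le h.zero.d h.zero.c).add (IsPrim.of_hasDerivAt (fun x => ?_) ?_)
  · have e := (h.one.d x)
    have e' : HasDerivAt (fun y => conj (u₁ y)) (conj (u₂ x)) x := e.star
    refine (((Θ.hV x).mul e).add (((Θ.hF.dP u _ x (h.zero.d x)).mul e).add
      ((Θ.hF.dQ u _ x (h.zero.d x)).mul e'))).congr_deriv ?_
    rw [nonlin₂]
  · exact ((Θ.hV₁.mul hu₁).add (Θ.V_continuous.mul hu₂)).add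
      (Θ.nonlin₂_locLip.continuous.comp (hu.prodMk (hu₁.prodMk hu₂)))

theorem op₁_per (h : PerC2 a b u u₁ u₂) : Θ.op₁ u u₁ a = Θ.op₁ u u₁ b := by
  simp only [op₁, Θ.per_V, Θ.per_V₁, h.zero.per, h.one.per]

theorem exists_bound_V : ∃ K : ℝ, 0 ≤ K ∧ ∀ x ∈ Icc a b, ‖Θ.V x‖ ≤ K ∧ ‖Θ.V₁ x‖ ≤ K := by
  obtain ⟨K, hK⟩ := (isCompact_Icc (a := a) (b := b)).exists_bound_of_continuousOn
    Θ.V_continuous.continuousOn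
  obtain ⟨K₁, hK₁⟩ := (isCompact_Icc (a := a) (b := b)).exists_bound_of_continuousOn
    Θ.hV₁.continuousOn
  exact ⟨max (max K K₁) 0, le_max_right _ _, fun x hx =>
    ⟨(hK x hx).trans ((le_max_left _ _).trans (le_max_left _ _)),
     (hK₁ x hx).trans ((le_max_right _ _).trans (le_max_left _ _))⟩⟩

theorem fourierCoef_op_sub (hu : Continuous u) (hv : Continuous v) (l : ℤ) :
    fourierCoef a b (Θ.op u) l - fourierCoef a b (Θ.op v) l
      = fourierCoef a b (fun x => Θ.op u x - Θ.op v x) l :=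
  (fourierCoef_sub (integrable_of_continuous (Θ.op_continuous hu))
    (integrable_of_continuous (Θ.op_continuous hv)) l).symm

/-- `B` is locally Lipschitz on `L^∞` with respect to the `L²` norm. -/
theorem op_lipschitz_L2 (M : ℝ) : ∃ C : ℝ, 0 ≤ C ∧ ∀ u v : ℝ → ℂ, Continuous u → Continuous v →
    (∀ x ∈ Icc a b, ‖u x‖ ≤ M) → (∀ x ∈ Icc a b, ‖v x‖ ≤ M) → ∀ S : Finset ℤ,
    ell S (fun _ => 1) (fun l => fourierCoef a b (Θ.op u) l - fourierCoef a b (Θ.op v) l)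
      ≤ C * nrm a b (fun x => u x - v x) := by
  obtain ⟨K, hK, hV⟩ := Θ.exists_bound_V
  obtain ⟨L, hL, hF⟩ := Θ.hF.lF M
  refine ⟨(Real.sqrt (b - a))⁻¹ * (K + L), by positivity, fun u v hu hv hbu hbv S => ?_⟩
  simp only [Θ.fourierCoef_op_sub hu hv]
  refine (ell_fourierCoef_le (u := fun x => Θ.op u x - Θ.op v x) Θ.hab (memLp_of_continuous
    ((Θ.op_continuous hu).sub (Θ.op_continuous hv)))).trans ?_
  rw [mul_assoc]
  refine mul_le_mul_of_nonneg_left ?_ (by positivity)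
  refine nrm_mono (by positivity) (memLp_of_continuous (hu.sub hv))
    (ae_vol_of_forall_Icc fun x hx => ?_)
  rw [show Θ.op u x - Θ.op v x = Θ.V x * (u x - v x) + (Θ.F (u x) - Θ.F (v x)) by
    simp only [op]; ring, add_mul]
  refine (norm_add_le _ _).trans (add_le_add ?_ (hF _ _ (hbu x hx) (hbv x hx)))
  rw [norm_mul]
  exact mul_le_mul_of_nonneg_right (hV x hx).1 (norm_nonneg _)

/-- `B` is locally Lipschitz on `H¹` near functions with bounded derivative. -/
theorem op_lipschitz_H1 (M : ℝ) : ∃ C : ℝ, 0 ≤ C ∧ ∀ u u₁ v v₁ : ℝ → ℂ, PerC1 a b u u₁ →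
    PerC1 a b v v₁ → (∀ x ∈ Icc a b, ‖u x‖ ≤ M) → (∀ x ∈ Icc a b, ‖u₁ x‖ ≤ M) →
    (∀ x ∈ Icc a b, ‖v x‖ ≤ M) → ∀ S : Finset ℤ,
    ell S (wt₁ a b) (fun l => fourierCoef a b (Θ.op u) l - fourierCoef a b (Θ.op v) l)
      ≤ C * (nrm a b (fun x => u x - v x) + nrm a b (fun x => u₁ x - v₁ x)) := by
  obtain ⟨K, hK, hV⟩ := Θ.exists_bound_V
  obtain ⟨L, hL, hF⟩ := Θ.hF.lF M
  obtain ⟨LP, hLP, hP⟩ := Θ.hF.lP M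
  obtain ⟨LQ, hLQ, hQ⟩ := Θ.hF.lQ M
  obtain ⟨BP, hBP, hP'⟩ := Θ.hF.lP.locBdd M
  obtain ⟨BQ, hBQ, hQ'⟩ := Θ.hF.lQ.locBdd M
  set M' := max M 0
  set C₁ := K + (LP + LQ) * M' with hC₁
  set C₂ := K + BP + BQ with hC₂
  have hC₁0 : 0 ≤ C₁ := by positivity
  have hC₂0 : 0 ≤ C₂ := by positivity
  refine ⟨(Real.sqrt (b - a))⁻¹ * (K + L + C₁ + C₂), by positivity,
    fun u u₁ v v₁ hu hv hbu hbu₁ hbv S => ?_⟩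
  have hd := hu.continuous.sub hv.continuous
  have hd₁ := hu.c.sub hv.c
  simp only [Θ.fourierCoef_op_sub hu.continuous hv.continuous]
  have hou := Θ.op_perC1 hu
  have hov := Θ.op_perC1 hv
  refine (ell_wt₁_le Θ.hab ((IsPrim.of_hasDerivAt hou.d hou.c).sub
    (IsPrim.of_hasDerivAt hov.d hov.c)) (by simp only [hou.per, hov.per])
    (memLp_of_continuous (hou.c.sub hov.c))).trans ?_
  rw [mul_assoc]
  refine mul_le_mul_of_nonneg_left ?_ (by positivity)
  have e0 : nrm a b (fun x => Θ.op u x - Θ.op v x) ≤ (K + L) * nrm a b (fun x => u x - v x) := by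
    refine nrm_mono (by positivity) (memLp_of_continuous hd)
      (ae_vol_of_forall_Icc fun x hx => ?_)
    rw [show Θ.op u x - Θ.op v x = Θ.V x * (u x - v x) + (Θ.F (u x) - Θ.F (v x)) by
      simp only [op]; ring, add_mul]
    refine (norm_add_le _ _).trans (add_le_add ?_ (hF _ _ (hbu x hx) (hbv x hx)))
    rw [norm_mul]
    exact mul_le_mul_of_nonneg_right (hV x hx).1 (norm_nonneg _)
  have e1 : nrm a b (fun x => Θ.op₁ u u₁ x - Θ.op₁ v v₁ x)
      ≤ C₁ * nrm a b (fun x => u x - v x) + C₂ * nrm a b (fun x => u₁ x - v₁ x) := by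
    -- The splitting attaches differences of `P` and `Q` to `u₁`, and lets `v₁` occur only in `u₁ -
    -- v₁`. Thus no bound on `v₁`, the derivative of the numerical solution, is ever needed.
    set r₁ : ℝ → ℂ := fun x => Θ.V₁ x * (u x - v x) + ((Θ.P (u x) - Θ.P (v x)) * u₁ x
      + (Θ.Q (u x) - Θ.Q (v x)) * conj (u₁ x)) with hr₁
    set r₂ : ℝ → ℂ := fun x => Θ.V x * (u₁ x - v₁ x) + (Θ.P (v x) * (u₁ x - v₁ x)
      + Θ.Q (v x) * conj (u₁ x - v₁ x)) with hr₂
    have er : (fun x => Θ.op₁ u u₁ x - Θ.op₁ v v₁ x) = fun x => r₁ x + r₂ x := by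
      ext x; simp only [op₁, hr₁, hr₂, map_sub]; ring
    have cu := hu.continuous
    have cv := hv.continuous
    have cP := Θ.hF.lP.continuous
    have cQ := Θ.hF.lQ.continuous
    have m1 : MemLp r₁ 2 (vol a b) := memLp_of_continuous <| (Θ.hV₁.mul hd).add
      ((((cP.comp cu).sub (cP.comp cv)).mul hu.c).add (((cQ.comp cu).sub (cQ.comp cv)).mul hu.c.star))
    have m2 : MemLp r₂ 2 (vol a b) := memLp_of_continuous <| (Θ.V_continuous.mul hd₁).add
      (((cP.comp cv).mul hd₁).add ((cQ.comp cv).mul hd₁.star))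
    rw [er]
    refine (nrm_add_le m1 m2).trans (add_le_add ?_ ?_)
    · refine nrm_mono hC₁0 (memLp_of_continuous hd) (ae_vol_of_forall_Icc fun x hx => ?_)
      have hM' : ‖u₁ x‖ ≤ M' := (hbu₁ x hx).trans (le_max_left _ _)
      refine (norm_add_le _ _).trans ((add_le_add_right (norm_add_le _ _) _).trans ?_)
      rw [norm_mul, norm_mul, norm_mul, RCLike.norm_conj]
      have f1 := mul_le_mul_of_nonneg_right (hV x hx).2 (norm_nonneg (u x - v x))
      have f2 := mul_le_mul (hP _ _ (hbu x hx) (hbv x hx)) hM' (norm_nonneg _) (by positivity)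
      have f3 := mul_le_mul (hQ _ _ (hbu x hx) (hbv x hx)) hM' (norm_nonneg _) (by positivity)
      rw [hC₁]
      linarith
    · refine nrm_mono hC₂0 (memLp_of_continuous hd₁) (ae_vol_of_forall_Icc fun x hx => ?_)
      refine (norm_add_le _ _).trans ((add_le_add_right (norm_add_le _ _) _).trans ?_)
      rw [norm_mul, norm_mul, norm_mul, RCLike.norm_conj]
      have f1 := mul_le_mul_of_nonneg_right (hV x hx).1 (norm_nonneg (u₁ x - v₁ x))
      have f2 := mul_le_mul_of_nonneg_right (hP' _ (hbv x hx)) (norm_nonneg (u₁ x - v₁ x))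
      have f3 := mul_le_mul_of_nonneg_right (hQ' _ (hbv x hx)) (norm_nonneg (u₁ x - v₁ x))
      rw [hC₂]
      linarith
  have n0 := nrm_nonneg (a := a) (b := b) (fun x => u x - v x)
  have n1 := nrm_nonneg (a := a) (b := b) (fun x => u₁ x - v₁ x)
  nlinarith [mul_nonneg hC₂0 n0, mul_nonneg hC₁0 n1, mul_nonneg (add_nonneg hK hL) n1]

/-- `B` is locally Lipschitz on `H²`. -/
theorem op_lipschitz_H2 (M : ℝ) : ∃ C : ℝ, 0 ≤ C ∧ ∀ u u₁ u₂ v v₁ v₂ : ℝ → ℂ, PerC2 a b u u₁ u₂ →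
    PerC2 a b v v₁ v₂ → (∀ x ∈ Icc a b, ‖u x‖ ≤ M ∧ ‖u₁ x‖ ≤ M ∧ ‖u₂ x‖ ≤ M) →
    (∀ x ∈ Icc a b, ‖v x‖ ≤ M ∧ ‖v₁ x‖ ≤ M ∧ ‖v₂ x‖ ≤ M) → ∀ δ : ℝ, 0 ≤ δ →
    (∀ x ∈ Icc a b, ‖u x - v x‖ ≤ δ) → (∀ x ∈ Icc a b, ‖u₁ x - v₁ x‖ ≤ δ) →
    nrm a b (fun x => u₂ x - v₂ x) ≤ δ → ∀ S : Finset ℤ,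
    ell S (wt₂ a b) (fun l => fourierCoef a b (Θ.op u) l - fourierCoef a b (Θ.op v) l)
      ≤ C * δ := by
  obtain ⟨K, hK, hV⟩ := Θ.exists_bound_V
  obtain ⟨L, hL, hF⟩ := Θ.hF.lF M
  obtain ⟨LN, hLN, hN⟩ := Θ.nonlin₂_locLip M
  set R := Real.sqrt (b - a)
  have hR : 0 ≤ R := Real.sqrt_nonneg _
  have hb := nrm_nonneg (a := a) (b := b) Θ.V₂
  refine ⟨R⁻¹ * ((K + L) * R + (nrm a b Θ.V₂ + ((2 * K + 2 * LN) * R + (K + LN)))), by positivity,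
    fun u u₁ u₂ v v₁ v₂ hu hv hbu hbv δ hδ hd0 hd1 hd2 S => ?_⟩
  have cu := hu.zero.continuous
  have cv := hv.zero.continuous
  have cd₂ := hu.one.c.sub hv.one.c
  simp only [Θ.fourierCoef_op_sub cu cv]
  have hou := Θ.op_perC1 hu.zero
  have hov := Θ.op_perC1 hv.zero
  -- `V₂` is only in L², so it is isolated and paired with the sup bound on `u - v`.
  set r₁ : ℝ → ℂ := fun x => Θ.V₂ x * (u x - v x) with hr₁
  set r₂ : ℝ → ℂ := fun x => 2 * Θ.V₁ x * (u₁ x - v₁ x) + Θ.V x * (u₂ x - v₂ x)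
      + (Θ.nonlin₂ (u x, u₁ x, u₂ x) - Θ.nonlin₂ (v x, v₁ x, v₂ x)) with hr₂
  have er : (fun x => Θ.op₂ u u₁ u₂ x - Θ.op₂ v v₁ v₂ x) = fun x => r₁ x + r₂ x := by
    ext x; simp only [op₂, hr₁, hr₂]; ring
  have cN := Θ.nonlin₂_locLip.continuous
  have c₂ : Continuous r₂ := (((continuous_const.mul Θ.hV₁).mul (hu.zero.c.sub hv.zero.c)).add
    (Θ.V_continuous.mul cd₂)).add ((cN.comp (cu.prodMk (hu.zero.c.prodMk hu.one.c))).sub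
      (cN.comp (cv.prodMk (hv.zero.c.prodMk hv.one.c))))
  have b1 : ∀ᵐ x ∂(vol a b), ‖r₁ x‖ ≤ δ * ‖Θ.V₂ x‖ := ae_vol_of_forall_Icc fun x hx => by
    rw [hr₁]; beta_reduce
    rw [norm_mul, mul_comm]
    exact mul_le_mul_of_nonneg_right (hd0 x hx) (norm_nonneg _)
  have m1 : MemLp r₁ 2 (vol a b) := Θ.memLp_V₂.of_le_mul
    (Θ.memLp_V₂.1.mul (cu.sub cv).aestronglyMeasurable) b1
  have m2 : MemLp r₂ 2 (vol a b) := memLp_of_continuous c₂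
  have n1 : nrm a b r₁ ≤ δ * nrm a b Θ.V₂ := nrm_mono hδ Θ.memLp_V₂ b1
  have n2 : nrm a b r₂ ≤ (2 * K + 2 * LN) * δ * R + (K + LN) * δ := by
    -- A majorant of `r₂`: a constant for what is controlled uniformly, and a multiple of |u₂ - v₂|,
    -- which is small only in L².
    set s₁ : ℝ → ℂ := fun x => (((2 * K + 2 * LN) * δ : ℝ) : ℂ) with hs₁
    set s₂ : ℝ → ℂ := fun x => (((K + LN) * ‖u₂ x - v₂ x‖ : ℝ) : ℂ) with hs₂
    have cs₂ : Continuous s₂ := Complex.continuous_ofReal.comp (continuous_const.mul cd₂.norm)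
    have h1 : nrm a b r₂ ≤ 1 * nrm a b (fun x => s₁ x + s₂ x) := by
      refine nrm_mono zero_le_one (memLp_of_continuous (continuous_const.add cs₂))
        (ae_vol_of_forall_Icc fun x hx => ?_)
      rw [hs₁, hs₂]; beta_reduce
      rw [one_mul, ← Complex.ofReal_add, Complex.norm_real, Real.norm_of_nonneg (by positivity)]
      have i1 : ‖(u x, u₁ x, u₂ x)‖ ≤ M := max_le (hbu x hx).1 (max_le (hbu x hx).2.1 (hbu x hx).2.2)
      have i2 : ‖(v x, v₁ x, v₂ x)‖ ≤ M := max_le (hbv x hx).1 (max_le (hbv x hx).2.1 (hbv x hx).2.2)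
      have i3 : ‖(u x, u₁ x, u₂ x) - (v x, v₁ x, v₂ x)‖ ≤ 2 * δ + ‖u₂ x - v₂ x‖ := by
        have j2 := norm_nonneg (u₂ x - v₂ x)
        refine max_le ?_ (max_le ?_ ?_)
        · exact (hd0 x hx).trans (by linarith)
        · exact (hd1 x hx).trans (by linarith)
        · change ‖u₂ x - v₂ x‖ ≤ _
          linarith
      have i4 := (hN _ _ i1 i2).trans (mul_le_mul_of_nonneg_left i3 hLN)
      have i5 : ‖2 * Θ.V₁ x * (u₁ x - v₁ x)‖ ≤ 2 * K * δ := by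
        rw [norm_mul, norm_mul, Complex.norm_ofNat]
        exact mul_le_mul (by linarith [(hV x hx).2]) (hd1 x hx) (norm_nonneg _) (by positivity)
      have i6 : ‖Θ.V x * (u₂ x - v₂ x)‖ ≤ K * ‖u₂ x - v₂ x‖ := by
        rw [norm_mul]
        exact mul_le_mul_of_nonneg_right (hV x hx).1 (norm_nonneg _)
      rw [hr₂]
      refine (norm_add₃_le).trans ?_
      linarith
    have h2 := nrm_add_le (a := a) (b := b) (u := s₁) (v := s₂)
      (memLp_of_continuous continuous_const) (memLp_of_continuous cs₂)
    have h3 : nrm a b s₁ ≤ (2 * K + 2 * LN) * δ * R := nrm_le_of_bound Θ.hab.le (by positivity)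
      fun x _ => by
        rw [hs₁]; beta_reduce
        rw [Complex.norm_real, Real.norm_of_nonneg (by positivity)]
    have h4 : nrm a b s₂ ≤ (K + LN) * nrm a b (fun x => u₂ x - v₂ x) :=
      nrm_mono (by positivity) (memLp_of_continuous cd₂) (Eventually.of_forall fun x => by
        rw [hs₂]; beta_reduce
        rw [Complex.norm_real, Real.norm_of_nonneg (by positivity)])
    have h5 := mul_le_mul_of_nonneg_left hd2 (add_nonneg hK hLN)
    linarith
  have n0 : nrm a b (fun x => Θ.op u x - Θ.op v x) ≤ (K + L) * δ * R := by
    refine nrm_le_of_bound Θ.hab.le (by positivity) fun x hx => ?_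
    rw [show Θ.op u x - Θ.op v x = Θ.V x * (u x - v x) + (Θ.F (u x) - Θ.F (v x)) by
      simp only [op]; ring, add_mul]
    refine (norm_add_le _ _).trans (add_le_add ?_ ((hF _ _ (hbu x hx).1 (hbv x hx).1).trans
      (mul_le_mul_of_nonneg_left (hd0 x hx) hL)))
    rw [norm_mul]
    exact mul_le_mul (hV x hx).1 (hd0 x hx) (norm_nonneg _) hK
  refine (ell_wt₂_le Θ.hab ((IsPrim.of_hasDerivAt hou.d hou.c).sub
    (IsPrim.of_hasDerivAt hov.d hov.c)) (by simp only [hou.per, hov.per])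
    ((Θ.op₁_isPrim hu).sub (Θ.op₁_isPrim hv)) (by simp only [Θ.op₁_per hu, Θ.op₁_per hv])
    (er ▸ m1.add m2)).trans ?_
  rw [mul_assoc, er]
  refine mul_le_mul_of_nonneg_left ?_ (by positivity)
  have := nrm_add_le m1 m2
  linarith

/-- Second differences of `B`. -/
theorem op_second_difference (M : ℝ) : ∃ C : ℝ, 0 ≤ C ∧ ∀ u v w : ℝ → ℂ, Continuous u →
    Continuous v → Continuous w → (∀ x ∈ Icc a b, ‖u x‖ ≤ M) → (∀ x ∈ Icc a b, ‖v x‖ ≤ M) →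
    (∀ x ∈ Icc a b, ‖w x‖ ≤ M) → ∀ δ : ℝ, 0 ≤ δ → (∀ x ∈ Icc a b, ‖u x - v x‖ ≤ δ) →
    (∀ x ∈ Icc a b, ‖w x - v x‖ ≤ δ) → ∀ S : Finset ℤ,
    ell S (fun _ => 1) (fun l => (fourierCoef a b (Θ.op u) l - fourierCoef a b (Θ.op v) l)
        + (fourierCoef a b (Θ.op w) l - fourierCoef a b (Θ.op v) l))
      ≤ C * (δ ^ 2 + nrm a b (fun x => u x - 2 * v x + w x)) := by
  obtain ⟨K, hK, hV⟩ := Θ.exists_bound_V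
  obtain ⟨L, hL, hT⟩ := Θ.hF.dF.taylor Θ.hF.lP Θ.hF.lQ M
  obtain ⟨BP, hBP, hP'⟩ := Θ.hF.lP.locBdd M
  obtain ⟨BQ, hBQ, hQ'⟩ := Θ.hF.lQ.locBdd M
  set R := Real.sqrt (b - a)
  have hR : 0 ≤ R := Real.sqrt_nonneg _
  refine ⟨R⁻¹ * (2 * L * R + (K + BP + BQ)), by positivity,
    fun u v w hu hv hw hbu hbv hbw δ hδ hd1 hd2 S => ?_⟩
  have cou := Θ.op_continuous hu
  have cov := Θ.op_continuous hv
  have cow := Θ.op_continuous hw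
  have e1 : ∀ l, (fourierCoef a b (Θ.op u) l - fourierCoef a b (Θ.op v) l)
        + (fourierCoef a b (Θ.op w) l - fourierCoef a b (Θ.op v) l)
      = fourierCoef a b (fun x => (Θ.op u x - Θ.op v x) + (Θ.op w x - Θ.op v x)) l := fun l => by
    rw [Θ.fourierCoef_op_sub hu hv, Θ.fourierCoef_op_sub hw hv,
      ← fourierCoef_add (u := fun x => Θ.op u x - Θ.op v x) (v := fun x => Θ.op w x - Θ.op v x)
        (integrable_of_continuous (cou.sub cov)) (integrable_of_continuous (cow.sub cov))]
  simp only [e1]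
  refine (ell_fourierCoef_le (u := fun x => (Θ.op u x - Θ.op v x) + (Θ.op w x - Θ.op v x)) Θ.hab
    (memLp_of_continuous ((cou.sub cov).add (cow.sub cov)))).trans ?_
  rw [mul_assoc]
  refine mul_le_mul_of_nonneg_left ?_ (by positivity)
  set q : ℝ → ℂ := fun x => u x - 2 * v x + w x with hq
  have cq : Continuous q := (hu.sub (continuous_const.mul hv)).add hw
  -- `r₁` is the linearization of `B` at `v` applied to the second difference `q`. What is left,
  -- `r₂`, consists of two Taylor remainders of `F`, each O(δ²).
  set r₁ : ℝ → ℂ := fun x => Θ.V x * q x + (Θ.P (v x) * q x + Θ.Q (v x) * conj (q x)) with hr₁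
  have c₁ : Continuous r₁ := (Θ.V_continuous.mul cq).add (((Θ.hF.lP.continuous.comp hv).mul cq).add
    ((Θ.hF.lQ.continuous.comp hv).mul cq.star))
  set r₂ : ℝ → ℂ := fun x => (Θ.op u x - Θ.op v x) + (Θ.op w x - Θ.op v x) - r₁ x with hr₂
  have c₂ : Continuous r₂ := ((cou.sub cov).add (cow.sub cov)).sub c₁
  have er : (fun x => (Θ.op u x - Θ.op v x) + (Θ.op w x - Θ.op v x)) = fun x => r₂ x + r₁ x := by
    ext x; simp only [hr₂]; ring
  rw [er]
  refine (nrm_add_le (memLp_of_continuous c₂) (memLp_of_continuous c₁)).trans ?_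
  have n1 : nrm a b r₁ ≤ (K + BP + BQ) * nrm a b q := by
    refine nrm_mono (by positivity) (memLp_of_continuous cq) (ae_vol_of_forall_Icc fun x hx => ?_)
    refine (norm_add_le _ _).trans ((add_le_add_right (norm_add_le _ _) _).trans ?_)
    rw [norm_mul, norm_mul, norm_mul, RCLike.norm_conj]
    have f1 := mul_le_mul_of_nonneg_right (hV x hx).1 (norm_nonneg (q x))
    have f2 := mul_le_mul_of_nonneg_right (hP' _ (hbv x hx)) (norm_nonneg (q x))
    have f3 := mul_le_mul_of_nonneg_right (hQ' _ (hbv x hx)) (norm_nonneg (q x))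
    linarith
  have n2 : nrm a b r₂ ≤ 2 * L * δ ^ 2 * R := by
    refine nrm_le_of_bound Θ.hab.le (by positivity) fun x hx => ?_
    have e : r₂ x = (Θ.F (u x) - Θ.F (v x) - (Θ.P (v x) * (u x - v x)
        + Θ.Q (v x) * conj (u x - v x))) + (Θ.F (w x) - Θ.F (v x) - (Θ.P (v x) * (w x - v x)
        + Θ.Q (v x) * conj (w x - v x))) := by
      simp only [hr₂, hr₁, hq, op, map_sub, map_add, map_mul, map_ofNat]
      ring
    rw [e]
    have t1 := (hT _ _ (hbu x hx) (hbv x hx)).trans (mul_le_mul_of_nonneg_left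
      (pow_le_pow_left₀ (norm_nonneg _) (hd1 x hx) 2) hL)
    have t2 := (hT _ _ (hbw x hx) (hbv x hx)).trans (mul_le_mul_of_nonneg_left
      (pow_le_pow_left₀ (norm_nonneg _) (hd2 x hx) 2) hL)
    refine (norm_add_le _ _).trans ?_
    linarith
  have nq := nrm_nonneg (a := a) (b := b) q
  have h3 : 0 ≤ 2 * L * R * nrm a b q := by positivity
  have h4 : 0 ≤ (K + BP + BQ) * δ ^ 2 := by positivity
  linarith

end Model

end SEWI

namespace SEWI

/-! ### The variation-of-constants formula for one mode -/

theorem norm_exp_I_mul (θ : ℝ) : ‖Complex.exp (Complex.I * θ)‖ = 1 := by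
  rw [mul_comm, Complex.norm_exp_ofReal_mul_I]

theorem norm_exp_I_mul_mul (m s : ℝ) : ‖Complex.exp (Complex.I * m * s)‖ = 1 := by
  rw [mul_assoc, ← Complex.ofReal_mul, norm_exp_I_mul]

theorem norm_exp_I_mul_sub_one_le (m s : ℝ) (hm : 0 ≤ m) :
    ‖Complex.exp (Complex.I * m * s) - 1‖ ≤ |s| * m := by
  rw [mul_assoc, ← Complex.ofReal_mul]
  refine (Real.norm_exp_I_mul_ofReal_sub_one_le (x := m * s)).trans (le_of_eq ?_)
  rw [norm_mul, Real.norm_of_nonneg hm, Real.norm_eq_abs, mul_comm]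

theorem continuous_exp_I_mul (m : ℝ) : Continuous fun s : ℝ => Complex.exp (Complex.I * m * s) := by
  fun_prop

theorem duhamel {y G : ℝ → ℂ} {m α β : ℝ} (hαβ : α ≤ β) (hy : ContinuousOn y (Icc α β))
    (hG : ContinuousOn G (Icc α β))
    (hd : ∀ t ∈ Ioo α β, HasDerivAt y (-Complex.I * (m * y t + G t)) t) :
    Complex.exp (Complex.I * m * β) * y β - Complex.exp (Complex.I * m * α) * y α
      = -Complex.I * ∫ s in α..β, Complex.exp (Complex.I * m * s) * G s := by
  have hE : ∀ t : ℝ, HasDerivAt (fun s : ℝ => Complex.exp (Complex.I * m * s))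
      (Complex.exp (Complex.I * m * t) * (Complex.I * m)) t := fun t => by
    simpa using ((hasDerivAt_id t).ofReal_comp.const_mul (Complex.I * m)).cexp
  have hc := (continuous_exp_I_mul m).continuousOn (s := Icc α β)
  rw [← intervalIntegral.integral_const_mul]
  refine (intervalIntegral.integral_eq_sub_of_hasDerivAt_of_le hαβ (hc.mul hy) (fun t ht => ?_)
    ((continuousOn_const.mul (hc.mul hG)).intervalIntegrable_of_Icc hαβ)).symm
  refine ((hE t).mul (hd t ht)).congr_deriv ?_
  simp only [Pi.mul_apply]
  ring

/-- The origin of the filter φ_s in the scheme: it is the exact integral of the oscillating factor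
over a symmetric step. -/
theorem integral_exp_I_mul_symm (m τ : ℝ) :
    ∫ s in (-τ)..τ, Complex.exp (Complex.I * m * s) = 2 * τ * (Real.sinc (τ * m) : ℂ) := by
  by_cases hm : m = 0
  · subst hm; simp; ring
  have h := integral_exp_mul_I_eq_sinc (τ * m)
  have h2 := intervalIntegral.integral_comp_mul_right (a := -τ) (b := τ)
    (fun t : ℝ => Complex.exp (t * Complex.I)) hm
  rw [neg_mul, h] at h2
  have e : ∀ s : ℝ, Complex.exp (Complex.I * m * s) = Complex.exp ((s * m : ℝ) * Complex.I) :=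
    fun s => by congr 1; push_cast; ring
  simp only [e]
  rw [h2]
  have : (m : ℂ) ≠ 0 := by exact_mod_cast hm
  simp only [Complex.real_smul]
  push_cast
  field_simp

theorem integral_exp_I_mul_zero (m τ : ℝ) :
    ∫ s in (0 : ℝ)..τ, Complex.exp (Complex.I * m * s)
      = Complex.exp (Complex.I * m * τ) * (τ * phi1 (-Complex.I * τ * m)) := by
  by_cases hm : m = 0
  · subst hm; simp [phi1]
  by_cases hτ : τ = 0
  · subst hτ; simp
  have h1 : (m : ℂ) ≠ 0 := by exact_mod_cast hm
  have h2 : (τ : ℂ) ≠ 0 := by exact_mod_cast hτ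
  have h3 : Complex.I * m ≠ 0 := mul_ne_zero Complex.I_ne_zero h1
  rw [integral_exp_mul_complex h3, phi1, if_neg (by simp [h1, h2])]
  have e : Complex.exp (Complex.I * m * τ) * Complex.exp (-Complex.I * τ * m) = 1 := by
    rw [← Complex.exp_add, ← Complex.exp_zero]; congr 1; ring
  have hI := Complex.I_ne_zero
  have e' : Complex.exp (Complex.I * m * τ) * (τ * ((Complex.exp (-Complex.I * τ * m) - 1)
      / (-Complex.I * τ * m))) = (Complex.exp (Complex.I * m * τ) * Complex.exp (-Complex.I * τ * m)
      - Complex.exp (Complex.I * m * τ)) * (τ / (-Complex.I * τ * m)) := by ring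
  rw [e', e]
  simp only [Complex.ofReal_zero, mul_zero, Complex.exp_zero]
  field_simp
  ring

/-- Replacing `G` by its midpoint value in Duhamel's formula reproduces the scheme exactly, the
linear part being integrated without error. The defect thus involves only G(t + s) - G(t). -/
theorem center_error {y G : ℝ → ℂ} {m t τ : ℝ} (hτ : 0 ≤ τ)
    (hy : ContinuousOn y (Icc (t - τ) (t + τ))) (hG : ContinuousOn G (Icc (t - τ) (t + τ)))
    (hd : ∀ s ∈ Ioo (t - τ) (t + τ), HasDerivAt y (-Complex.I * (m * y s + G s)) s) :
    y (t + τ) - (Complex.exp (-2 * Complex.I * τ * m) * y (t - τ)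
      - 2 * Complex.I * τ * Complex.exp (-Complex.I * τ * m) * (Real.sinc (τ * m) : ℂ) * G t)
    = -Complex.I * Complex.exp (-Complex.I * τ * m) *
      ∫ s in (-τ)..τ, Complex.exp (Complex.I * m * s) * (G (t + s) - G t) := by
  have h := duhamel (by linarith) hy hG hd
  have h1 : ∫ s in (t - τ)..(t + τ), Complex.exp (Complex.I * m * s) * G s
      = Complex.exp (Complex.I * m * t) *
        ∫ s in (-τ)..τ, Complex.exp (Complex.I * m * s) * G (t + s) := by
    have := intervalIntegral.integral_comp_add_left (a := -τ) (b := τ)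
      (fun s : ℝ => Complex.exp (Complex.I * m * s) * G s) t
    rw [← sub_eq_add_neg] at this
    rw [← this, ← intervalIntegral.integral_const_mul]
    congr 1
    ext s
    rw [← mul_assoc, ← Complex.exp_add]
    congr 2
    push_cast; ring
  have hGs : ContinuousOn (fun s => G (t + s)) (Icc (-τ) τ) :=
    hG.comp (by fun_prop) fun s hs => ⟨by linarith [hs.1], by linarith [hs.2]⟩
  have hc := (continuous_exp_I_mul m).continuousOn (s := Icc (-τ) τ)
  have h2 : ∫ s in (-τ)..τ, Complex.exp (Complex.I * m * s) * (G (t + s) - G t)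
      = (∫ s in (-τ)..τ, Complex.exp (Complex.I * m * s) * G (t + s))
        - 2 * τ * (Real.sinc (τ * m) : ℂ) * G t := by
    have i1 : IntervalIntegrable (fun s : ℝ => Complex.exp (Complex.I * m * s) * G (t + s))
        volume (-τ) τ := (hc.mul hGs).intervalIntegrable_of_Icc (by linarith)
    have i2 : IntervalIntegrable (fun s : ℝ => Complex.exp (Complex.I * m * s) * G t)
        volume (-τ) τ := (hc.mul continuousOn_const).intervalIntegrable_of_Icc (by linarith)
    rw [← integral_exp_I_mul_symm, ← intervalIntegral.integral_mul_const,
      ← intervalIntegral.integral_sub i1 i2]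
    congr 1; ext s; ring
  rw [h1] at h
  rw [h2]
  set J := ∫ s in (-τ)..τ, Complex.exp (Complex.I * m * s) * G (t + s)
  have x1 : Complex.exp (Complex.I * m * (t + τ : ℝ)) * Complex.exp (-Complex.I * m * (t + τ : ℝ))
      = 1 := by rw [← Complex.exp_add, ← Complex.exp_zero]; congr 1; ring
  have x2 : Complex.exp (Complex.I * m * (t - τ : ℝ)) * Complex.exp (-Complex.I * m * (t + τ : ℝ))
      = Complex.exp (-2 * Complex.I * τ * m) := by
    rw [← Complex.exp_add]; congr 1; push_cast; ring
  have x3 : Complex.exp (Complex.I * m * t) * Complex.exp (-Complex.I * m * (t + τ : ℝ))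
      = Complex.exp (-Complex.I * τ * m) := by
    rw [← Complex.exp_add]; congr 1; push_cast; ring
  linear_combination Complex.exp (-Complex.I * m * (t + τ : ℝ)) * h - y (t + τ) * x1
    + y (t - τ) * x2 - Complex.I * J * x3

theorem start_error {y G : ℝ → ℂ} {m τ : ℝ} (hτ : 0 ≤ τ)
    (hy : ContinuousOn y (Icc 0 τ)) (hG : ContinuousOn G (Icc 0 τ))
    (hd : ∀ s ∈ Ioo 0 τ, HasDerivAt y (-Complex.I * (m * y s + G s)) s) :
    y τ - (Complex.exp (-Complex.I * τ * m) * y 0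
      - Complex.I * τ * phi1 (-Complex.I * τ * m) * G 0)
    = -Complex.I * Complex.exp (-Complex.I * τ * m) *
      ∫ s in (0 : ℝ)..τ, Complex.exp (Complex.I * m * s) * (G s - G 0) := by
  have h := duhamel hτ hy hG hd
  have hc := (continuous_exp_I_mul m).continuousOn (s := Icc 0 τ)
  have h2 : ∫ s in (0 : ℝ)..τ, Complex.exp (Complex.I * m * s) * (G s - G 0)
      = (∫ s in (0 : ℝ)..τ, Complex.exp (Complex.I * m * s) * G s)
        - Complex.exp (Complex.I * m * τ) * (τ * phi1 (-Complex.I * τ * m)) * G 0 := by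
    have i1 : IntervalIntegrable (fun s : ℝ => Complex.exp (Complex.I * m * s) * G s)
        volume 0 τ := (hc.mul hG).intervalIntegrable_of_Icc hτ
    have i2 : IntervalIntegrable (fun s : ℝ => Complex.exp (Complex.I * m * s) * G 0)
        volume 0 τ := (hc.mul continuousOn_const).intervalIntegrable_of_Icc hτ
    rw [← integral_exp_I_mul_zero, ← intervalIntegral.integral_mul_const,
      ← intervalIntegral.integral_sub i1 i2]
    congr 1; ext s; ring
  rw [h2]
  have x1 : Complex.exp (Complex.I * m * τ) * Complex.exp (-Complex.I * τ * m) = 1 := by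
    rw [← Complex.exp_add, ← Complex.exp_zero]; congr 1; ring
  simp only [Complex.ofReal_zero, mul_zero, Complex.exp_zero, one_mul] at h
  linear_combination Complex.exp (-Complex.I * τ * m) * h - y τ * x1
    - Complex.I * τ * phi1 (-Complex.I * τ * m) * G 0 * x1

/-- By `integral_exp_I_mul_zero` this is the modulus of an integral of a unimodular function over an
interval of length τ. -/
theorem norm_mul_phi1_le (m : ℝ) {τ : ℝ} (hτ : 0 ≤ τ) : ‖τ * phi1 (-Complex.I * τ * m)‖ ≤ τ := by
  have h := integral_exp_I_mul_zero m τ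
  have h2 : ‖∫ s in (0 : ℝ)..τ, Complex.exp (Complex.I * m * s)‖ ≤ 1 * |τ - 0| :=
    intervalIntegral.norm_integral_le_of_norm_le_const fun s _ => (norm_exp_I_mul_mul m s).le
  rwa [h, norm_mul, norm_exp_I_mul_mul, one_mul, one_mul, sub_zero, abs_of_nonneg hτ] at h2

/-! ### Discrete Gronwall inequality for two-step schemes -/

/-- The recursion is assumed only while the error is at most `r`. As the resulting bound is itself
at most `r`, the induction keeps that condition alive. The comparison sequence is `A n` = e^{Lnτ}(d
+ nτδ). -/
theorem two_step_gronwall {E : ℕ → ℝ} {n₀ : ℕ} {τ T L δ d r : ℝ} (hτ : 0 ≤ τ) (hL : 0 ≤ L)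
    (hδ : 0 ≤ δ) (hd : 0 ≤ d) (hT : n₀ * τ ≤ T) (h0 : E 0 ≤ 0)
    (h1 : 1 ≤ n₀ → E 1 ≤ d)
    (hstep : ∀ n, n + 2 ≤ n₀ → E (n + 1) ≤ r → E (n + 2) ≤ E n + τ * (L * E (n + 1) + δ))
    (hr : Real.exp (L * T) * (d + T * δ) ≤ r) :
    ∀ n ≤ n₀, E n ≤ Real.exp (L * T) * (d + T * δ) := by
  set A : ℕ → ℝ := fun n => Real.exp (L * (n * τ)) * (d + n * τ * δ) with hA
  have hA0 : ∀ n, 0 ≤ A n := fun n => by positivity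
  have hmono : ∀ m n : ℕ, m ≤ n → A m ≤ A n := fun m n h => by
    have : (m : ℝ) ≤ n := by exact_mod_cast h
    simp only [hA]; gcongr
  have hAT : ∀ n ≤ n₀, A n ≤ Real.exp (L * T) * (d + T * δ) := fun n hn => by
    have hn' : (n : ℝ) ≤ n₀ := by exact_mod_cast hn
    have : n * τ ≤ T := (mul_le_mul_of_nonneg_right hn' hτ).trans hT
    simp only [hA]; gcongr
  -- Since `A` is increasing, `A n` may be replaced by `A (n + 1)`. The two-step recursion then
  -- reduces to the one-step estimate 1 + Lτ ≤ e^{Lτ}.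
  have hstepA : ∀ n, A n + τ * (L * A (n + 1) + δ) ≤ A (n + 2) := by
    intro n
    have e1 := hmono n (n + 1) (by omega)
    have e2 : Real.exp (L * τ) * A (n + 1) + τ * δ ≤ A (n + 2) := by
      simp only [hA]
      rw [← mul_assoc, ← Real.exp_add]
      push_cast
      have e3 : L * τ + L * ((n + 1) * τ) = L * ((n + 2) * τ) := by ring
      rw [e3]
      have e4 : 1 ≤ Real.exp (L * ((n + 2) * τ)) := Real.one_le_exp (by positivity)
      have e5 : 0 ≤ τ * δ := by positivity
      nlinarith
    have e6 : 1 + L * τ ≤ Real.exp (L * τ) := by linarith [Real.add_one_le_exp (L * τ)]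
    nlinarith [mul_le_mul_of_nonneg_right e6 (hA0 (n + 1))]
  have main : ∀ n, n ≤ n₀ → E n ≤ A n := by
    intro n
    induction n using Nat.strong_induction_on with
    | _ n ih =>
      intro hn
      match n, ih, hn with
      | 0, _, _ => exact h0.trans (hA0 0)
      | 1, _, hn =>
        refine (h1 hn).trans ?_
        simp only [hA]
        have e4 : 1 ≤ Real.exp (L * ((1 : ℕ) * τ)) := Real.one_le_exp (by positivity)
        have e5 : 0 ≤ (1 : ℕ) * τ * δ := by positivity
        nlinarith
      | n + 2, ih, hn =>
        have i1 := ih n (by omega) (by omega)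
        have i2 := ih (n + 1) (by omega) (by omega)
        have i3 := hstep n hn (i2.trans ((hAT _ (by omega)).trans hr))
        have i4 := hstepA n
        have i5 := mul_le_mul_of_nonneg_left (mul_le_mul_of_nonneg_left i2 hL) hτ
        nlinarith
  exact fun n hn => (main n hn).trans (hAT n hn)

end SEWI

/-! ### Bounds for the exact solution and local errors of the scheme -/

namespace SEWI

variable {a b : ℝ}

/-- `U` is a solution on `[0, T]` of the equation described by the model `Θ`, with space
derivatives `U₁` and `U₂`, bounded with all the quantities controlling its regularity by `M`. -/
structure Sol (Θ : Model a b) (T M : ℝ) (U U₁ U₂ : ℝ → ℝ → ℂ) : Prop where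
  M_nonneg : 0 ≤ M
  smooth : ∀ t ∈ Icc 0 T, PerC2 a b (U t) (U₁ t) (U₂ t)
  bdd : ∀ t ∈ Icc 0 T, ∀ x ∈ Icc a b, ‖U t x‖ ≤ M ∧ ‖U₁ t x‖ ≤ M ∧ ‖U₂ t x‖ ≤ M
  lip : ∀ s ∈ Icc 0 T, ∀ t ∈ Icc 0 T, ∀ x ∈ Icc a b, ‖U t x - U s x‖ ≤ M * |t - s|
  lip₁ : ∀ s ∈ Icc 0 T, ∀ t ∈ Icc 0 T, ∀ x ∈ Icc a b, ‖U₁ t x - U₁ s x‖ ≤ M * |t - s|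
  lip₂ : ∀ s ∈ Icc 0 T, ∀ t ∈ Icc 0 T, nrm a b (fun x => U₂ t x - U₂ s x) ≤ M * |t - s|
  second : ∀ t s, 0 ≤ s → t - s ∈ Icc 0 T → t + s ∈ Icc 0 T →
    nrm a b (fun x => U (t + s) x - 2 * U t x + U (t - s) x) ≤ M * s ^ 2
  ode : ∀ l, ∀ t ∈ Ioo 0 T, HasDerivAt (fun t => fourierCoef a b (U t) l)
    (-Complex.I * ((freq a b l ^ 2 : ℝ) * fourierCoef a b (U t) l
      + fourierCoef a b (Θ.op (U t)) l)) t
  tail : ∀ t ∈ Icc 0 T, ∀ S, ell S (fun l => freq a b l ^ 4) (fourierCoef a b (U t)) ≤ M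

theorem norm_le_ell_singleton {ν : ℤ → ℝ} {c : ℤ → ℂ} {l : ℤ} (h : 1 ≤ ν l) :
    ‖c l‖ ≤ ell {l} ν c := by
  rw [ell, Finset.sum_singleton, Real.sqrt_sq (by positivity)]
  exact le_mul_of_one_le_left (norm_nonneg _) h

theorem one_le_wt₂ (l : ℤ) : 1 ≤ wt₂ a b l := by
  rw [wt₂]; linarith [sq_nonneg (freq a b l)]

theorem one_le_wt₁ (l : ℤ) : 1 ≤ wt₁ a b l := by
  rw [wt₁, Real.one_le_sqrt]; exact one_le_wt₂ l

theorem wt₁_le_wt₂ (l : ℤ) : wt₁ a b l ≤ wt₂ a b l := by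
  rw [← wt₁_sq]; nlinarith [one_le_wt₁ (a := a) (b := b) l]

theorem ell_mono_weight {S : Finset ℤ} {ν ν' : ℤ → ℝ} {c d : ℤ → ℂ} {r : ℝ} (hr : 0 ≤ r)
    (h0 : ∀ l, 0 ≤ ν l) (h : ∀ l ∈ S, ν l * ‖c l‖ ≤ r * (ν' l * ‖d l‖)) :
    ell S ν c ≤ r * ell S ν' d := by
  refine Real.sqrt_le_iff.2 ⟨mul_nonneg hr ell_nonneg, ?_⟩
  rw [mul_pow, ell_sq, Finset.mul_sum]
  refine Finset.sum_le_sum fun l hl => ?_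
  rw [← mul_pow]
  exact pow_le_pow_left₀ (mul_nonneg (h0 l) (norm_nonneg _)) (h l hl) 2

theorem continuousOn_of_abs_le {y : ℝ → ℂ} {T C : ℝ} (hC : 0 ≤ C)
    (h : ∀ s ∈ Icc 0 T, ∀ t ∈ Icc 0 T, ‖y t - y s‖ ≤ C * |t - s|) : ContinuousOn y (Icc 0 T) := by
  refine LipschitzOnWith.continuousOn (K := ⟨C, hC⟩) (LipschitzOnWith.of_dist_le_mul ?_)
  intro s hs t ht
  rw [dist_eq_norm, Real.dist_eq]
  exact h t ht s hs

namespace Sol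

variable {Θ : Model a b} {T M : ℝ} {U U₁ U₂ : ℝ → ℝ → ℂ}

theorem op_lipschitz (hU : Sol Θ T M U U₁ U₂) : ∃ C : ℝ, 0 ≤ C ∧ ∀ s ∈ Icc 0 T, ∀ t ∈ Icc 0 T,
    ∀ S : Finset ℤ, ell S (wt₂ a b)
      (fun l => fourierCoef a b (Θ.op (U t)) l - fourierCoef a b (Θ.op (U s)) l)
      ≤ C * |t - s| := by
  obtain ⟨C, hC, h⟩ := Θ.op_lipschitz_H2 M
  refine ⟨C * M, mul_nonneg hC hU.M_nonneg, fun s hs t ht S => ?_⟩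
  rw [mul_assoc]
  exact h _ _ _ _ _ _ (hU.smooth t ht) (hU.smooth s hs) (hU.bdd t ht) (hU.bdd s hs) _
    (mul_nonneg hU.M_nonneg (abs_nonneg _)) (hU.lip s hs t ht) (hU.lip₁ s hs t ht)
    (hU.lip₂ s hs t ht) S

theorem op_second (hU : Sol Θ T M U U₁ U₂) : ∃ C : ℝ, 0 ≤ C ∧ ∀ t s, 0 ≤ s → t - s ∈ Icc 0 T →
    t + s ∈ Icc 0 T → ∀ S : Finset ℤ, ell S (fun _ => 1) (fun l =>
      (fourierCoef a b (Θ.op (U (t + s))) l - fourierCoef a b (Θ.op (U t)) l)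
      + (fourierCoef a b (Θ.op (U (t - s))) l - fourierCoef a b (Θ.op (U t)) l))
      ≤ C * s ^ 2 := by
  obtain ⟨C, hC, h⟩ := Θ.op_second_difference M
  refine ⟨C * (M ^ 2 + M), mul_nonneg hC (add_nonneg (sq_nonneg _) hU.M_nonneg),
    fun t s hs hm hp S => ?_⟩
  have ht : t ∈ Icc 0 T := ⟨by linarith [hm.1], by linarith [hp.2]⟩
  have e1 : M * |t + s - t| = M * s := by rw [add_sub_cancel_left, abs_of_nonneg hs]
  have e2 : M * |t - s - t| = M * s := by
    rw [sub_sub_cancel_left, abs_neg, abs_of_nonneg hs]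
  refine (h _ _ _ (hU.smooth _ hp).zero.continuous (hU.smooth _ ht).zero.continuous
    (hU.smooth _ hm).zero.continuous (fun x hx => (hU.bdd _ hp x hx).1)
    (fun x hx => (hU.bdd _ ht x hx).1) (fun x hx => (hU.bdd _ hm x hx).1) (M * s)
    (mul_nonneg hU.M_nonneg hs) (fun x hx => (hU.lip _ ht _ hp x hx).trans e1.le)
    (fun x hx => (hU.lip _ ht _ hm x hx).trans e2.le) S).trans ?_
  rw [mul_assoc]
  refine mul_le_mul_of_nonneg_left ?_ hC
  have := hU.second t s hs hm hp
  linarith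

theorem continuousOn_op (hU : Sol Θ T M U U₁ U₂) (l : ℤ) :
    ContinuousOn (fun t => fourierCoef a b (Θ.op (U t)) l) (Icc 0 T) := by
  obtain ⟨C, hC, h⟩ := hU.op_lipschitz
  exact continuousOn_of_abs_le hC fun s hs t ht =>
    (norm_le_ell_singleton (c := fun l => fourierCoef a b (Θ.op (U t)) l
      - fourierCoef a b (Θ.op (U s)) l) (one_le_wt₂ l)).trans (h s hs t ht {l})

theorem continuousOn_coef (hU : Sol Θ T M U U₁ U₂) (l : ℤ) :
    ContinuousOn (fun t => fourierCoef a b (U t) l) (Icc 0 T) := by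
  have hM := hU.M_nonneg
  refine continuousOn_of_abs_le (C := (Real.sqrt (b - a))⁻¹ * (M * Real.sqrt (b - a)))
    (by positivity) fun s hs t ht => ?_
  have ct := (hU.smooth t ht).zero.continuous
  have cs := (hU.smooth s hs).zero.continuous
  rw [← fourierCoef_sub (integrable_of_continuous ct) (integrable_of_continuous cs)]
  refine (norm_le_ell_singleton (ν := fun _ => 1) le_rfl).trans
    ((ell_fourierCoef_le Θ.hab (memLp_of_continuous (ct.sub cs))).trans ?_)
  rw [mul_assoc]
  refine mul_le_mul_of_nonneg_left ?_ (by positivity)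
  have := nrm_le_of_bound (u := U t - U s) Θ.hab.le (by positivity) (hU.lip s hs t ht)
  linarith

/-- The local error of the two-step scheme. -/
theorem center_error (hU : Sol Θ T M U U₁ U₂) : ∃ C : ℝ, 0 ≤ C ∧ ∀ t τ : ℝ, 0 ≤ τ →
    t - τ ∈ Icc 0 T → t + τ ∈ Icc 0 T → ∃ R : ℤ → ℂ,
    (∀ l, fourierCoef a b (U (t + τ)) l
      = Complex.exp (-2 * Complex.I * τ * (freq a b l : ℂ) ^ 2) * fourierCoef a b (U (t - τ)) l
        - 2 * Complex.I * τ * Complex.exp (-Complex.I * τ * (freq a b l : ℂ) ^ 2)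
          * (Real.sinc (τ * freq a b l ^ 2) : ℂ) * fourierCoef a b (Θ.op (U t)) l + R l) ∧
    ∀ S : Finset ℤ, ell S (fun _ => 1) R ≤ C * τ ^ 3 ∧
      ell S (wt₁ a b) R ≤ C * (τ * τ ^ (3 / 2 : ℝ)) := by
  obtain ⟨C, hC, hl⟩ := hU.op_lipschitz
  obtain ⟨C', hC', hs2⟩ := hU.op_second
  refine ⟨2 * C + C', by positivity, fun t τ hτ hm hp => ?_⟩
  have ht : t ∈ Icc 0 T := ⟨by linarith [hm.1], by linarith [hp.2]⟩
  have hsub : Icc (t - τ) (t + τ) ⊆ Icc 0 T := Icc_subset_Icc hm.1 hp.2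
  set G : ℝ → ℤ → ℂ := fun s l => fourierCoef a b (Θ.op (U s)) l with hG
  set φ : ℝ → ℤ → ℂ := fun s l => Complex.exp (Complex.I * (freq a b l ^ 2 : ℝ) * s)
    * (G (t + s) l - G t l) with hφ
  have hshift : ∀ s ∈ Icc (-τ) τ, t + s ∈ Icc 0 T := fun s hs =>
    hsub ⟨by linarith [hs.1], by linarith [hs.2]⟩
  have hgc : ∀ l, ContinuousOn (fun s => G (t + s) l - G t l) (Icc (-τ) τ) := fun l =>
    ((hU.continuousOn_op l).comp (by fun_prop) hshift).sub continuousOn_const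
  have hφc : ∀ l, ContinuousOn (fun s => φ s l) (Icc (-τ) τ) := fun l =>
    (continuous_exp_I_mul _).continuousOn.mul (hgc l)
  have hg : ∀ s ∈ Icc (-τ) τ, ∀ S, ell S (wt₂ a b) (fun l => G (t + s) l - G t l) ≤ C * |s| := by
    intro s hs S
    have := hl t ht (t + s) (hshift s hs) S
    rwa [add_sub_cancel_left] at this
  have habs : ∀ s ∈ Icc (-τ) τ, |s| ≤ τ := fun s hs => abs_le.2 hs
  refine ⟨fun l => -Complex.I * Complex.exp (-Complex.I * τ * (freq a b l ^ 2 : ℝ))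
    * ∫ s in (-τ)..τ, φ s l, fun l => ?_, fun S => ?_⟩
  · have := SEWI.center_error (m := freq a b l ^ 2) hτ ((hU.continuousOn_coef l).mono hsub)
      ((hU.continuousOn_op l).mono hsub)
      (fun s hs => hU.ode l s ⟨hm.1.trans_lt hs.1, hs.2.trans_le hp.2⟩)
    refine (sub_eq_iff_eq_add'.1 this).trans ?_
    simp only [hφ, hG, Complex.ofReal_pow]
  have hR : ∀ ν, ell S ν (fun l => -Complex.I * Complex.exp (-Complex.I * τ * (freq a b l ^ 2 : ℝ))
      * ∫ s in (-τ)..τ, φ s l) ≤ 1 * ell S ν (fun l => ∫ s in (-τ)..τ, φ s l) := fun ν =>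
    ell_mono zero_le_one fun l _ => by
      rw [norm_mul, norm_mul, norm_neg, Complex.norm_I,
        show -Complex.I * τ * (freq a b l ^ 2 : ℝ) = Complex.I * (-τ * freq a b l ^ 2 : ℝ) by
          push_cast; ring, norm_exp_I_mul, one_mul]
  -- In H² there is no cancellation: an integrand of size C|s| over length 2τ.
  have h2 : ell S (wt₂ a b) (fun l => ∫ s in (-τ)..τ, φ s l) ≤ 2 * C * τ ^ 2 := by
    refine (ell_integral_le (K := C * τ) (by linarith) (fun l _ => hφc l) fun s hs => ?_).trans
      (le_of_eq (by ring))
    have h3 : ell S (wt₂ a b) (φ s) ≤ 1 * ell S (wt₂ a b) (fun l => G (t + s) l - G t l) :=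
      ell_mono zero_le_one fun l _ => by rw [hφ, norm_mul, norm_exp_I_mul_mul]
    rw [one_mul] at h3
    exact h3.trans ((hg s hs S).trans (mul_le_mul_of_nonneg_left (habs s hs) hC))
  have h1 : ell S (fun _ => 1) (fun l => ∫ s in (-τ)..τ, φ s l) ≤ (2 * C + C') * τ ^ 3 := by
    -- The exponential is split as 1 + (e^{iμ²s} - 1). `φ₁` carries the second term; folding the
    -- integral of the first onto [0, τ] gives the symmetric second difference `φ₂`.
    set φ₁ : ℝ → ℤ → ℂ := fun s l => (Complex.exp (Complex.I * (freq a b l ^ 2 : ℝ) * s) - 1)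
      * (G (t + s) l - G t l) with hφ₁
    have hφ₁c : ∀ l, ContinuousOn (fun s => φ₁ s l) (Icc (-τ) τ) := fun l =>
      ((continuous_exp_I_mul _).continuousOn.sub continuousOn_const).mul (hgc l)
    set φ₂ : ℝ → ℤ → ℂ := fun s l => (G (t + s) l - G t l) + (G (t - s) l - G t l) with hφ₂
    have hgc' : ∀ l, ContinuousOn (fun s => G (t - s) l - G t l) (Icc (-τ) τ) := fun l => by
      have := (hgc l).comp (f := fun s => -s) (by fun_prop)
        (s := Icc (-τ) τ) fun s hs => ⟨by linarith [hs.2], by linarith [hs.1]⟩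
      exact this
    have hsplit : ∀ l, ∫ s in (-τ)..τ, φ s l
        = (∫ s in (-τ)..τ, φ₁ s l) + ∫ s in (0 : ℝ)..τ, φ₂ s l := by
      intro l
      have i0 := (hgc l).intervalIntegrable_of_Icc (μ := volume) (by linarith)
      have i1 : IntervalIntegrable (fun s => G (t + s) l - G t l) volume (-τ) 0 :=
        ((hgc l).mono (Icc_subset_Icc_right hτ)).intervalIntegrable_of_Icc (by linarith)
      have i2 : IntervalIntegrable (fun s => G (t + s) l - G t l) volume 0 τ :=
        ((hgc l).mono (Icc_subset_Icc_left (by linarith))).intervalIntegrable_of_Icc hτ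
      have i3 : IntervalIntegrable (fun s => G (t - s) l - G t l) volume 0 τ :=
        ((hgc' l).mono (Icc_subset_Icc_left (by linarith))).intervalIntegrable_of_Icc hτ
      have e1 : ∫ s in (-τ)..τ, φ s l = (∫ s in (-τ)..τ, φ₁ s l)
          + ∫ s in (-τ)..τ, (G (t + s) l - G t l) := by
        rw [← intervalIntegral.integral_add
          ((hφ₁c l).intervalIntegrable_of_Icc (by linarith)) i0]
        congr 1; ext s; simp only [hφ, hφ₁]; ring
      have e2 : ∫ s in (-τ)..0, (G (t + s) l - G t l)
          = ∫ s in (0 : ℝ)..τ, (G (t - s) l - G t l) := by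
        have := intervalIntegral.integral_comp_neg (a := 0) (b := τ)
          (fun s => G (t + s) l - G t l)
        rw [neg_zero] at this
        rw [← this]
        rfl
      rw [e1, ← intervalIntegral.integral_add_adjacent_intervals i1 i2, e2,
        ← intervalIntegral.integral_add i3 i2]
      congr 2; ext s; simp only [hφ₂]; ring
    simp only [hsplit]
    refine ell_add_le.trans ?_
    have b1 : ell S (fun _ => 1) (fun l => ∫ s in (-τ)..τ, φ₁ s l) ≤ 2 * C * τ ^ 3 := by
      refine (ell_integral_le (K := τ * (C * τ)) (by linarith) (fun l _ => hφ₁c l)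
        fun s hs => ?_).trans (le_of_eq (by ring))
      -- From |e^{iμ²s} - 1| ≤ |s|μ², a factor τ is gained at the price of the H² weight.
      have h3 : ell S (fun _ => 1) (φ₁ s) ≤ τ * ell S (wt₂ a b) (fun l => G (t + s) l - G t l) :=
        ell_mono_weight hτ (fun _ => zero_le_one) fun l _ => by
          rw [one_mul, hφ₁, norm_mul, ← mul_assoc]
          refine mul_le_mul_of_nonneg_right ?_ (norm_nonneg _)
          refine (norm_exp_I_mul_sub_one_le _ s (sq_nonneg _)).trans ?_
          exact mul_le_mul (habs s hs) (by rw [wt₂]; linarith) (sq_nonneg _) hτ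
      exact h3.trans (mul_le_mul_of_nonneg_left ((hg s hs S).trans
        (mul_le_mul_of_nonneg_left (habs s hs) hC)) hτ)
    have b2 : ell S (fun _ => 1) (fun l => ∫ s in (0 : ℝ)..τ, φ₂ s l) ≤ C' * τ ^ 3 := by
      refine (ell_integral_le (K := C' * τ ^ 2) hτ (fun l _ => ((hgc l).mono
        (Icc_subset_Icc_left (by linarith))).add ((hgc' l).mono
        (Icc_subset_Icc_left (by linarith)))) fun s hs => ?_).trans (le_of_eq (by ring))
      refine (hs2 t s hs.1 ⟨by linarith [hm.1, hs.2], by linarith [ht.2, hs.1]⟩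
        ⟨by linarith [ht.1, hs.1], by linarith [hp.2, hs.2]⟩ S).trans ?_
      exact mul_le_mul_of_nonneg_left (pow_le_pow_left₀ hs.1 hs.2 2) hC'
    linarith
  have r1 := (hR (fun _ => 1)).trans ((one_mul _).trans_le h1)
  have r2 := (hR (wt₂ a b)).trans ((one_mul _).trans_le h2)
  refine ⟨r1, ?_⟩
  have hint := ell_interpolation (S := S) (ν := wt₂ a b) (ν₁ := wt₁ a b)
    (c := fun l => -Complex.I * Complex.exp (-Complex.I * τ * (freq a b l ^ 2 : ℝ))
      * ∫ s in (-τ)..τ, φ s l) wt₁_sq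
  -- The geometric mean of τ² and τ³ is τ^{5/2}. The factor τ is kept apart because summing over T/τ
  -- steps consumes it.
  have h5 : (τ * τ ^ (3 / 2 : ℝ)) ^ 2 = τ ^ 2 * τ ^ 3 := by
    rw [mul_pow, ← Real.rpow_natCast (τ ^ (3 / 2 : ℝ)), ← Real.rpow_mul hτ]
    norm_num
  have h6 : 0 ≤ τ * τ ^ (3 / 2 : ℝ) := by positivity
  refine le_of_sq_le_sq ?_ (by positivity)
  rw [mul_pow, h5]
  refine hint.trans ((mul_le_mul r2 r1 ell_nonneg (by positivity)).trans ?_)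
  have : 2 * C * τ ^ 2 * ((2 * C + C') * τ ^ 3) = (2 * C * (2 * C + C')) * (τ ^ 2 * τ ^ 3) := by ring
  rw [this]
  exact mul_le_mul_of_nonneg_right (by nlinarith [mul_nonneg hC hC', mul_nonneg hC' hC'])
    (by positivity)

/-- The local error of the first step. -/
theorem start_error (hU : Sol Θ T M U U₁ U₂) : ∃ C : ℝ, 0 ≤ C ∧ ∀ τ : ℝ, 0 ≤ τ → τ ≤ T →
    ∃ R : ℤ → ℂ, (∀ l, fourierCoef a b (U τ) l
      = Complex.exp (-Complex.I * τ * (freq a b l : ℂ) ^ 2) * fourierCoef a b (U 0) l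
        - Complex.I * τ * phi1 (-Complex.I * τ * (freq a b l : ℂ) ^ 2)
          * fourierCoef a b (Θ.op (U 0)) l + R l) ∧
    ∀ S : Finset ℤ, ell S (fun _ => 1) R ≤ C * τ ^ 2 ∧ ell S (wt₁ a b) R ≤ C * τ ^ 2 := by
  obtain ⟨C, hC, hl⟩ := hU.op_lipschitz
  refine ⟨C, hC, fun τ hτ hT => ?_⟩
  have hsub : Icc 0 τ ⊆ Icc 0 T := Icc_subset_Icc_right hT
  set G : ℝ → ℤ → ℂ := fun s l => fourierCoef a b (Θ.op (U s)) l with hG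
  set φ : ℝ → ℤ → ℂ := fun s l => Complex.exp (Complex.I * (freq a b l ^ 2 : ℝ) * s)
    * (G s l - G 0 l) with hφ
  refine ⟨fun l => -Complex.I * Complex.exp (-Complex.I * τ * (freq a b l ^ 2 : ℝ))
    * ∫ s in (0 : ℝ)..τ, φ s l, fun l => ?_, fun S => ?_⟩
  · have := SEWI.start_error (m := freq a b l ^ 2) hτ ((hU.continuousOn_coef l).mono hsub)
      ((hU.continuousOn_op l).mono hsub)
      (fun s hs => hU.ode l s ⟨hs.1, hs.2.trans_le hT⟩)
    refine (sub_eq_iff_eq_add'.1 this).trans ?_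
    simp only [hφ, hG, Complex.ofReal_pow]
  -- Second order suffices here, since this error is committed only once. The H² bound then
  -- dominates both required norms.
  have h2 : ell S (wt₂ a b) (fun l => -Complex.I * Complex.exp (-Complex.I * τ *
      (freq a b l ^ 2 : ℝ)) * ∫ s in (0 : ℝ)..τ, φ s l) ≤ C * τ ^ 2 := by
    have hR : ell S (wt₂ a b) (fun l => -Complex.I * Complex.exp (-Complex.I * τ *
        (freq a b l ^ 2 : ℝ)) * ∫ s in (0 : ℝ)..τ, φ s l)
        ≤ 1 * ell S (wt₂ a b) (fun l => ∫ s in (0 : ℝ)..τ, φ s l) :=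
      ell_mono zero_le_one fun l _ => by
        rw [norm_mul, norm_mul, norm_neg, Complex.norm_I,
          show -Complex.I * τ * (freq a b l ^ 2 : ℝ) = Complex.I * (-τ * freq a b l ^ 2 : ℝ) by
            push_cast; ring, norm_exp_I_mul, one_mul]
    refine hR.trans ?_
    rw [one_mul]
    refine (ell_integral_le (K := C * τ) hτ (fun l _ => (continuous_exp_I_mul _).continuousOn.mul
      (((hU.continuousOn_op l).mono hsub).sub continuousOn_const)) fun s hs => ?_).trans
      (le_of_eq (by ring))
    have h3 : ell S (wt₂ a b) (φ s) ≤ 1 * ell S (wt₂ a b) (fun l => G s l - G 0 l) :=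
      ell_mono zero_le_one fun l _ => by rw [hφ, norm_mul, norm_exp_I_mul_mul]
    rw [one_mul] at h3
    have h4 := hl 0 ⟨le_rfl, hτ.trans hT⟩ s (hsub hs) S
    rw [sub_zero, abs_of_nonneg hs.1] at h4
    exact h3.trans (h4.trans (mul_le_mul_of_nonneg_left hs.2 hC))
  refine ⟨?_, ?_⟩
  · refine le_trans ((ell_mono_weight (ν' := wt₂ a b) zero_le_one (fun _ => zero_le_one)
      fun l _ => ?_).trans (one_mul _).le) h2
    rw [one_mul, one_mul]
    exact le_mul_of_one_le_left (norm_nonneg _) (one_le_wt₂ l)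
  · refine le_trans ((ell_mono_weight (ν' := wt₂ a b) zero_le_one
      (fun l => zero_le_one.trans (one_le_wt₁ l)) fun l _ => ?_).trans (one_mul _).le) h2
    rw [one_mul]
    exact mul_le_mul_of_nonneg_right (wt₁_le_wt₂ l) (norm_nonneg _)

end Sol

end SEWI

namespace SEWI

variable {a b : ℝ}

/-! ### Spectral projection -/

theorem nrm_le_of_sum_le (hab : a < b) {u : ℝ → ℂ} (hu : MemLp u 2 (vol a b)) {A : ℝ} (hA : 0 ≤ A)
    (h : ∀ S : Finset ℤ, ∑ l ∈ S, ‖fourierCoef a b u l‖ ^ 2 ≤ A ^ 2) :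
    nrm a b u ≤ Real.sqrt (b - a) * A := by
  have hpos : 0 < b - a := sub_pos.2 hab
  have h1 := hasSum_le_of_sum_le (hasSum_fourierCoef hab hu) h
  refine le_of_sq_le_sq ?_ (by positivity)
  rw [mul_pow, Real.sq_sqrt hpos.le]
  rwa [inv_mul_le_iff₀ hpos] at h1

/-- Outside the index set |l| ≥ N/2, so h|μ_l| = 2π|l|/N ≥ π. -/
theorem one_le_mul_abs_freq (hab : a < b) {N : ℕ} (hN : 0 < N) (hN2 : Even N) {l : ℤ}
    (hl : l ∉ indexSet N) : 1 ≤ (b - a) / N * |freq a b l| := by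
  have hpos : 0 < b - a := sub_pos.2 hab
  obtain ⟨k, rfl⟩ := hN2
  have hk : (0 : ℝ) < k := by exact_mod_cast (by omega : 0 < k)
  have hl' : (k : ℤ) ≤ |l| := by
    rw [indexSet, Finset.mem_Ico, not_and_or, not_le, not_lt] at hl
    have e : (((k + k : ℕ) : ℤ) / 2) = k := by push_cast; omega
    rw [e] at hl
    rcases hl with hl | hl
    · exact le_abs.2 (Or.inr (by omega))
    · exact le_abs.2 (Or.inl hl)
  have hl2 : (k : ℝ) ≤ |(l : ℝ)| := by
    rw [← Int.cast_abs]; exact_mod_cast hl'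
  have e : (b - a) / ((k + k : ℕ) : ℝ) * |freq a b l| = Real.pi * |(l : ℝ)| / k := by
    rw [freq, abs_div, abs_mul, abs_of_pos hpos, abs_of_pos Real.two_pi_pos]
    push_cast
    field_simp
    ring
  rw [e, le_div_iff₀ hk]
  nlinarith [Real.pi_gt_three]

theorem sum_sq_le_of_split {S : Finset ℤ} {v : ℤ → ℂ} {α β : ℝ}
    (hα : 0 ≤ α) (hβ : 0 ≤ β) (h1 : ∑ l ∈ S, ‖v l‖ ^ 2 ≤ α ^ 2)
    (h2 : ∀ S' : Finset ℤ, Disjoint S' S → ∑ l ∈ S', ‖v l‖ ^ 2 ≤ β ^ 2) (S' : Finset ℤ) :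
    ∑ l ∈ S', ‖v l‖ ^ 2 ≤ (α + β) ^ 2 := by
  have h3 : ∑ l ∈ S', ‖v l‖ ^ 2 ≤ ∑ l ∈ S ∪ S', ‖v l‖ ^ 2 :=
    Finset.sum_le_sum_of_subset_of_nonneg Finset.subset_union_right fun _ _ _ => by positivity
  have h4 : ∑ l ∈ S ∪ S', ‖v l‖ ^ 2 = ∑ l ∈ S, ‖v l‖ ^ 2 + ∑ l ∈ S' \ S, ‖v l‖ ^ 2 := by
    rw [← Finset.union_sdiff_self_eq_union, Finset.sum_union Finset.disjoint_sdiff]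
  have h5 := h2 (S' \ S) Finset.sdiff_disjoint
  nlinarith [mul_nonneg hα hβ]

/-- The numerical scheme on the level of the Fourier coefficients. -/
noncomputable def coefs (Θ : Model a b) (N : ℕ) (τ : ℝ) (c₀ : ℤ → ℂ) : ℕ → ℤ → ℂ
  | 0 => c₀
  | 1 => fun l => Complex.exp (-Complex.I * τ * (freq a b l : ℂ) ^ 2) * c₀ l
      - Complex.I * τ * phi1 (-Complex.I * τ * (freq a b l : ℂ) ^ 2)
        * fourierCoef a b (Θ.op (trigPoly a b N c₀)) l
  | n + 2 => fun l => Complex.exp (-2 * Complex.I * τ * (freq a b l : ℂ) ^ 2)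
        * coefs Θ N τ c₀ n l
      - 2 * Complex.I * τ * Complex.exp (-Complex.I * τ * (freq a b l : ℂ) ^ 2)
        * (Real.sinc (τ * freq a b l ^ 2) : ℂ)
        * fourierCoef a b (Θ.op (trigPoly a b N (coefs Θ N τ c₀ (n + 1)))) l

theorem trigPoly_perC1 (hab : a < b) (N : ℕ) (c : ℤ → ℂ) :
    PerC1 a b (trigPoly a b N c) (trigPolyDeriv a b N c) :=
  ⟨trigPoly_hasDerivAt N c, trigPoly_continuous N _, trigPoly_periodic hab N c⟩

theorem PerC1.isPrim {u u₁ : ℝ → ℂ} (h : PerC1 a b u u₁) : IsPrim a b u u₁ :=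
  IsPrim.of_hasDerivAt h.d h.c

namespace Sol

variable {Θ : Model a b} {T M : ℝ} {U U₁ U₂ : ℝ → ℝ → ℂ}

theorem fourierCoef_sub_trigPoly (hU : Sol Θ T M U U₁ U₂) {t : ℝ} (ht : t ∈ Icc 0 T) (N : ℕ)
    (c : ℤ → ℂ) (l : ℤ) : fourierCoef a b (fun x => U t x - trigPoly a b N c x) l
      = fourierCoef a b (U t) l - if l ∈ indexSet N then c l else 0 := by
  rw [fourierCoef_sub (integrable_of_continuous (hU.smooth t ht).zero.continuous)
    (integrable_of_continuous (trigPoly_continuous N c)), fourierCoef_trigPoly Θ.hab]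

/-- Parseval splits the error: retained modes give the coefficient error, and discarded ones are
dominated by h⁴μ⁴ times the coefficient, which `tail` bounds. -/
theorem nrm_sub_trigPoly_le (hU : Sol Θ T M U U₁ U₂) {t : ℝ} (ht : t ∈ Icc 0 T) {N : ℕ}
    (hN : 0 < N) (hN2 : Even N) {h : ℝ} (hh : h = (b - a) / N) (c : ℤ → ℂ) :
    nrm a b (fun x => U t x - trigPoly a b N c x) ≤ Real.sqrt (b - a) *
      (ell (indexSet N) (fun _ => 1) (fun l => fourierCoef a b (U t) l - c l) + M * h ^ 4) := by
  have hM := hU.M_nonneg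
  have hpos : 0 < b - a := sub_pos.2 Θ.hab
  have hh0 : 0 ≤ h := by rw [hh]; positivity
  have cU := (hU.smooth t ht).zero.continuous
  refine nrm_le_of_sum_le (u := fun x => U t x - trigPoly a b N c x) Θ.hab
    (memLp_of_continuous (cU.sub (trigPoly_continuous N c)))
    (add_nonneg ell_nonneg (by positivity)) fun S' => ?_
  refine sum_sq_le_of_split (S := indexSet N) ell_nonneg (by positivity) ?_ (fun S'' hS => ?_) S'
  · rw [ell_sq]
    refine le_of_eq (Finset.sum_congr rfl fun l hl => ?_)
    rw [hU.fourierCoef_sub_trigPoly ht, if_pos hl, one_mul]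
  · have ht := hU.tail t ht S''
    have h1 : ∑ l ∈ S'', ‖fourierCoef a b (fun x => U t x - trigPoly a b N c x) l‖ ^ 2
        ≤ (h ^ 4 * ell S'' (fun l => freq a b l ^ 4) (fourierCoef a b (U t))) ^ 2 := by
      rw [mul_pow, ell_sq, Finset.mul_sum]
      refine Finset.sum_le_sum fun l hl => ?_
      have hl' : l ∉ indexSet N := Finset.disjoint_left.1 hS hl
      rw [hU.fourierCoef_sub_trigPoly ‹_›, if_neg hl', sub_zero, ← mul_pow]
      refine pow_le_pow_left₀ (norm_nonneg _) ?_ 2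
      have hf := one_le_mul_abs_freq Θ.hab hN hN2 hl'
      rw [← hh] at hf
      have hf4 : 1 ≤ h ^ 4 * freq a b l ^ 4 := by
        have := one_le_pow₀ hf (n := 4)
        rwa [mul_pow, (by decide : Even 4).pow_abs] at this
      rw [← mul_assoc]
      exact le_mul_of_one_le_left (norm_nonneg _) hf4
    refine h1.trans (pow_le_pow_left₀ (mul_nonneg (by positivity) ell_nonneg) ?_ 2)
    rw [mul_comm]
    exact mul_le_mul_of_nonneg_right ht (by positivity)

/-- The derivative uses up one factor μ, so the fourth-order tail leaves only h³; on retained modes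
|μ| is at most the H¹ weight. -/
theorem nrm_deriv_sub_trigPoly_le (hU : Sol Θ T M U U₁ U₂) {t : ℝ} (ht : t ∈ Icc 0 T) {N : ℕ}
    (hN : 0 < N) (hN2 : Even N) {h : ℝ} (hh : h = (b - a) / N) (c : ℤ → ℂ) :
    nrm a b (fun x => U₁ t x - trigPolyDeriv a b N c x) ≤ Real.sqrt (b - a) *
      (ell (indexSet N) (wt₁ a b) (fun l => fourierCoef a b (U t) l - c l) + M * h ^ 3) := by
  have hM := hU.M_nonneg
  have hpos : 0 < b - a := sub_pos.2 Θ.hab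
  have hh0 : 0 ≤ h := by rw [hh]; positivity
  have hs := (hU.smooth t ht).zero
  have hp := trigPoly_perC1 Θ.hab N c
  have hcoef : ∀ l, ‖fourierCoef a b (fun x => U₁ t x - trigPolyDeriv a b N c x) l‖
      = |freq a b l| * ‖fourierCoef a b (U t) l - if l ∈ indexSet N then c l else 0‖ := by
    intro l
    rw [← hU.fourierCoef_sub_trigPoly ht, (hs.isPrim.sub hp.isPrim).fourierCoef_eq Θ.hab
      (by simp only [hs.per, hp.per]), norm_mul, norm_mul, Complex.norm_I, one_mul,
      Complex.norm_real, Real.norm_eq_abs]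
  refine nrm_le_of_sum_le (u := fun x => U₁ t x - trigPolyDeriv a b N c x) Θ.hab
    (memLp_of_continuous (hs.c.sub hp.c))
    (add_nonneg ell_nonneg (by positivity)) fun S' => ?_
  refine sum_sq_le_of_split (S := indexSet N) ell_nonneg (by positivity) ?_ (fun S'' hS => ?_) S'
  · rw [ell_sq]
    refine Finset.sum_le_sum fun l hl => ?_
    rw [hcoef, if_pos hl]
    refine pow_le_pow_left₀ (by positivity) (mul_le_mul_of_nonneg_right ?_ (norm_nonneg _)) 2
    rw [wt₁, ← Real.sqrt_sq_eq_abs]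
    exact Real.sqrt_le_sqrt (by linarith)
  · have ht' := hU.tail t ht S''
    have h1 : ∑ l ∈ S'', ‖fourierCoef a b (fun x => U₁ t x - trigPolyDeriv a b N c x) l‖ ^ 2
        ≤ (h ^ 3 * ell S'' (fun l => freq a b l ^ 4) (fourierCoef a b (U t))) ^ 2 := by
      rw [mul_pow, ell_sq, Finset.mul_sum]
      refine Finset.sum_le_sum fun l hl => ?_
      have hl' : l ∉ indexSet N := Finset.disjoint_left.1 hS hl
      rw [hcoef, if_neg hl', sub_zero, ← mul_pow]
      refine pow_le_pow_left₀ (by positivity) ?_ 2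
      have hf := one_le_mul_abs_freq Θ.hab hN hN2 hl'
      rw [← hh] at hf
      have hf3 : 1 ≤ h ^ 3 * |freq a b l| ^ 3 := by
        have := one_le_pow₀ hf (n := 3)
        rwa [mul_pow] at this
      have e : h ^ 3 * (freq a b l ^ 4 * ‖fourierCoef a b (U t) l‖)
          = (h ^ 3 * |freq a b l| ^ 3) * (|freq a b l| * ‖fourierCoef a b (U t) l‖) := by
        rw [← (by decide : Even 4).pow_abs (freq a b l)]; ring
      rw [e]
      exact le_mul_of_one_le_left (by positivity) hf3
    refine h1.trans (pow_le_pow_left₀ (mul_nonneg (by positivity) ell_nonneg) ?_ 2)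
    rw [mul_comm]
    exact mul_le_mul_of_nonneg_right ht' (by positivity)

/-! ### Stability and the global error -/

/-- One step of the error recursion of the two-step scheme. -/
theorem ell_error_step {ν : ℤ → ℝ} {S : Finset ℤ} {τ : ℝ} (hτ : 0 ≤ τ) {e e' d R : ℤ → ℂ}
    (h : ∀ l, e' l = Complex.exp (-2 * Complex.I * τ * (freq a b l : ℂ) ^ 2) * e l
      - 2 * Complex.I * τ * Complex.exp (-Complex.I * τ * (freq a b l : ℂ) ^ 2)
        * (Real.sinc (τ * freq a b l ^ 2) : ℂ) * d l + R l) :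
    ell S ν e' ≤ ell S ν e + 2 * τ * ell S ν d + ell S ν R := by
  rw [show e' = fun l => (Complex.exp (-2 * Complex.I * τ * (freq a b l : ℂ) ^ 2) * e l
      + -(2 * Complex.I * τ * Complex.exp (-Complex.I * τ * (freq a b l : ℂ) ^ 2)
        * (Real.sinc (τ * freq a b l ^ 2) : ℂ) * d l)) + R l from funext fun l => by
      rw [h, sub_eq_add_neg]]
  have n1 : ∀ l, ‖Complex.exp (-2 * Complex.I * τ * (freq a b l : ℂ) ^ 2)‖ = 1 := fun l => by
    rw [show -2 * Complex.I * τ * (freq a b l : ℂ) ^ 2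
      = Complex.I * (-2 * τ * freq a b l ^ 2 : ℝ) by push_cast; ring, norm_exp_I_mul]
  have n2 : ∀ l, ‖Complex.exp (-Complex.I * τ * (freq a b l : ℂ) ^ 2)‖ = 1 := fun l => by
    rw [show -Complex.I * τ * (freq a b l : ℂ) ^ 2
      = Complex.I * (-τ * freq a b l ^ 2 : ℝ) by push_cast; ring, norm_exp_I_mul]
  refine ell_add_le.trans (add_le_add_left (ell_add_le.trans (add_le_add ?_ ?_)) _)
  · refine (ell_mono zero_le_one fun l _ => ?_).trans (one_mul _).le
    rw [norm_mul, n1]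
  · refine ell_mono (by positivity) fun l _ => ?_
    rw [norm_neg, norm_mul, norm_mul, norm_mul, norm_mul, norm_mul, n2, Complex.norm_I,
      Complex.norm_real, Complex.norm_real, Real.norm_of_nonneg hτ, Complex.norm_ofNat, mul_one,
      mul_one]
    refine mul_le_mul_of_nonneg_right (mul_le_of_le_one_right (by positivity) ?_) (norm_nonneg _)
    exact Real.abs_sinc_le_one _

theorem ell_error_start {ν : ℤ → ℝ} {S : Finset ℤ} {τ : ℝ} (hτ : 0 ≤ τ) {e' d R : ℤ → ℂ}
    (h : ∀ l, e' l = - (Complex.I * τ * phi1 (-Complex.I * τ * (freq a b l : ℂ) ^ 2) * d l) + R l) :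
    ell S ν e' ≤ τ * ell S ν d + ell S ν R := by
  rw [show e' = fun l => - (Complex.I * τ * phi1 (-Complex.I * τ * (freq a b l : ℂ) ^ 2) * d l)
    + R l from funext h]
  refine ell_add_le.trans (add_le_add_left (ell_mono hτ fun l _ => ?_) _)
  rw [norm_neg, norm_mul, mul_assoc, norm_mul, Complex.norm_I, one_mul]
  refine mul_le_mul_of_nonneg_right ?_ (norm_nonneg _)
  have := norm_mul_phi1_le (freq a b l ^ 2) hτ
  rwa [Complex.ofReal_pow] at this

set_option maxHeartbeats 1000000 in
/-- The global error of the scheme. -/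
theorem error (hU : Sol Θ T M U U₁ U₂) (hT : 0 < T) : ∃ ε : ℝ, 0 < ε ∧ ∃ C : ℝ, 0 ≤ C ∧
    ∀ τ : ℝ, 0 < τ → τ < ε → ∀ N : ℕ, 0 < N → Even N → ∀ h : ℝ, h = (b - a) / N → h < ε →
    ∀ n : ℕ, n * τ ≤ T →
      nrm a b (fun x => U (n * τ) x
        - trigPoly a b N (coefs Θ N τ (fourierCoef a b (U 0)) n) x) ≤ C * (τ ^ 2 + h ^ 4) ∧
      nrm a b (fun x => U (n * τ) x
        - trigPoly a b N (coefs Θ N τ (fourierCoef a b (U 0)) n) x)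
        + nrm a b (fun x => U₁ (n * τ) x
          - trigPolyDeriv a b N (coefs Θ N τ (fourierCoef a b (U 0)) n) x)
        ≤ C * (τ ^ (3 / 2 : ℝ) + h ^ 3) := by
  have hpos : 0 < b - a := sub_pos.2 Θ.hab
  have hM := hU.M_nonneg
  obtain ⟨C₀, hC₀, hL2⟩ := Θ.op_lipschitz_L2 (M + 1)
  obtain ⟨C₁, hC₁, hH1⟩ := Θ.op_lipschitz_H1 (M + 1)
  obtain ⟨C₃, hC₃, hcen⟩ := hU.center_error
  obtain ⟨C₄, hC₄, hsta⟩ := hU.start_error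
  set q := Real.sqrt (b - a) with hq
  have hq0 : 0 < q := Real.sqrt_pos.2 hpos
  set Cs := q / (b - a) + q with hCs
  have hCs0 : 0 < Cs := by positivity
  -- The factor 2 of the scheme, times the Lipschitz constant, times the factor 2q (respectively q,
  -- for `L₀`) relating norms of functions to norms of coefficients.
  set L := 4 * C₁ * q with hL
  set L₀ := 2 * C₀ * q with hL₀
  have hL0 : 0 ≤ L := by positivity
  have hL₀0 : 0 ≤ L₀ := by positivity
  -- Chosen so that a coefficient error of at most `r` contributes at most 1/2 to the sup norm. The
  -- discarded modes may contribute another 1/2, whence the bound M + 1.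
  set r := 1 / (4 * Cs * q) with hr
  have hr0 : 0 < r := by positivity
  set K₁ := Real.exp (L * T) * ((L * M + C₄) + T * (L * M + C₃)) with hK₁
  set K₀ := Real.exp (L₀ * T) * ((L₀ * M + C₄) + T * (L₀ * M + C₃)) with hK₀
  have hK₁0 : 0 ≤ K₁ := by positivity
  have hK₀0 : 0 ≤ K₀ := by positivity
  -- The second entry makes the H¹ bound K₁(τ^{3/2} + h³) at most `r`, closing the bootstrap; the
  -- third makes the sup norm of the projection error at most 1/2.
  set ε := min 1 (min (r / (2 * K₁ + 1)) (1 / (4 * Cs * q * M + 1))) with hε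
  refine ⟨ε, by positivity, q * (K₀ + M) + 2 * q * (K₁ + M), by positivity,
    fun τ hτ hτε N hN hN2 h hh hhε n hn => ?_⟩
  have hτ1 : τ ≤ 1 := hτε.le.trans (min_le_left _ _)
  have hh1 : h ≤ 1 := hhε.le.trans (min_le_left _ _)
  have hh0 : 0 < h := by rw [hh]; positivity
  set s := τ ^ (3 / 2 : ℝ) with hs
  have hs0 : 0 ≤ s := by positivity
  have hsτ : s ≤ τ := by
    have := Real.rpow_le_rpow_of_exponent_ge hτ hτ1 (show (1:ℝ) ≤ 3 / 2 by norm_num)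
    rwa [Real.rpow_one] at this
  have hτs : τ ^ 2 ≤ s := by
    have := Real.rpow_le_rpow_of_exponent_ge hτ hτ1 (show (3 / 2:ℝ) ≤ (2:ℕ) by norm_num)
    rwa [Real.rpow_natCast] at this
  have hh3 : h ^ 3 ≤ h := by
    have := pow_le_pow_of_le_one hh0.le hh1 (show 1 ≤ 3 by norm_num)
    rwa [pow_one] at this
  have hh43 : h ^ 4 ≤ h ^ 3 := pow_le_pow_of_le_one hh0.le hh1 (by norm_num)
  have hsmall : K₁ * (s + h ^ 3) ≤ r := by
    have e1 : τ < r / (2 * K₁ + 1) :=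
      hτε.trans_le ((min_le_right _ _).trans (min_le_left _ _))
    have e2 : h < r / (2 * K₁ + 1) :=
      hhε.trans_le ((min_le_right _ _).trans (min_le_left _ _))
    have e3 : K₁ * (s + h ^ 3) ≤ K₁ * (2 * (r / (2 * K₁ + 1))) :=
      mul_le_mul_of_nonneg_left (by linarith) hK₁0
    refine e3.trans ?_
    rw [← mul_assoc, ← mul_div_assoc, div_le_iff₀ (by positivity)]
    nlinarith
  have hsmall' : 2 * Cs * q * (M * h ^ 3) ≤ 1 / 2 := by
    have e1 : h < 1 / (4 * Cs * q * M + 1) :=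
      hhε.trans_le ((min_le_right _ _).trans (min_le_right _ _))
    have e2 : h * (4 * Cs * q * M + 1) ≤ 1 := by
      rw [lt_div_iff₀ (by positivity)] at e1; exact e1.le
    have e3 : 0 ≤ Cs * q * M := by positivity
    nlinarith [mul_le_mul_of_nonneg_left hh3 e3]
  set S := indexSet N with hS
  set c := coefs Θ N τ (fourierCoef a b (U 0)) with hc
  set p : ℕ → ℝ → ℂ := fun k => trigPoly a b N (c k) with hp
  set p₁ : ℕ → ℝ → ℂ := fun k => trigPolyDeriv a b N (c k) with hp₁
  set e : ℕ → ℤ → ℂ := fun k l => fourierCoef a b (U (k * τ)) l - c k l with he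
  set E : ℕ → ℝ := fun k => ell S (wt₁ a b) (e k) with hE
  set E₀ : ℕ → ℝ := fun k => ell S (fun _ => 1) (e k) with hE₀
  have hEE : ∀ k, E₀ k ≤ E k := fun k =>
    (ell_mono_weight zero_le_one (fun _ => zero_le_one) fun l _ => by
      rw [one_mul, one_mul]
      exact le_mul_of_one_le_left (norm_nonneg _) (one_le_wt₁ l)).trans (one_mul _).le
  have htime : ∀ k ≤ n, (k : ℝ) * τ ∈ Icc 0 T := fun k hk => by
    have : (k : ℝ) ≤ n := by exact_mod_cast hk
    exact ⟨by positivity, (mul_le_mul_of_nonneg_right this hτ.le).trans hn⟩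
  have hproj₀ : ∀ k ≤ n, nrm a b (fun x => U (k * τ) x - p k x) ≤ q * (E₀ k + M * h ^ 4) :=
    fun k hk => hU.nrm_sub_trigPoly_le (htime k hk) hN hN2 hh (c k)
  have hproj₁ : ∀ k ≤ n, nrm a b (fun x => U (k * τ) x - p k x)
      + nrm a b (fun x => U₁ (k * τ) x - p₁ k x) ≤ 2 * q * (E k + M * h ^ 3) := fun k hk => by
    have i1 := hproj₀ k hk
    have i2 := hU.nrm_deriv_sub_trigPoly_le (htime k hk) hN hN2 hh (c k)
    have i3 := mul_le_mul_of_nonneg_left (add_le_add (hEE k)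
      (mul_le_mul_of_nonneg_left hh43 hM)) hq0.le
    linarith
  have hper : ∀ k, PerC1 a b (p k) (p₁ k) := fun k => trigPoly_perC1 Θ.hab N (c k)
  -- A small H¹ error gives a sup bound through the Sobolev inequality. No inverse inequality
  -- enters, so τ and h remain unrelated.
  have hbound : ∀ k ≤ n, E k ≤ r → ∀ x ∈ Icc a b, ‖p k x‖ ≤ M + 1 := by
    intro k hk hEk x hx
    have hs := (hU.smooth _ (htime k hk)).zero
    have i1 := (hs.isPrim.sub (hper k).isPrim).norm_le Θ.hab
      (memLp_of_continuous (hs.c.sub (hper k).c)) hx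
    have i2 := mul_le_mul_of_nonneg_left (hproj₁ k hk) hCs0.le
    have i3 : 2 * Cs * q * E k ≤ 1 / 2 := by
      have : 2 * Cs * q * E k ≤ 2 * Cs * q * r := mul_le_mul_of_nonneg_left hEk (by positivity)
      refine this.trans (le_of_eq ?_)
      rw [hr]; field_simp; norm_num
    have i4 := (hU.bdd _ (htime k hk) x hx).1
    have i5 := norm_le_norm_add_norm_sub' (p k x) (U (k * τ) x)
    rw [norm_sub_rev] at i5
    linarith
  have hboundU : ∀ k ≤ n, ∀ x ∈ Icc a b, ‖U (k * τ) x‖ ≤ M + 1 ∧ ‖U₁ (k * τ) x‖ ≤ M + 1 :=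
    fun k hk x hx => ⟨by linarith [(hU.bdd _ (htime k hk) x hx).1],
      by linarith [(hU.bdd _ (htime k hk) x hx).2.1]⟩
  set d : ℕ → ℤ → ℂ := fun k l => fourierCoef a b (Θ.op (U (k * τ))) l
    - fourierCoef a b (Θ.op (p k)) l with hd
  have hd₁ : ∀ k ≤ n, E k ≤ r → 2 * ell S (wt₁ a b) (d k) ≤ L * (E k + M * h ^ 3) := by
    intro k hk hEk
    have i1 := hH1 _ _ _ _ (hU.smooth _ (htime k hk)).zero (hper k)
      (fun x hx => (hboundU k hk x hx).1) (fun x hx => (hboundU k hk x hx).2)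
      (hbound k hk hEk) S
    have i2 := mul_le_mul_of_nonneg_left (hproj₁ k hk) hC₁
    rw [hL]
    linarith
  have hd₀ : ∀ k ≤ n, E k ≤ r → 2 * ell S (fun _ => 1) (d k) ≤ L₀ * (E₀ k + M * h ^ 4) := by
    intro k hk hEk
    have i1 := hL2 _ _ (hU.smooth _ (htime k hk)).zero.continuous (hper k).continuous
      (fun x hx => (hboundU k hk x hx).1) (hbound k hk hEk) S
    have i2 := mul_le_mul_of_nonneg_left (hproj₀ k hk) hC₀
    rw [hL₀]
    linarith
  have he0 : ∀ l, e 0 l = 0 := fun l => by simp [he, hc, coefs]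
  have hell0 : ∀ ν, ell S ν (e 0) = 0 := fun ν => by
    simp [ell, he0]
  -- Subtracting the scheme from the perturbed recursion of the exact solution, for an arbitrary
  -- weight ν so that L² and H¹ share the argument.
  have hstep : ∀ ν k, k + 2 ≤ n → ∃ R : ℤ → ℂ, (ell S (fun _ => 1) R ≤ C₃ * τ ^ 3 ∧
      ell S (wt₁ a b) R ≤ C₃ * (τ * s)) ∧
      ell S ν (e (k + 2)) ≤ ell S ν (e k) + 2 * τ * ell S ν (d (k + 1)) + ell S ν R := by
    intro ν k hk
    have t1 : ((k + 1 : ℕ) : ℝ) * τ - τ = k * τ := by push_cast; ring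
    have t2 : ((k + 1 : ℕ) : ℝ) * τ + τ = (k + 2 : ℕ) * τ := by push_cast; ring
    obtain ⟨R, hR, hRb⟩ := hcen ((k + 1 : ℕ) * τ) τ hτ.le (t1 ▸ htime k (by omega))
      (t2 ▸ htime (k + 2) hk)
    refine ⟨R, hRb S, ell_error_step (a := a) (b := b) hτ.le fun l => ?_⟩
    have := hR l
    rw [t1, t2] at this
    simp only [he, hd, hp]
    rw [this, show c (k + 2) l = Complex.exp (-2 * Complex.I * τ * (freq a b l : ℂ) ^ 2)
        * c k l - 2 * Complex.I * τ * Complex.exp (-Complex.I * τ * (freq a b l : ℂ) ^ 2)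
        * (Real.sinc (τ * freq a b l ^ 2) : ℂ)
        * fourierCoef a b (Θ.op (trigPoly a b N (c (k + 1)))) l from rfl]
    ring
  have hstart : ∀ ν, 1 ≤ n → ∃ R : ℤ → ℂ, (ell S (fun _ => 1) R ≤ C₄ * τ ^ 2 ∧
      ell S (wt₁ a b) R ≤ C₄ * τ ^ 2) ∧ ell S ν (e 1) ≤ τ * ell S ν (d 0) + ell S ν R := by
    intro ν hn1
    have ht1 := htime 1 hn1
    rw [Nat.cast_one, one_mul] at ht1
    obtain ⟨R, hR, hRb⟩ := hsta τ hτ.le ht1.2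
    refine ⟨R, hRb S, ell_error_start (a := a) (b := b) hτ.le fun l => ?_⟩
    simp only [he, hd, hp, Nat.cast_one, Nat.cast_zero, one_mul, zero_mul]
    rw [hR l, show c 1 l = Complex.exp (-Complex.I * τ * (freq a b l : ℂ) ^ 2)
        * fourierCoef a b (U 0) l
        - Complex.I * τ * phi1 (-Complex.I * τ * (freq a b l : ℂ) ^ 2)
        * fourierCoef a b (Θ.op (trigPoly a b N (c 0))) l from rfl]
    ring
  have hE0r : E 0 ≤ r := (hell0 _).le.trans hr0.le
  have hK₁b : Real.exp (L * T) * ((L * (M * h ^ 3) + C₄ * s) + T * (L * (M * h ^ 3) + C₃ * s))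
      ≤ K₁ * (s + h ^ 3) := by
    have ek : K₁ * (s + h ^ 3)
        = Real.exp (L * T) * (((L * M + C₄) + T * (L * M + C₃)) * (s + h ^ 3)) := by
      rw [hK₁, mul_assoc]
    rw [ek]
    refine mul_le_mul_of_nonneg_left ?_ (by positivity)
    have i1 : 0 ≤ L * M * s := by positivity
    have i2 : 0 ≤ C₄ * h ^ 3 := by positivity
    have i3 : 0 ≤ T * (L * M * s) := by positivity
    have i4 : 0 ≤ T * (C₃ * h ^ 3) := by positivity
    linarith
  -- The H¹ estimate comes first, because it alone controls the sup norm. The starting error τ² is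
  -- absorbed into τ^{3/2}.
  have main₁ : ∀ k ≤ n, E k ≤ K₁ * (s + h ^ 3) := by
    intro k hk
    refine le_trans (two_step_gronwall (E := E) (r := r) (L := L) (δ := L * (M * h ^ 3) + C₃ * s)
      (d := L * (M * h ^ 3) + C₄ * s) hτ.le hL0 (by positivity) (by positivity) hn
      (hell0 (wt₁ a b)).le (fun hn1 => ?_) (fun k hk hEk => ?_) (hK₁b.trans hsmall) k hk) hK₁b
    · obtain ⟨R, hRb, hR⟩ := hstart (wt₁ a b) hn1
      have i1 := hd₁ 0 (by omega) hE0r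
      rw [show E 0 = 0 from hell0 _, zero_add] at i1
      have i2 : 0 ≤ ell S (wt₁ a b) (d 0) := ell_nonneg
      have i3 := mul_le_of_le_one_left i2 hτ1
      have i4 := mul_le_mul_of_nonneg_left hτs hC₄
      have i5 := hRb.2
      change ell S (wt₁ a b) (e 1) ≤ _
      linarith
    · obtain ⟨R, hRb, hR⟩ := hstep (wt₁ a b) k hk
      have i1 := mul_le_mul_of_nonneg_left (hd₁ (k + 1) (by omega) hEk) hτ.le
      have i2 := hRb.2
      change ell S (wt₁ a b) (e (k + 2)) ≤ ell S (wt₁ a b) (e k) + _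
      linarith
  have hEr : ∀ k ≤ n, E k ≤ r := fun k hk => (main₁ k hk).trans hsmall
  have hK₀b : Real.exp (L₀ * T) * ((L₀ * (M * h ^ 4) + C₄ * τ ^ 2)
      + T * (L₀ * (M * h ^ 4) + C₃ * τ ^ 2)) ≤ K₀ * (τ ^ 2 + h ^ 4) := by
    have ek : K₀ * (τ ^ 2 + h ^ 4)
        = Real.exp (L₀ * T) * (((L₀ * M + C₄) + T * (L₀ * M + C₃)) * (τ ^ 2 + h ^ 4)) := by
      rw [hK₀, mul_assoc]
    rw [ek]
    refine mul_le_mul_of_nonneg_left ?_ (by positivity)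
    have i1 : 0 ≤ L₀ * M * τ ^ 2 := by positivity
    have i2 : 0 ≤ C₄ * h ^ 4 := by positivity
    have i3 : 0 ≤ T * (L₀ * M * τ ^ 2) := by positivity
    have i4 : 0 ≤ T * (C₃ * h ^ 4) := by positivity
    linarith
  -- By `hEr` the sup bound now holds at every step, so L² needs no further smallness: the threshold
  -- is taken to be the Gronwall bound itself.
  have main₀ : ∀ k ≤ n, E₀ k ≤ K₀ * (τ ^ 2 + h ^ 4) := by
    intro k hk
    refine le_trans (two_step_gronwall (E := E₀) (L := L₀) (T := T)
      (r := Real.exp (L₀ * T) * ((L₀ * (M * h ^ 4) + C₄ * τ ^ 2)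
        + T * (L₀ * (M * h ^ 4) + C₃ * τ ^ 2))) (δ := L₀ * (M * h ^ 4) + C₃ * τ ^ 2)
      (d := L₀ * (M * h ^ 4) + C₄ * τ ^ 2) hτ.le hL₀0 (by positivity) (by positivity) hn
      (hell0 fun _ => 1).le (fun hn1 => ?_) (fun k hk _ => ?_) le_rfl k hk) hK₀b
    · obtain ⟨R, hRb, hR⟩ := hstart (fun _ => 1) hn1
      have i1 := hd₀ 0 (by omega) hE0r
      rw [show E₀ 0 = 0 from hell0 _, zero_add] at i1
      have i2 : 0 ≤ ell S (fun _ => 1) (d 0) := ell_nonneg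
      have i3 := mul_le_of_le_one_left i2 hτ1
      have i5 := hRb.1
      change ell S (fun _ => 1) (e 1) ≤ _
      linarith
    · obtain ⟨R, hRb, hR⟩ := hstep (fun _ => 1) k hk
      have i1 := mul_le_mul_of_nonneg_left (hd₀ (k + 1) (by omega) (hEr _ (by omega))) hτ.le
      have i2 := hRb.1
      change ell S (fun _ => 1) (e (k + 2)) ≤ ell S (fun _ => 1) (e k) + _
      linarith
  have f0 : 0 ≤ τ ^ 2 := sq_nonneg τ
  have f4 : 0 ≤ h ^ 4 := by positivity
  have f3 : 0 ≤ h ^ 3 := by positivity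
  refine ⟨(hproj₀ n le_rfl).trans ?_, (hproj₁ n le_rfl).trans ?_⟩
  · have i1 := mul_le_mul_of_nonneg_left (main₀ n le_rfl) hq0.le
    have i2 : 0 ≤ q * M * τ ^ 2 := by positivity
    have i3 : 0 ≤ 2 * q * (K₁ + M) * (τ ^ 2 + h ^ 4) := by positivity
    linarith
  · have i1 := mul_le_mul_of_nonneg_left (main₁ n le_rfl) hq0.le
    have i2 : 0 ≤ q * M * s := by positivity
    have i3 : 0 ≤ q * (K₀ + M) * (s + h ^ 3) := by positivity
    linarith

end Sol

end SEWI

namespace SEWI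

variable {a b : ℝ}

/-! ### The model attached to the equation -/

theorem exists_model (hab : a < b) {V : ℝ → ℝ} (hV : MemHper a b 2 (fun x => (V x : ℂ)))
    (β : ℝ) {σ : ℝ} (hσ : 1 ≤ σ) : ∃ Θ : Model a b, (fun x => (V x : ℂ)) =ᵐ[vol a b] Θ.V ∧
      Θ.F = fun z => (β : ℂ) * powFun σ 1 z := by
  obtain ⟨w, hw, hper⟩ := hV
  obtain ⟨U, hae, hc, hprim, hd⟩ := Hm.exists_rep hab w
  obtain ⟨P, Q, P₁, P₂, Q₁, Q₂, hF⟩ := powFun_wDeriv₂ hσ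
  refine ⟨⟨U 0, U 1, U 2, _, _, _, _, _, _, _, hab, hd 0 (by norm_num), hc 1 (by norm_num),
    hprim 1 (by norm_num), ?_, ?_, ?_, hF.const_mul β⟩, hw.symm.trans (hae 0 (by norm_num)), rfl⟩
  · exact (memLp_congr_ae (hae 2 (by norm_num))).1 (wderiv_memLp w _)
  · exact hper.rep_eq hab 0 (hc 0 (by norm_num)).continuousOn (hae 0 (by norm_num))
  · exact hper.rep_eq hab 1 (hc 1 (by norm_num)).continuousOn (hae 1 (by norm_num))

theorem B_ae_eq {Θ : Model a b} {V : ℝ → ℝ} {β σ : ℝ} (hV : (fun x => (V x : ℂ)) =ᵐ[vol a b] Θ.V)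
    (hF : Θ.F = fun z => (β : ℂ) * powFun σ 1 z) {u v : ℝ → ℂ} (h : u =ᵐ[vol a b] v) :
    B V β σ u =ᵐ[vol a b] Θ.op v := by
  filter_upwards [hV, h] with x h1 h2
  simp only [B, Model.op, hF, h1, h2, f, powFun]
  push_cast
  ring

/-! ### Regularity in time -/

section

variable {E : Type*} [NormedAddCommGroup E] [NormedSpace ℝ E] {T : ℝ} {φ : ℝ → E}

theorem exists_lipschitz_of_contDiffOn (hT : 0 < T) (h : ContDiffOn ℝ 1 φ (Icc 0 T)) :
    ∃ L : ℝ, 0 ≤ L ∧ ∀ s ∈ Icc 0 T, ∀ t ∈ Icc 0 T, ‖φ t - φ s‖ ≤ L * |t - s| := by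
  have hc := h.continuousOn_derivWithin (uniqueDiffOn_Icc hT) le_rfl
  obtain ⟨L, hL⟩ := isCompact_Icc.exists_bound_of_continuousOn hc
  refine ⟨L, (norm_nonneg _).trans (hL 0 ⟨le_rfl, hT.le⟩), fun s hs t ht => ?_⟩
  exact (convex_Icc 0 T).norm_image_sub_le_of_norm_derivWithin_le
    (h.differentiableOn one_ne_zero) hL hs ht

/-- The r-derivative of φ(t + r) + φ(t - r) is a difference of φ' at points 2r apart, hence at most
2Lr. The mean value inequality on [0, s] concludes. -/
theorem exists_second_difference_of_contDiffOn (hT : 0 < T) (h : ContDiffOn ℝ 2 φ (Icc 0 T)) :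
    ∃ L : ℝ, 0 ≤ L ∧ ∀ t s, 0 ≤ s → t - s ∈ Icc 0 T → t + s ∈ Icc 0 T →
      ‖(φ (t + s) - (2 : ℝ) • φ t) + φ (t - s)‖ ≤ L * s ^ 2 := by
  obtain ⟨L, hL, hlip⟩ := exists_lipschitz_of_contDiffOn hT
    (h.derivWithin (m := 1) (uniqueDiffOn_Icc hT) (by norm_num))
  refine ⟨2 * L, by positivity, fun t s hs hm hp => ?_⟩
  have hin : ∀ r ∈ Icc 0 s, t + r ∈ Icc 0 T ∧ t - r ∈ Icc 0 T := fun r hr =>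
    ⟨⟨by linarith [hm.1, hr.1], by linarith [hp.2, hr.2]⟩,
      ⟨by linarith [hm.1, hr.2], by linarith [hp.2, hr.1]⟩⟩
  have hd : ∀ r ∈ Icc 0 T, HasDerivWithinAt φ (derivWithin φ (Icc 0 T) r) (Icc 0 T) r :=
    fun r hr => (h.differentiableOn (by norm_num) r hr).hasDerivWithinAt
  have key := norm_image_sub_le_of_norm_deriv_le_segment' (a := 0) (b := s)
    (f := fun r => φ (t + r) + φ (t - r)) (C := 2 * L * s)
    (f' := fun r => derivWithin φ (Icc 0 T) (t + r) - derivWithin φ (Icc 0 T) (t - r))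
    (fun r hr => by
      have e1 := (hd _ (hin r hr).1).scomp r ((hasDerivWithinAt_id r (Icc 0 s)).const_add t)
        fun y hy => (hin y hy).1
      have e2 := (hd _ (hin r hr).2).scomp r ((hasDerivWithinAt_id r (Icc 0 s)).const_sub t)
        fun y hy => (hin y hy).2
      refine (e1.add e2).congr_deriv ?_
      simp [sub_eq_add_neg]) (fun r hr => by
      have hr' := Ico_subset_Icc_self hr
      refine (hlip _ (hin r hr').2 _ (hin r hr').1).trans ?_
      rw [show t + r - (t - r) = 2 * r by ring, abs_of_nonneg (by linarith [hr.1])]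
      nlinarith [mul_le_mul_of_nonneg_left hr.2.le hL]) s ⟨hs, le_rfl⟩
  have e : (φ (t + s) - (2 : ℝ) • φ t) + φ (t - s)
      = φ (t + s) + φ (t - s) - (φ (t + 0) + φ (t - 0)) := by
    rw [add_zero, sub_zero, two_smul]; abel
  rw [e]
  refine key.trans (le_of_eq ?_)
  ring

end

/-- The Fourier coefficient of index `l`, as a continuous linear functional on `L²(Ω)`. -/
noncomputable def coefCLM (hab : a < b) (l : ℤ) : L2 a b →L[ℝ] ℂ :=
  LinearMap.mkContinuous
    { toFun := fun u => fourierCoef a b u l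
      map_add' := fun u v => by
        rw [fourierCoef_congr (Lp.coeFn_add u v)]
        exact fourierCoef_add (integrable_of_memLp (Lp.memLp u))
          (integrable_of_memLp (Lp.memLp v)) l
      map_smul' := fun c u => by
        rw [fourierCoef_congr (Lp.coeFn_smul c u)]
        have e : c • (u : ℝ → ℂ) = fun x => (c : ℂ) * u x := by ext x; simp
        rw [e, fourierCoef_const_mul, RingHom.id_apply, Complex.real_smul] }
    ((Real.sqrt (b - a))⁻¹) fun u =>
      (norm_le_ell_singleton (ν := fun _ => 1) le_rfl).trans
        (ell_fourierCoef_le hab (Lp.memLp u))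

theorem coefCLM_apply (hab : a < b) (l : ℤ) (u : L2 a b) :
    coefCLM hab l u = fourierCoef a b u l := rfl

theorem nrm_sub_eq {u v : L2 a b} {u' v' : ℝ → ℂ} (hu : u =ᵐ[vol a b] u') (hv : v =ᵐ[vol a b] v') :
    nrm a b (fun x => u' x - v' x) = ‖u - v‖ := by
  rw [← nrm_coeFn]
  refine nrm_congr ?_
  filter_upwards [hu, hv, Lp.coeFn_sub u v] with x h1 h2 h3
  rw [h3, Pi.sub_apply, h1, h2]

theorem norm_wderiv_le {m : ℕ} (w : Hm a b m) (k : Fin (m + 1)) : ‖wderiv w k‖ ≤ ‖w‖ :=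
  PiLp.norm_apply_le w.1 k

theorem norm_wderiv_sub_le {m : ℕ} (w w' : Hm a b m) (k : Fin (m + 1)) :
    ‖wderiv w k - wderiv w' k‖ ≤ ‖w - w'‖ :=
  PiLp.norm_apply_le (w - w').1 k

/-- One family of representatives, taken from the H⁴ path, carries all bounds: sup norms by Sobolev,
time Lipschitz bounds from C¹ into H², second differences from C² into L², and the tail from four
integrations by parts. -/
theorem exists_sol (hab : a < b) {T : ℝ} (hT : 0 < T) {V : ℝ → ℝ} {β σ : ℝ} {Θ : Model a b}
    (hV : (fun x => (V x : ℂ)) =ᵐ[vol a b] Θ.V) (hF : Θ.F = fun z => (β : ℂ) * powFun σ 1 z)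
    {ψ₀ : L2 a b} {ψ : ℝ → L2 a b} (hsol : IsNLSESolution a b T V β σ ψ₀ ψ)
    (hC0 : IsCjHm a b T 0 4 ψ) (hper : ∀ t ∈ Icc 0 T, MemHper a b 4 (ψ t))
    (hC1 : IsCjHm a b T 1 2 ψ) (hC2 : ContDiffOn ℝ 2 ψ (Icc 0 T)) :
    ∃ (M : ℝ) (U U₁ U₂ : ℝ → ℝ → ℂ), Sol Θ T M U U₁ U₂ ∧ ∀ t ∈ Icc 0 T, ψ t =ᵐ[vol a b] U t := by
  obtain ⟨Ψ, hΨc, hΨ⟩ := hC0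
  obtain ⟨Φ, hΦc, hΦ⟩ := hC1
  choose R hae hcont hprim hder using fun t => Hm.exists_rep hab (Ψ t)
  have hpd : 0 < b - a := sub_pos.2 hab
  have hΨc' : ContinuousOn Ψ (Icc 0 T) := contDiffOn_zero.1 hΨc
  obtain ⟨M₄, hM₄⟩ := isCompact_Icc.exists_bound_of_continuousOn hΨc'
  have hM₄0 : 0 ≤ M₄ := (norm_nonneg _).trans (hM₄ 0 ⟨le_rfl, hT.le⟩)
  obtain ⟨L, hL, hlip⟩ := exists_lipschitz_of_contDiffOn hT hΦc
  obtain ⟨D, hD, hsec⟩ := exists_second_difference_of_contDiffOn hT hC2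
  set q := Real.sqrt (b - a) with hq
  have hq0 : 0 < q := Real.sqrt_pos.2 hpd
  set Cs := q / (b - a) + q with hCs
  have hCs0 : 0 < Cs := by positivity
  set M := 2 * Cs * M₄ + 2 * Cs * L + L + D + q⁻¹ * M₄ with hM
  have h1 : 0 ≤ 2 * Cs * M₄ := by positivity
  have h2 : 0 ≤ 2 * Cs * L := by positivity
  have h3 : 0 ≤ q⁻¹ * M₄ := by positivity
  have hmem : ∀ t k, k < 5 → MemLp (R t k) 2 (vol a b) := fun t k hk =>
    (memLp_congr_ae (hae t k hk)).1 (wderiv_memLp _ _)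
  have hψ : ∀ t ∈ Icc 0 T, ψ t =ᵐ[vol a b] R t 0 := fun t ht => by
    have := hae t 0 (by norm_num)
    rwa [show wderiv (Ψ t) ⟨0, by norm_num⟩ = ψ t from hΨ t ht] at this
  -- Periodicity is given for another H⁴ witness of the same L² class; uniqueness of weak
  -- derivatives transfers it.
  have hpers : ∀ t ∈ Icc 0 T, ∀ k, k < 4 → R t k a = R t k b := by
    intro t ht k hk
    obtain ⟨w, hw, hwp⟩ := hper t ht
    have e : toL2 w = toL2 (Ψ t) := (Lp.ext hw).trans (hΨ t ht).symm
    refine hwp.rep_eq hab ⟨k, hk⟩ (hcont t k hk).continuousOn ?_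
    have := Hm.wderiv_unique w (Ψ t) e k (by omega) (by omega)
    change wderiv w ⟨k, by omega⟩ =ᵐ[vol a b] _
    rw [this]
    exact hae t k (by omega)
  have hnrm : ∀ t ∈ Icc 0 T, ∀ k (hk : k < 5), nrm a b (R t k) ≤ M₄ := fun t ht k hk => by
    rw [← nrm_congr (hae t k hk), nrm_coeFn]
    exact (norm_wderiv_le _ _).trans (hM₄ t ht)
  have hsup : ∀ t ∈ Icc 0 T, ∀ k, k < 4 → ∀ x ∈ Icc a b, ‖R t k x‖ ≤ M := by
    intro t ht k hk x hx
    have i1 := (hprim t k hk).norm_le hab (hmem t (k + 1) (by omega)) hx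
    have i2 := mul_le_mul_of_nonneg_left (add_le_add (hnrm t ht k (by omega))
      (hnrm t ht (k + 1) (by omega))) hCs0.le
    linarith
  -- In H⁴ the path is merely continuous in time, so the Lipschitz bound is taken from the H² path
  -- `Φ`, whose derivatives agree with those of `Ψ` up to order two.
  have hdiff : ∀ s ∈ Icc 0 T, ∀ t ∈ Icc 0 T, ∀ k, k < 3 →
      nrm a b (fun x => R t k x - R s k x) ≤ L * |t - s| := by
    intro s hs t ht k hk
    have et := Hm.wderiv_unique (Ψ t) (Φ t) ((hΨ t ht).trans (hΦ t ht).symm) k (by omega) hk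
    have es := Hm.wderiv_unique (Ψ s) (Φ s) ((hΨ s hs).trans (hΦ s hs).symm) k (by omega) hk
    rw [nrm_sub_eq (hae t k (by omega)) (hae s k (by omega)), et, es]
    exact (norm_wderiv_sub_le _ _ _).trans (hlip s hs t ht)
  have hLM : ∀ s t : ℝ, L * |t - s| ≤ M * |t - s| := fun s t =>
    mul_le_mul_of_nonneg_right (by linarith) (abs_nonneg _)
  have hdiffsup : ∀ s ∈ Icc 0 T, ∀ t ∈ Icc 0 T, ∀ k, k < 2 → ∀ x ∈ Icc a b,
      ‖R t k x - R s k x‖ ≤ M * |t - s| := by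
    intro s hs t ht k hk x hx
    have i1 := ((hprim t k (by omega)).sub (hprim s k (by omega))).norm_le hab
      ((hmem t (k + 1) (by omega)).sub (hmem s (k + 1) (by omega))) hx
    have i2 := mul_le_mul_of_nonneg_left (add_le_add (hdiff s hs t ht k (by omega))
      (hdiff s hs t ht (k + 1) (by omega))) hCs0.le
    have i3 : 2 * Cs * L * |t - s| ≤ M * |t - s| :=
      mul_le_mul_of_nonneg_right (by linarith) (abs_nonneg _)
    linarith
  have hC1s : ∀ t ∈ Icc 0 T, ∀ k, k < 3 → PerC1 a b (R t k) (R t (k + 1)) := fun t ht k hk =>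
    ⟨hder t k (by omega), hcont t (k + 1) (by omega), hpers t ht k (by omega)⟩
  have hcoef : ∀ t ∈ Icc 0 T, ∀ k, k < 4 → ∀ l, fourierCoef a b (R t (k + 1)) l
      = Complex.I * freq a b l * fourierCoef a b (R t k) l := fun t ht k hk l =>
    (hprim t k hk).fourierCoef_eq hab (hpers t ht k hk) l
  refine ⟨M, fun t => R t 0, fun t => R t 1, fun t => R t 2, ⟨by linarith, ?_, ?_, ?_, ?_, ?_, ?_,
    ?_, ?_⟩, hψ⟩
  · exact fun t ht => ⟨hC1s t ht 0 (by norm_num), hC1s t ht 1 (by norm_num)⟩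
  · exact fun t ht x hx => ⟨hsup t ht 0 (by norm_num) x hx, hsup t ht 1 (by norm_num) x hx,
      hsup t ht 2 (by norm_num) x hx⟩
  · exact fun s hs t ht => hdiffsup s hs t ht 0 (by norm_num)
  · exact fun s hs t ht => hdiffsup s hs t ht 1 (by norm_num)
  · exact fun s hs t ht => (hdiff s hs t ht 2 (by norm_num)).trans (hLM s t)
  · intro t s hs hm hp
    have ht : t ∈ Icc 0 T := ⟨by linarith [hm.1], by linarith [hp.2]⟩
    have e : (fun x => R (t + s) 0 x - 2 * R t 0 x + R (t - s) 0 x) =ᵐ[vol a b]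
        ((ψ (t + s) - (2 : ℝ) • ψ t) + ψ (t - s) : L2 a b) := by
      filter_upwards [Lp.coeFn_add (ψ (t + s) - (2 : ℝ) • ψ t) (ψ (t - s)),
        Lp.coeFn_sub (ψ (t + s)) ((2 : ℝ) • ψ t), Lp.coeFn_smul (2 : ℝ) (ψ t), hψ _ hp, hψ _ ht,
        hψ _ hm] with x e1 e2 e3 e4 e5 e6
      rw [e1, Pi.add_apply, e2, Pi.sub_apply, e3, Pi.smul_apply, e4, e5, e6]
      simp
    rw [nrm_congr e, nrm_coeFn]
    exact (hsec t s hs hm hp).trans (mul_le_mul_of_nonneg_right (by linarith) (sq_nonneg _))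
  · intro l t ht
    have htI := Ioo_subset_Icc_self ht
    have hn : Icc 0 T ∈ 𝓝 t := Icc_mem_nhds ht.1 ht.2
    have hdψ : HasDerivAt ψ (derivWithin ψ (Icc 0 T) t) t :=
      (hsol.2.1 t htI).hasDerivWithinAt.hasDerivAt hn
    have hd := (coefCLM hab l).hasFDerivAt.comp_hasDerivAt t hdψ
    obtain ⟨w, hw, hweq⟩ := hsol.2.2 t (Ioo_subset_Ioc_self ht)
    have hw2 : wderiv w 2 =ᵐ[vol a b] R t 2 := by
      have := Hm.wderiv_unique w (Ψ t) (hw.trans (hΨ t htI).symm) 2 (by norm_num) (by norm_num)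
      change wderiv w ⟨2, by norm_num⟩ =ᵐ[vol a b] _
      rw [this]
      exact hae t 2 (by norm_num)
    have hop := B_ae_eq hV hF (hψ t htI)
    have hcop := Θ.op_continuous (hC1s t htI 0 (by norm_num)).continuous
    -- The equation is solved for ∂_t ψ by multiplying with -i; a bounded functional then turns it
    -- into an ODE for each mode.
    have he : (derivWithin ψ (Icc 0 T) t : L2 a b) =ᵐ[vol a b]
        fun x => -Complex.I * (Θ.op (R t 0) x - R t 2 x) := by
      filter_upwards [hweq, hw2, hop] with x e1 e2 e3
      rw [e2, e3] at e1
      linear_combination (-Complex.I) * e1 + (derivWithin ψ (Icc 0 T) t : L2 a b) x * Complex.I_sq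
    have hval : coefCLM hab l (derivWithin ψ (Icc 0 T) t)
        = -Complex.I * ((freq a b l ^ 2 : ℝ) * fourierCoef a b (R t 0) l
          + fourierCoef a b (Θ.op (R t 0)) l) := by
      rw [coefCLM_apply, fourierCoef_congr he, fourierCoef_const_mul,
        fourierCoef_sub (integrable_of_continuous hcop)
        (integrable_of_continuous (hcont t 2 (by norm_num))), hcoef t htI 1 (by norm_num),
        hcoef t htI 0 (by norm_num)]
      push_cast
      linear_combination (Complex.I * (freq a b l : ℂ) ^ 2 * fourierCoef a b (R t 0) l)
        * Complex.I_sq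
    rw [← hval]
    refine hd.congr_of_eventuallyEq ?_
    filter_upwards [hn] with s hs
    exact fourierCoef_congr (hψ s hs).symm l
  · intro t ht S
    have e : ell S (fun l => freq a b l ^ 4) (fourierCoef a b (R t 0))
        ≤ 1 * ell S (fun _ => 1) (fourierCoef a b (R t 4)) := by
      refine ell_mono_weight zero_le_one (fun l => (by decide : Even 4).pow_nonneg _) fun l _ => ?_
      rw [hcoef t ht 3 (by norm_num), hcoef t ht 2 (by norm_num), hcoef t ht 1 (by norm_num),
        hcoef t ht 0 (by norm_num)]
      simp only [norm_mul, Complex.norm_I, one_mul, Complex.norm_real, Real.norm_eq_abs]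
      rw [← (by decide : Even 4).pow_abs]
      exact le_of_eq (by ring)
    have e2 := ell_fourierCoef_le (S := S) hab (hmem t 4 (by norm_num))
    have e3 := mul_le_mul_of_nonneg_left (hnrm t ht 4 (by norm_num)) (inv_nonneg.2 hq0.le)
    linarith

/-! ### The fully discrete solution and the norms of the error -/

theorem trigPoly_congr {N : ℕ} {c d : ℤ → ℂ} (h : ∀ l ∈ indexSet N, c l = d l) :
    trigPoly a b N c = trigPoly a b N d := by
  ext x
  exact Finset.sum_congr rfl fun l hl => by rw [h l hl]

/-- `coefs` evolves every integer mode, while `psih` rereads coefficients from a truncated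
polynomial. They agree on the index set, which is all that `trigPoly` sees. -/
theorem psih_eq {V : ℝ → ℝ} {β σ : ℝ} {Θ : Model a b}
    (hV : (fun x => (V x : ℂ)) =ᵐ[vol a b] Θ.V) (hF : Θ.F = fun z => (β : ℂ) * powFun σ 1 z)
    {ψ₀ u₀ : ℝ → ℂ} (h₀ : ψ₀ =ᵐ[vol a b] u₀) (N : ℕ) (τ : ℝ) (n : ℕ) :
    psih a b V β σ ψ₀ N τ n = trigPoly a b N (coefs Θ N τ (fourierCoef a b u₀) n) := by
  have hB : ∀ u : ℝ → ℂ, ∀ l, fourierCoef a b (B V β σ u) l = fourierCoef a b (Θ.op u) l :=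
    fun u l => fourierCoef_congr (B_ae_eq hV hF (ae_eq_refl u)) l
  induction n using Nat.strong_induction_on with
  | _ n ih =>
    match n, ih with
    | 0, _ =>
      rw [psih, coefs]
      exact trigPoly_congr fun l _ => fourierCoef_congr h₀ l
    | 1, ih =>
      have i0 := ih 0 (by omega)
      rw [psih, coefs]
      refine trigPoly_congr fun l hl => ?_
      rw [i0, hB, fourierCoef_trigPoly Θ.hab, if_pos hl, coefs]
    | n + 2, ih =>
      have i0 := ih n (by omega)
      have i1 := ih (n + 1) (by omega)
      rw [psih, coefs]
      refine trigPoly_congr fun l hl => ?_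
      rw [i0, i1, hB, fourierCoef_trigPoly Θ.hab, if_pos hl]

theorem eLpNorm_eq_ofReal_nrm {u : ℝ → ℂ} (hu : MemLp u 2 (vol a b)) :
    eLpNorm u 2 (vol a b) = ENNReal.ofReal (nrm a b u) :=
  (ENNReal.ofReal_toReal hu.2.ne).symm

/-- The norm is an infimum over Sobolev elements representing `g`, so exhibiting the pair (g, g₁)
bounds it. -/
theorem HmNorm_one_le (hab : a ≤ b) {g g₁ : ℝ → ℂ} (hg : IsPrim a b g g₁)
    (hg₁ : MemLp g₁ 2 (vol a b)) :
    HmNorm a b 1 g ≤ ENNReal.ofReal (nrm a b g + nrm a b g₁) := by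
  have hgm := memLp_of_continuousOn (hg.continuousOn hab)
  let w : Hm a b 1 := ⟨WithLp.toLp 2 ![hgm.toLp g, hg₁.toLp g₁], fun k => by
    fin_cases k
    exact (hg.isWeakDeriv hab).congr hgm.coeFn_toLp.symm hg₁.coeFn_toLp.symm⟩
  have hw : toL2 w =ᵐ[vol a b] g := hgm.coeFn_toLp
  refine (iInf₂_le w hw).trans ?_
  rw [← ofReal_norm]
  refine ENNReal.ofReal_le_ofReal ?_
  refine le_of_sq_le_sq ?_ (add_nonneg (nrm_nonneg _) (nrm_nonneg _))
  have e : ‖w‖ ^ 2 = nrm a b g ^ 2 + nrm a b g₁ ^ 2 := by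
    change ‖w.1‖ ^ 2 = _
    rw [PiLp.norm_sq_eq_of_L2, Fin.sum_univ_two]
    change ‖hgm.toLp g‖ ^ 2 + ‖hg₁.toLp g₁‖ ^ 2 = _
    rw [Lp.norm_toLp, Lp.norm_toLp]
    rfl
  rw [e]
  nlinarith [nrm_nonneg (a := a) (b := b) g, nrm_nonneg (a := a) (b := b) g₁]

theorem HmNorm_congr {m : ℕ} {u v : ℝ → ℂ} (h : u =ᵐ[vol a b] v) :
    HmNorm a b m u = HmNorm a b m v := by
  rw [HmNorm, HmNorm]
  refine iInf_congr fun w => iInf_congr_Prop ⟨fun hw => hw.trans h, fun hw => hw.trans h.symm⟩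
    fun _ => rfl

end SEWI

/-! ### The error estimates -/

theorem theorem4p1 (a b T : ℝ) (hab : a < b) (hT : 0 < T)
    (V : ℝ → ℝ) (hV : SEWI.MemHper a b 2 (fun x => (V x : ℂ)))
    (β σ : ℝ) (hσ : 1 ≤ σ)
    (ψ₀ : SEWI.L2 a b) (ψ : ℝ → SEWI.L2 a b)
    (hsol : SEWI.IsNLSESolution a b T V β σ ψ₀ ψ)
    (hC0 : SEWI.IsCjHm a b T 0 4 ψ)
    (hper : ∀ t ∈ Icc 0 T, SEWI.MemHper a b 4 (ψ t))
    (hC1 : SEWI.IsCjHm a b T 1 2 ψ)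
    (hC2 : ContDiffOn ℝ 2 ψ (Icc 0 T)) :
    ∃ τ₀ > 0, ∃ h₀ > 0, ∃ C > 0, ∀ τ : ℝ, 0 < τ → τ < τ₀ →
      ∀ N : ℕ, 0 < N → Even N → ∀ h : ℝ, h = (b - a) / N → h < h₀ →
        ∀ n : ℕ, (n : ℝ) ≤ T / τ →
          eLpNorm (fun x => ψ (n * τ) x - SEWI.psih a b V β σ ψ₀ N τ n x) 2 (SEWI.vol a b)
              ≤ ENNReal.ofReal (C * (τ ^ 2 + h ^ 4)) ∧
          SEWI.HmNorm a b 1 (fun x => ψ (n * τ) x - SEWI.psih a b V β σ ψ₀ N τ n x)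
              ≤ ENNReal.ofReal (C * (τ ^ (3 / 2 : ℝ) + h ^ 3)) := by
  obtain ⟨Θ, hΘV, hΘF⟩ := SEWI.exists_model hab hV β hσ
  obtain ⟨M, U, U₁, U₂, hU, hψU⟩ := SEWI.exists_sol hab hT hΘV hΘF hsol hC0 hper hC1 hC2
  obtain ⟨ε, hε, C, hC, herr⟩ := hU.error hT
  -- `Sol.error` only provides C ≥ 0; adding 1 makes the constant positive.
  refine ⟨ε, hε, ε, hε, C + 1, by positivity, fun τ hτ hτε N hN hN2 h hh hhε n hn => ?_⟩
  have hn' : n * τ ≤ T := (le_div_iff₀ hτ).1 hn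
  have ht : n * τ ∈ Icc 0 T := ⟨by positivity, hn'⟩
  have hh0 : 0 ≤ h := by
    rw [hh]; exact div_nonneg (sub_pos.2 hab).le (Nat.cast_nonneg _)
  have h₀ : ψ₀ =ᵐ[SEWI.vol a b] U 0 := by
    rw [← hsol.1]; exact hψU 0 ⟨le_rfl, hT.le⟩
  obtain ⟨e1, e2⟩ := herr τ hτ hτε N hN hN2 h hh hhε n hn'
  rw [SEWI.psih_eq hΘV hΘF h₀]
  set c := SEWI.coefs Θ N τ (SEWI.fourierCoef a b (U 0)) n
  have hs := (hU.smooth _ ht).zero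
  have hp := SEWI.trigPoly_perC1 hab N c
  have hae : (fun x => ψ (n * τ) x - SEWI.trigPoly a b N c x) =ᵐ[SEWI.vol a b]
      fun x => U (n * τ) x - SEWI.trigPoly a b N c x :=
    (hψU _ ht).mono fun x hx => by simp only [hx]
  constructor
  · rw [eLpNorm_congr_ae hae, SEWI.eLpNorm_eq_ofReal_nrm
      (u := fun x => U (n * τ) x - SEWI.trigPoly a b N c x)
      (SEWI.memLp_of_continuous (hs.continuous.sub hp.continuous))]
    refine ENNReal.ofReal_le_ofReal (e1.trans (mul_le_mul_of_nonneg_right (by linarith) ?_))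
    positivity
  · rw [SEWI.HmNorm_congr hae]
    refine (SEWI.HmNorm_one_le hab.le (hs.isPrim.sub hp.isPrim)
      (SEWI.memLp_of_continuous (hs.c.sub hp.c))).trans ?_
    refine ENNReal.ofReal_le_ofReal (e2.trans (mul_le_mul_of_nonneg_right (by linarith) ?_))
    positivity
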